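/- **Setting.** For $k\in\mathbb Z^2_0=\mathbb Z^2\setminus\{0\}$ let $k^\perp=(-k_2,k_1)$ and let $h_k(\xi)=\frac1{2\pi}\frac{k^\perp}{|k|}e^{ik\cdot\xi}$ on the torus $\mathbb T=[0,2\pi]^2$ with periodic boundary conditions. For $r\in\mathbb R$ let $$\mathcal H^r=\Big\{v=\sum_{k\in\mathbb Z^2_0}v_kh_k:\ v_{-k}=-\overline{v_k}\ \text{for all }k,\ \|v\|_{\mathcal H^r}^2=\sum_{k}|k|^{2r}|v_k|^2<\infty\Big\},$$ and write $\langle u,\varphi\rangle=\sum_k u_k\overline{\varphi_k}$ for the $\mathcal H^{-r}$–$\mathcal H^{r}$ duality. Let $A=\Delta$, i.e. $(Av)_k=-|k|^2v_k$, and let $B(u,v)=P[(u\cdot\nabla)v]$, where $P$ is the projection onto divergence free fields, i.e. $B(u,v)=\sum_kB_k(u,v)h_k$ with $$B_k(u,v)=i\sum_{h\in\mathbb Z^2_0,\,h\ne k}\gamma_{h,k}\,u_hv_{k-h},\qquad \gamma_{h,k}=\frac1{2\pi}\frac{(h^\perp\cdot k)\,((k-h)\cdot k)}{|h|\,|k-h|\,|k|}.$$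 Let $\mathbb Z^2_+=\{k\in\mathbb Z^2: k_1>0\}\cup\{k\in\mathbb Z^2: k_1=0,\ k_2>0\}$. On a probability space $(\Omega,\mathcal F,\mathbb P)$ let $b_k$ $(k\in\mathbb Z^2_+)$ be complex-valued processes indexed by $t\in\mathbb R$ whose real and imaginary parts are all independent real fractional Brownian motions of Hurst parameter $H$, i.e. centered Gaussian processes with covariance $\frac12(|t|^{2H}+|s|^{2H}-|t-s|^{2H})$; put $b_{-k}=-\overline{b_k}$ for $k\in\mathbb Z^2_+$, and let $w^H(t)=\sum_{k\in\mathbb Z^2_0}b_k(t)h_k$ be the corresponding cylindrical fractional Brownian motion. Let $T>0$ and $v_0\in\mathcal H^\sigma$. A $C([0,T];\mathcal H^\sigma)$-valued process $v$ on $\Omega$ is a *solution* of the stochastic Navier–Stokes equation (with unit viscosity) $$dv=Av\,dt-B(v,v)\,dt+dw^H,\qquad v(0)=v_0,$$ if $v(0)=v_0$ almost surely and, for every $t\in[0,T]$ and every $\varphi\in\mathcal H^{2-\sigma}$, almost surely $$\langle v(t)-v_0,\varphi\rangle-\int_0^t\langle Av(s),\varphi\rangle\,ds+\int_0^t\langle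 B(v(s),v(s)),\varphi\rangle\,ds=\langle w^H(t),\varphi\rangle .$$ **Theorem (Uniqueness).** Let $\frac12<H<1$ and $0<\sigma<2(H-\frac12)$. For every $T>0$ and every $v_0\in\mathcal H^\sigma$ there exists a unique $C([0,T];\mathcal H^\sigma)$-valued process solving the stochastic Navier–Stokes equation with initial value $v_0$. That is, on the given probability space and for the given noise a solution exists, and it is pathwise unique: if $v_1,v_2$ are two solutions on that space with the same noise and the same $v_0$, then almost surely $v_1(t)=v_2(t)$ for all $t\in[0,T]$. -/

import Mathlib

open MeasureTheory ProbabilityTheory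
open scoped ComplexConjugate

noncomputable section

namespace FractionalNS

/-! ### Fourier modes on the torus `[0, 2π]²`

A mean zero, divergence free periodic vector field is written `v = ∑_{k ≠ 0} v_k h_k`, with
`h_k(ξ) = (2π)⁻¹ (k^⊥ / |k|) exp(i k · ξ)` and `k^⊥ = (-k₂, k₁)`; it is represented by its
family of coefficients `(v_k)`, where `v_0 = 0` by convention.
Since `h_{-k} = - conj h_k`, the field is real exactly when `v_{-k} = - conj v_k`. -/

/-- The Euclidean length `|k|`. -/
def modeNorm (k : ℤ × ℤ) : ℝ := Real.sqrt ((k.1 : ℝ) ^ 2 + (k.2 : ℝ) ^ 2)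

/-- The dot product `h · k`. -/
def modeDot (h k : ℤ × ℤ) : ℝ := (h.1 : ℝ) * k.1 + (h.2 : ℝ) * k.2

/-- The rotated vector `k^⊥`. -/
def modePerp (k : ℤ × ℤ) : ℤ × ℤ := (-k.2, k.1)

/-- The half lattice `ℤ²₊`; the nonzero modes are the disjoint union of `ℤ²₊` and `-ℤ²₊`. -/
def halfLattice : Set (ℤ × ℤ) := {k | 0 < k.1 ∨ (k.1 = 0 ∧ 0 < k.2)}

theorem modeNorm_pos {k : ℤ × ℤ} (hk : k ≠ 0) : 0 < modeNorm k := by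
  apply Real.sqrt_pos.2
  by_cases h1 : k.1 = 0
  · have h2 : (k.2 : ℝ) ≠ 0 := by
      intro h
      exact hk (Prod.ext h1 (by exact_mod_cast h))
    positivity
  · have h2 : (k.1 : ℝ) ≠ 0 := by exact_mod_cast h1
    positivity

theorem modeNorm_nonneg (k : ℤ × ℤ) : 0 ≤ modeNorm k := Real.sqrt_nonneg _

/-! ### The spaces `ℋ^r` -/

/-- `(v_k)` is the coefficient family of an element of `ℋ^r`: mean zero, real, and
`∑ |k|^{2r} |v_k|² < ∞`. -/
def IsSobolev (r : ℝ) (v : ℤ × ℤ → ℂ) : Prop :=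
  v 0 = 0 ∧ (∀ k, v (-k) = -conj (v k)) ∧
    Summable fun k => modeNorm k ^ (2 * r) * ‖v k‖ ^ 2

/-- The family `(|k|^r v_k)`. -/
def weighted (r : ℝ) (v : ℤ × ℤ → ℂ) (k : ℤ × ℤ) : ℂ := ((modeNorm k ^ r : ℝ) : ℂ) * v k

theorem norm_weighted_sq (r : ℝ) (v : ℤ × ℤ → ℂ) (k : ℤ × ℤ) :
    ‖weighted r v k‖ ^ 2 = modeNorm k ^ (2 * r) * ‖v k‖ ^ 2 := by
  rw [weighted, norm_mul, mul_pow, Complex.norm_real, Real.norm_eq_abs, sq_abs, mul_comm 2 r,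
    Real.rpow_mul (modeNorm_nonneg k), Real.rpow_two]

theorem summable_iff_memℓp (r : ℝ) (v : ℤ × ℤ → ℂ) :
    (Summable fun k => modeNorm k ^ (2 * r) * ‖v k‖ ^ 2) ↔ Memℓp (weighted r v) 2 := by
  rw [memℓp_gen_iff (by norm_num)]
  simp [← norm_weighted_sq]

/-- `ℋ^r` as a real vector space of coefficient families. -/
def sobolevSubmodule (r : ℝ) : Submodule ℝ (ℤ × ℤ → ℂ) where
  carrier := {v | IsSobolev r v}
  zero_mem' := ⟨rfl, by simp, by simp⟩
  add_mem' := by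
    rintro u v ⟨hu0, hu1, hu2⟩ ⟨hv0, hv1, hv2⟩
    refine ⟨by simp [hu0, hv0], fun k => ?_, ?_⟩
    · simp [hu1 k, hv1 k, add_comm]
    · rw [summable_iff_memℓp] at hu2 hv2 ⊢
      convert hu2.add hv2 using 1
      ext k
      simp [weighted, mul_add]
  smul_mem' := by
    rintro c v ⟨hv0, hv1, hv2⟩
    refine ⟨by simp [hv0], fun k => ?_, ?_⟩
    · simp [hv1 k]
    · rw [summable_iff_memℓp] at hv2 ⊢
      convert hv2.const_smul c using 1
      ext k
      simp [weighted]
      ring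

/-- The Hilbert space `ℋ^r`, with the norm `(∑ |k|^{2r} |v_k|²)^{1/2}`. -/
def HSob (r : ℝ) : Type := sobolevSubmodule r

instance (r : ℝ) : AddCommGroup (HSob r) := inferInstanceAs (AddCommGroup (sobolevSubmodule r))

instance (r : ℝ) : Module ℝ (HSob r) := inferInstanceAs (Module ℝ (sobolevSubmodule r))

/-- The coefficient family of an element of `ℋ^r`. -/
def HSob.coeff {r : ℝ} (v : HSob r) : ℤ × ℤ → ℂ := v.1

theorem HSob.isSobolev {r : ℝ} (v : HSob r) : IsSobolev r v.coeff := v.2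

/-- The map `v ↦ (|k|^r v_k)` from `ℋ^r` to `ℓ²`. -/
def HSob.toLp (r : ℝ) : HSob r →ₗ[ℝ] lp (fun _ : ℤ × ℤ => ℂ) 2 where
  toFun v := ⟨weighted r v.coeff, (summable_iff_memℓp r v.coeff).1 v.isSobolev.2.2⟩
  map_add' u v := by
    ext k
    exact mul_add _ _ _
  map_smul' c v := by
    ext k
    change ((modeNorm k ^ r : ℝ) : ℂ) * (c • v.coeff k) =
      c • (((modeNorm k ^ r : ℝ) : ℂ) * v.coeff k)
    exact mul_smul_comm _ _ _

theorem HSob.toLp_injective (r : ℝ) : Function.Injective (HSob.toLp r) := by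
  intro u v huv
  apply Subtype.ext
  funext k
  by_cases hk : k = 0
  · subst hk
    exact u.isSobolev.1.trans v.isSobolev.1.symm
  · have h1 : ((modeNorm k ^ r : ℝ) : ℂ) * u.coeff k = ((modeNorm k ^ r : ℝ) : ℂ) * v.coeff k :=
      congrFun (congrArg Subtype.val huv) k
    have h2 : ((modeNorm k ^ r : ℝ) : ℂ) ≠ 0 := by
      exact_mod_cast (Real.rpow_pos_of_pos (modeNorm_pos hk) r).ne'
    exact mul_left_cancel₀ h2 h1

instance (r : ℝ) : NormedAddCommGroup (HSob r) :=
  NormedAddCommGroup.induced (HSob r) (lp (fun _ : ℤ × ℤ => ℂ) 2) (HSob.toLp r)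
    (HSob.toLp_injective r)

instance (r : ℝ) : NormedSpace ℝ (HSob r) :=
  NormedSpace.induced ℝ (HSob r) (lp (fun _ : ℤ × ℤ => ℂ) 2) (HSob.toLp r)

instance (r : ℝ) : MeasurableSpace (HSob r) := borel (HSob r)

instance (r : ℝ) : BorelSpace (HSob r) := ⟨rfl⟩

theorem HSob.norm_sq {r : ℝ} (v : HSob r) :
    ‖v‖ ^ 2 = ∑' k, modeNorm k ^ (2 * r) * ‖v.coeff k‖ ^ 2 := by
  have h := lp.norm_rpow_eq_tsum (p := 2) (by norm_num) (HSob.toLp r v)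
  simp only [ENNReal.toReal_ofNat, Real.rpow_two] at h
  calc ‖v‖ ^ 2 = ‖HSob.toLp r v‖ ^ 2 := rfl
    _ = ∑' k, ‖weighted r v.coeff k‖ ^ 2 := h
    _ = _ := by simp only [norm_weighted_sq]

/-! ### The operators of the Navier-Stokes equation -/

/-- The duality bracket `⟨u, φ⟩ = ∑_k u_k conj φ_k` between `ℋ^{-r}` and `ℋ^r`. -/
def bracket (u φ : ℤ × ℤ → ℂ) : ℂ := ∑' k, u k * conj (φ k)

/-- The Stokes operator `A = Δ`, that is `(A v)_k = -|k|² v_k`. -/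
def stokes (v : ℤ × ℤ → ℂ) (k : ℤ × ℤ) : ℂ := -((modeNorm k ^ 2 : ℝ) : ℂ) * v k

/-- `γ_{h,k} = (2π)⁻¹ (h^⊥ · k) ((k - h) · k) / (|h| |k - h| |k|)`; the projection of
`(h_h · ∇) h_{k-h}` on divergence free fields is `i γ_{h,k} h_k`. -/
def gammaCoeff (h k : ℤ × ℤ) : ℝ :=
  1 / (2 * Real.pi) * (modeDot (modePerp h) k * modeDot (k - h) k) /
    (modeNorm h * modeNorm (k - h) * modeNorm k)

/-- The coefficients of `B(u, v) = P[(u · ∇) v]`, where `P` is the projection on divergence free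
fields: `B_k(u, v) = i ∑_{h ≠ 0, k} γ_{h,k} u_h v_{k-h}`. -/
def nonlin (u v : ℤ × ℤ → ℂ) (k : ℤ × ℤ) : ℂ :=
  Complex.I * ∑' h : {h : ℤ × ℤ // h ≠ 0 ∧ h ≠ k}, (gammaCoeff h k : ℂ) * u h * v (k - h)

/-! ### The noise -/

variable {Ω : Type*} [MeasurableSpace Ω]

/-- A real fractional Brownian motion `(X_t)_{t ∈ ℝ}` of Hurst parameter `H`: a centered Gaussian
process with covariance `(|t|^{2H} + |s|^{2H} - |t-s|^{2H}) / 2`. -/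
structure IsFractionalBrownian (H : ℝ) (X : ℝ → Ω → ℝ) (μ : Measure Ω) : Prop where
  measurable : ∀ t, Measurable (X t)
  gaussian : IsGaussianProcess X μ
  centered : ∀ t, ∫ ω, X t ω ∂μ = 0
  covariance : ∀ t s, covariance (X t) (X s) μ =
    1 / 2 * (|t| ^ (2 * H) + |s| ^ (2 * H) - |t - s| ^ (2 * H))

/-- `(b_k)_{k ∈ ℤ²₊}` is a sequence of independent complex fractional Brownian motions: all the
real and imaginary parts are independent (as processes) real fractional Brownian motions. -/
structure IsComplexFBMFamily (H : ℝ) (b : halfLattice → ℝ → Ω → ℂ) (μ : Measure Ω) : Prop where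
  fbm_re : ∀ k, IsFractionalBrownian H (fun t ω => (b k t ω).re) μ
  fbm_im : ∀ k, IsFractionalBrownian H (fun t ω => (b k t ω).im) μ
  indep : iIndepFun (fun (j : halfLattice ⊕ halfLattice) (ω : Ω) (t : ℝ) =>
    Sum.elim (fun k => (b k t ω).re) (fun k => (b k t ω).im) j) μ

open Classical in
/-- The coefficients of the cylindrical fractional Brownian motion `w = ∑_{k ≠ 0} b_k h_k`, where
`b_{-k} = - conj b_k` for `k ∈ ℤ²₊`, so that `w` is a real vector field. -/
def cylNoise (b : halfLattice → ℝ → Ω → ℂ) (t : ℝ) (ω : Ω) (k : ℤ × ℤ) : ℂ :=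
  if h : k ∈ halfLattice then b ⟨k, h⟩ t ω
  else if h' : -k ∈ halfLattice then -conj (b ⟨-k, h'⟩ t ω)
  else 0

/-! ### Solutions -/

/-- The `C([0,T]; ℋ^σ)`-valued process `v` is a weak solution of
`dv = A v dt - B(v, v) dt + dw` with `v(0) = v₀`: for all `t ∈ [0,T]` and `φ ∈ ℋ^{2-σ}`, almost
surely
`⟨v(t) - v₀, φ⟩ - ∫₀ᵗ ⟨A v(s), φ⟩ ds + ∫₀ᵗ ⟨B(v(s), v(s)), φ⟩ ds = ⟨w(t), φ⟩`.
(`Set.IccExtend` extends a path on `[0,T]` to the real line; only its values on `[0,T]` enter.) -/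
structure IsSolution {T : ℝ} (hT : 0 ≤ T) {σ : ℝ} (b : halfLattice → ℝ → Ω → ℂ) (μ : Measure Ω)
    (v₀ : HSob σ) (v : Ω → C(Set.Icc (0 : ℝ) T, HSob σ)) : Prop where
  measurable : ∀ t, Measurable fun ω => v ω t
  initial : ∀ᵐ ω ∂μ, v ω ⟨0, le_refl 0, hT⟩ = v₀
  weak : ∀ (t : Set.Icc (0 : ℝ) T) (φ : HSob (2 - σ)), ∀ᵐ ω ∂μ,
    bracket (v ω t - v₀).coeff φ.coeff
      - (∫ s in (0 : ℝ)..t, bracket (stokes (Set.IccExtend hT (v ω) s).coeff) φ.coeff)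
      + (∫ s in (0 : ℝ)..t, bracket (nonlin (Set.IccExtend hT (v ω) s).coeff
          (Set.IccExtend hT (v ω) s).coeff) φ.coeff)
      = bracket (cylNoise b t ω) φ.coeff

end FractionalNS

end

noncomputable section

namespace FractionalNS

open scoped ENNReal NNReal Topology

/-! ### Lattice estimates -/

/-! The noise is additive, so the equation is solved path by path. Choose α with (1+σ)/2 < α < H,
which is possible because σ < 2(H - 1/2). Kolmogorov's criterion gives each noise coefficient an
α-Hölder version. Integration by parts bounds the k-th coefficient of the stochastic convolution by
|k|^{-2α} times the Hölder constant of that version, and these constants are almost surely square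
summable against |k|^{2σ-4α} because 4α - 2σ > 2. Hence the solution g of the linear equation has
paths in C([0,T]; ℋ^σ) (`exists_regular_version`, `norm_sub_duhamel_le`, `exists_linear_path`). What
remains is the deterministic mild equation v(t) = g(t) - ∫₀ᵗ e^{rA} B(v,v)(t-r) dr.

The trilinear estimate `exists_trilinear_le` shows that B maps ℋ^σ × ℋ^σ to a space of negative
order from which the heat semigroup returns to ℋ^σ with an integrable singularity r^{-θ}, θ < 1
(`exists_heatNonlin_bound`). After composition with a radial retraction the nonlinearity is globally
Lipschitz with an integrable Volterra kernel, so the truncated equation is well posed on all of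
[0,T] by a contraction in an exponentially weighted norm (`IsVolterraKernel.exists_solution`).
Solutions are compared by a Gronwall inequality for the same kernel (`exists_gronwall`).

The truncation is removed by an a priori bound in ℋ^σ that depends neither on the truncation radius
nor on the number of Galerkin modes (`exists_apriori`). Since g has only σ derivatives, energy
estimates do not apply to v - g directly. Instead g is split into finitely many modes ζ, which are
smooth, and a small remainder; the remainder drives an auxiliary solution x that stays small in ℋ^σ
by the fixed point estimate alone. Then u = v - x - ζ starts at zero. Its L² estimate uses
⟨B(p,q),q⟩ = 0 and controls the time integral of ‖u‖₁² (`exists_energy_le`). This makes the ℋ^σ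
estimate, whose right side is linear in (1+‖u‖_σ²)(1+‖u‖₁²), closable through a logarithm
(`exists_weighted_energy_le`, `exists_galerkin_bound`).

The mild solution depends measurably on ω because the solution map is a pointwise limit of the
continuous solution maps of the truncated equations (`exists_mild_solution_map`), and it satisfies
the weak equation by summing over modes (`weak_of_coeff`). For uniqueness, testing with single modes
at a countable dense set of times gives the equation for each coefficient outside one null set.
Subtracting two solutions cancels the noise, the difference satisfies the mild equation without
noise, and Gronwall makes it vanish (`coeff_of_weak`, `eq_of_coeff_eq`, `IsSolution.ae_eq`). -/

theorem modeNorm_sq (k : ℤ × ℤ) : modeNorm k ^ 2 = (k.1 : ℝ) ^ 2 + (k.2 : ℝ) ^ 2 :=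
  Real.sq_sqrt (by positivity)

@[simp] theorem modeNorm_zero : modeNorm 0 = 0 := by simp [modeNorm]

@[simp] theorem modeNorm_neg (k : ℤ × ℤ) : modeNorm (-k) = modeNorm k := by simp [modeNorm]

theorem modeNorm_perp (k : ℤ × ℤ) : modeNorm (modePerp k) = modeNorm k := by
  simp [modeNorm, modePerp, add_comm]

theorem modeDot_sq_le (h k : ℤ × ℤ) : modeDot h k ^ 2 ≤ modeNorm h ^ 2 * modeNorm k ^ 2 := by
  rw [modeNorm_sq, modeNorm_sq, modeDot]
  nlinarith [sq_nonneg ((h.1 : ℝ) * k.2 - h.2 * k.1)]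

theorem abs_modeDot_le (h k : ℤ × ℤ) : |modeDot h k| ≤ modeNorm h * modeNorm k := by
  apply abs_le_of_sq_le_sq _ (mul_nonneg (modeNorm_nonneg _) (modeNorm_nonneg _))
  rw [mul_pow]
  exact modeDot_sq_le h k

theorem modeNorm_add_le (h k : ℤ × ℤ) : modeNorm (h + k) ≤ modeNorm h + modeNorm k := by
  refine Real.sqrt_le_iff.2 ⟨add_nonneg (modeNorm_nonneg _) (modeNorm_nonneg _), ?_⟩
  have h1 := (abs_le.1 (abs_modeDot_le h k)).2
  have h2 := modeNorm_sq h
  have h3 := modeNorm_sq k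
  rw [modeDot] at h1
  push_cast [Prod.fst_add, Prod.snd_add]
  nlinarith

theorem one_le_modeNorm {k : ℤ × ℤ} (hk : k ≠ 0) : 1 ≤ modeNorm k := by
  rw [modeNorm, Real.one_le_sqrt]
  have h : 1 ≤ k.1 ^ 2 + k.2 ^ 2 := by
    by_contra hc
    have h1 : k.1 = 0 := by nlinarith [sq_nonneg k.1, sq_nonneg k.2]
    have h2 : k.2 = 0 := by nlinarith [sq_nonneg k.1, sq_nonneg k.2]
    exact hk (Prod.ext h1 h2)
  exact_mod_cast h

theorem norm_vec_le_modeNorm (k : ℤ × ℤ) : ‖(![k.1, k.2] : Fin 2 → ℤ)‖ ≤ modeNorm k := by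
  rw [pi_norm_le_iff_of_nonneg (modeNorm_nonneg _)]
  intro i
  rw [modeNorm]
  apply Real.le_sqrt_of_sq_le
  fin_cases i
  · simp [Int.norm_eq_abs]; positivity
  · simp [Int.norm_eq_abs]; positivity

/-- The Euclidean length dominates the sup norm, so the lattice sum used for Eisenstein series is a
majorant. -/
theorem summable_modeNorm_rpow {s : ℝ} (hs : 2 < s) :
    Summable fun k : ℤ × ℤ => modeNorm k ^ (-s) := by
  have h := (finTwoArrowEquiv ℤ).symm.summable_iff.2
    (EisensteinSeries.summable_one_div_norm_rpow hs)
  refine h.of_nonneg_of_le (fun k => Real.rpow_nonneg (modeNorm_nonneg k) _) fun k => ?_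
  by_cases hk : k = 0
  · subst hk
    -- For `Real.rpow`, zero to a nonzero power is 0, so the zero mode contributes nothing.
    rw [modeNorm_zero, Real.zero_rpow (by linarith)]
    exact Real.rpow_nonneg (norm_nonneg _) _
  · apply Real.rpow_le_rpow_of_nonpos _ (norm_vec_le_modeNorm k) (by linarith)
    rw [norm_pos_iff]
    intro h0
    apply hk
    have h1 := congrFun h0 0
    have h2 := congrFun h0 1
    exact Prod.ext h1 h2

theorem tsum_ofReal_modeNorm_lt_top {s : ℝ} (hs : 2 < s) :
    ∑' k : ℤ × ℤ, ENNReal.ofReal (modeNorm k ^ (-s)) < ∞ := by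
  rw [← ENNReal.ofReal_tsum_of_nonneg (fun k => Real.rpow_nonneg (modeNorm_nonneg k) _)
    (summable_modeNorm_rpow hs)]
  exact ENNReal.ofReal_lt_top

/-- Discrete form of integrating x^{-a}: Bernoulli's inequality for the concave power 1 - a bounds
each term by an increment of x^{1-a}, and the sum telescopes. -/
theorem sum_rpow_neg_le {a : ℝ} (ha : 0 ≤ a) (ha' : a < 1) (N : ℕ) :
    (1 - a) * ∑ n ∈ Finset.range N, ((n : ℝ) + 1) ^ (-a) ≤ (N : ℝ) ^ (1 - a) := by
  induction N with
  | zero => simp [Real.zero_rpow (by linarith : 1 - a ≠ 0)]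
  | succ N ih =>
    rw [Finset.sum_range_succ, mul_add]
    have hN : (0 : ℝ) < N + 1 := by positivity
    have h1 : (N : ℝ) ^ (1 - a) ≤ ((N : ℝ) + 1) ^ (1 - a) - (1 - a) * ((N : ℝ) + 1) ^ (-a) := by
      have h2 := rpow_one_add_le_one_add_mul_self (s := -1 / ((N : ℝ) + 1))
        (by rw [le_div_iff₀ hN]; linarith [Nat.cast_nonneg (α := ℝ) N]) (p := 1 - a)
        (by linarith) (by linarith)
      have h3 : (1 : ℝ) + -1 / ((N : ℝ) + 1) = N / (N + 1) := by field_simp; ring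
      rw [h3, Real.div_rpow (by positivity) hN.le, div_le_iff₀ (by positivity)] at h2
      have h4 : ((N : ℝ) + 1) ^ (-a) = ((N : ℝ) + 1) ^ (1 - a) / (N + 1) := by
        rw [← Real.rpow_sub_one hN.ne']; congr 1; ring
      rw [h4]
      refine h2.trans (le_of_eq ?_)
      field_simp
      ring
    push_cast
    linarith

theorem sum_Icc_max_rpow_le {a : ℝ} (ha : 0 ≤ a) (ha' : a < 1) (N : ℕ) (hN : 1 ≤ N) :
    ∑ n ∈ Finset.Icc (-(N : ℤ)) N, (max |(n : ℝ)| 1) ^ (-a) ≤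
      (1 + 2 / (1 - a)) * (N : ℝ) ^ (1 - a) := by
  have h1 : Finset.Icc (-(N : ℤ)) N ⊆ {0} ∪ ((Finset.range N).image (fun n : ℕ => (n : ℤ) + 1) ∪
      (Finset.range N).image (fun n : ℕ => -((n : ℤ) + 1))) := by
    intro n hn
    simp only [Finset.mem_Icc, Finset.mem_union, Finset.mem_singleton, Finset.mem_image,
      Finset.mem_range] at hn ⊢
    rcases lt_trichotomy n 0 with h | h | h
    · exact Or.inr (Or.inr ⟨(-n - 1).toNat, by omega, by omega⟩)
    · exact Or.inl h
    · exact Or.inr (Or.inl ⟨(n - 1).toNat, by omega, by omega⟩)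
  have hp : ∀ n : ℤ, 0 ≤ (max |(n : ℝ)| 1) ^ (-a) := fun n => by positivity
  have h2 : ∑ n ∈ Finset.range N, ((n : ℝ) + 1) ^ (-a) ≤ (N : ℝ) ^ (1 - a) / (1 - a) := by
    rw [le_div_iff₀ (by linarith), mul_comm]
    exact sum_rpow_neg_le ha ha' N
  have h3 : (1 : ℝ) ≤ (N : ℝ) ^ (1 - a) :=
    Real.one_le_rpow (by exact_mod_cast hN) (by linarith)
  refine (Finset.sum_le_sum_of_subset_of_nonneg h1 fun n _ _ => hp n).trans ?_
  have hu : ∀ s t : Finset ℤ, ∑ n ∈ s ∪ t, (max |(n : ℝ)| 1) ^ (-a) ≤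
      ∑ n ∈ s, (max |(n : ℝ)| 1) ^ (-a) + ∑ n ∈ t, (max |(n : ℝ)| 1) ^ (-a) := by
    intro s t
    rw [← Finset.sum_union_inter]
    exact le_add_of_nonneg_right (Finset.sum_nonneg fun n _ => hp n)
  refine (hu _ _).trans ?_
  refine (add_le_add_right (hu _ _) _).trans ?_
  rw [Finset.sum_image (fun x _ y _ h => by simpa using h),
    Finset.sum_image (fun x _ y _ h => by simpa using h), Finset.sum_singleton]
  have e1 : ∀ n : ℕ, (max |(((n : ℤ) + 1 : ℤ) : ℝ)| 1) ^ (-a) = ((n : ℝ) + 1) ^ (-a) := by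
    intro n
    push_cast
    rw [abs_of_nonneg (by positivity), max_eq_left (by linarith [Nat.cast_nonneg (α := ℝ) n])]
  have e2 : ∀ n : ℕ, (max |((-((n : ℤ) + 1) : ℤ) : ℝ)| 1) ^ (-a) = ((n : ℝ) + 1) ^ (-a) := by
    intro n
    rw [← e1 n, Int.cast_neg, abs_neg]
  simp only [e1, e2]
  have h4 : ((max |((0 : ℤ) : ℝ)| 1) ^ (-a)) = 1 := by simp
  rw [h4]
  have : (1 + 2 / (1 - a)) * (N : ℝ) ^ (1 - a) =
    (N : ℝ) ^ (1 - a) + ((N : ℝ) ^ (1 - a) / (1 - a) + (N : ℝ) ^ (1 - a) / (1 - a)) := by ring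
  linarith

/-- A nonzero mode satisfies |k| ≥ max(|k_i|, 1) in both coordinates. Spending half of the exponent
on each turns a lattice sum over a square into the square of a one dimensional sum. -/
theorem modeNorm_rpow_neg_le {a : ℝ} (ha : 0 ≤ a) {k : ℤ × ℤ} (hk : k ≠ 0) :
    modeNorm k ^ (-(2 * a)) ≤ (max |(k.1 : ℝ)| 1) ^ (-a) * (max |(k.2 : ℝ)| 1) ^ (-a) := by
  have h1 := one_le_modeNorm hk
  have h2 : |(k.1 : ℝ)| ≤ modeNorm k := Real.le_sqrt_of_sq_le (by rw [sq_abs]; nlinarith)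
  have h3 : |(k.2 : ℝ)| ≤ modeNorm k := Real.le_sqrt_of_sq_le (by rw [sq_abs]; nlinarith)
  rw [two_mul, neg_add, Real.rpow_add (modeNorm_pos hk)]
  gcongr ?_ * ?_
  · exact Real.rpow_le_rpow_of_nonpos (by positivity) (max_le h2 h1) (by linarith)
  · exact Real.rpow_le_rpow_of_nonpos (by positivity) (max_le h3 h1) (by linarith)

/-- The ball of radius |l| lies in the square of half side ⌊|l|⌋, where the sum factorizes; a < 1
lets the mass sit at the outer radius, which gives the sharp power of |l|. -/
theorem exists_tsum_ball_le {a : ℝ} (ha : 0 ≤ a) (ha' : a < 1) : ∃ C : ℝ, 0 ≤ C ∧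
    ∀ l : ℤ × ℤ, l ≠ 0 → ∑' h : ℤ × ℤ, (if h ≠ 0 ∧ modeNorm h ≤ modeNorm l then
      ENNReal.ofReal (modeNorm h ^ (-(2 * a))) else 0) ≤
      ENNReal.ofReal (C * modeNorm l ^ (2 - 2 * a)) := by
  have ha1 : 0 < 1 - a := by linarith
  refine ⟨(1 + 2 / (1 - a)) ^ 2, by positivity, fun l hl => ?_⟩
  set N := ⌊modeNorm l⌋₊ with hNdef
  have hN : 1 ≤ N := Nat.le_floor (by exact_mod_cast one_le_modeNorm hl)
  have hNl : (N : ℝ) ≤ modeNorm l := Nat.floor_le (modeNorm_nonneg l)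
  set B := Finset.Icc (-(N : ℤ)) N with hB
  rw [tsum_eq_sum (s := B ×ˢ B)]
  · calc _ ≤ ∑ h ∈ B ×ˢ B, ENNReal.ofReal
          ((max |(h.1 : ℝ)| 1) ^ (-a) * (max |(h.2 : ℝ)| 1) ^ (-a)) := by
          refine Finset.sum_le_sum fun h _ => ?_
          split_ifs with hc
          · exact ENNReal.ofReal_le_ofReal (modeNorm_rpow_neg_le ha hc.1)
          · exact zero_le
      _ = ENNReal.ofReal (∑ h ∈ B ×ˢ B,
          ((max |(h.1 : ℝ)| 1) ^ (-a) * (max |(h.2 : ℝ)| 1) ^ (-a))) :=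
          (ENNReal.ofReal_sum_of_nonneg fun h _ => by positivity).symm
      _ ≤ _ := by
          apply ENNReal.ofReal_le_ofReal
          rw [Finset.sum_product]
          simp only
          rw [← Finset.sum_mul_sum, ← sq]
          calc _ ≤ ((1 + 2 / (1 - a)) * (N : ℝ) ^ (1 - a)) ^ 2 := by
                gcongr
                exact sum_Icc_max_rpow_le ha ha' N hN
            _ ≤ ((1 + 2 / (1 - a)) * modeNorm l ^ (1 - a)) ^ 2 := by gcongr
            _ = _ := by
                rw [mul_pow, ← Real.rpow_natCast (modeNorm l ^ (1 - a)),
                  ← Real.rpow_mul (modeNorm_nonneg l)]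
                congr 2
                push_cast; ring
  · intro h hh
    rw [if_neg]
    rintro ⟨-, h2⟩
    apply hh
    have key : ∀ n : ℤ, (n : ℝ) ^ 2 ≤ modeNorm h ^ 2 → n ∈ B := by
      intro n hn
      have h3 : |(n : ℝ)| ≤ modeNorm l :=
        (abs_le_of_sq_le_sq hn (modeNorm_nonneg h)).trans h2
      have h4 : n.natAbs ≤ N := by
        apply Nat.le_floor
        rw [Nat.cast_natAbs, Int.cast_abs]
        exact h3
      rw [hB, Finset.mem_Icc]
      omega
    rw [Finset.mem_product]
    exact ⟨key _ (by rw [modeNorm_sq]; nlinarith), key _ (by rw [modeNorm_sq]; nlinarith)⟩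

/-! ### The trilinear convolution estimate -/

/-- Cauchy–Schwarz as Hölder's inequality for counting measure; extended values spare all
summability conditions. -/
theorem tsum_mul_sq_le {ι : Type*} (a b : ι → ℝ≥0∞) :
    (∑' i, a i * b i) ^ 2 ≤ (∑' i, a i ^ 2) * ∑' i, b i ^ 2 := by
  let : MeasurableSpace ι := ⊤
  have h := ENNReal.lintegral_mul_le_Lp_mul_Lq (Measure.count : Measure ι)
    Real.HolderConjugate.two_two (f := a) (g := b) (measurable_from_top).aemeasurable
    (measurable_from_top).aemeasurable
  simp only [Pi.mul_apply, lintegral_count] at h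
  calc _ ≤ _ := pow_le_pow_left₀ zero_le h 2
    _ = _ := by
      rw [mul_pow]
      simp only [← ENNReal.rpow_natCast, ← ENNReal.rpow_mul]
      norm_num

/-- The square `∑ |k|^{2s} f_k²` of the `s`-th Sobolev norm. -/
def sobSq (s : ℝ) (f : ℤ × ℤ → ℝ≥0∞) : ℝ≥0∞ :=
  ∑' k, ENNReal.ofReal (modeNorm k ^ (2 * s)) * f k ^ 2

theorem sobSq_comp_neg (s : ℝ) (f : ℤ × ℤ → ℝ≥0∞) : sobSq s (fun k => f (-k)) = sobSq s f := by
  unfold sobSq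
  rw [← (Equiv.neg (ℤ × ℤ)).tsum_eq]
  simp

/-- Cauchy–Schwarz over pairs (h, l), grouping f_h w_{h+l} against K g_l: a translation decouples
the first factor, and the hypothesis on the kernel sums out h in the second. -/
theorem tsum_kernel_sq_le (K : ℤ × ℤ → ℤ × ℤ → ℝ≥0∞) (C : ℝ≥0∞)
    (hK : ∀ l, ∑' h, K h l ^ 2 ≤ C) (f g w : ℤ × ℤ → ℝ≥0∞) :
    (∑' h, ∑' l, K h l * (f h * g l * w (h + l))) ^ 2 ≤
      C * ((∑' h, f h ^ 2) * (∑' l, g l ^ 2) * ∑' k, w k ^ 2) := by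
  have e : ∑' h, ∑' l, K h l * (f h * g l * w (h + l)) =
      ∑' p : (ℤ × ℤ) × (ℤ × ℤ), (f p.1 * w (p.1 + p.2)) * (K p.1 p.2 * g p.2) := by
    refine Eq.trans ?_ (ENNReal.tsum_prod' (f := fun p : (ℤ × ℤ) × (ℤ × ℤ) =>
      (f p.1 * w (p.1 + p.2)) * (K p.1 p.2 * g p.2))).symm
    exact tsum_congr fun h => tsum_congr fun l => by ring
  rw [e]
  refine (tsum_mul_sq_le _ _).trans ?_
  have h1 : ∑' p : (ℤ × ℤ) × (ℤ × ℤ), (f p.1 * w (p.1 + p.2)) ^ 2 =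
      (∑' h, f h ^ 2) * ∑' k, w k ^ 2 := by
    rw [ENNReal.tsum_prod', ← ENNReal.tsum_mul_right]
    refine tsum_congr fun h => ?_
    simp only [mul_pow]
    rw [ENNReal.tsum_mul_left]
    congr 1
    exact (Equiv.addLeft h).tsum_eq (fun k => w k ^ 2)
  have h2 : ∑' p : (ℤ × ℤ) × (ℤ × ℤ), (K p.1 p.2 * g p.2) ^ 2 ≤ C * ∑' l, g l ^ 2 := by
    rw [ENNReal.tsum_prod', ENNReal.tsum_comm, ← ENNReal.tsum_mul_left]
    refine ENNReal.tsum_le_tsum fun l => ?_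
    simp only [mul_pow]
    rw [ENNReal.tsum_mul_right]
    gcongr
    exact hK l
  rw [h1]
  calc _ ≤ ((∑' h, f h ^ 2) * ∑' k, w k ^ 2) * (C * ∑' l, g l ^ 2) := by gcongr
    _ = _ := by ring

/-- The exponents for which the smallest mode can carry the weight. -/
def Admissible (a b c : ℝ) : Prop :=
  0 ≤ a ∧ 0 ≤ b ∧ 0 ≤ c ∧ (1 < a + b + c ∨ (a + b + c = 1 ∧ a < 1 ∧ b < 1 ∧ c < 1))

/-- With h the smallest of the three modes, all weights may be moved onto |h|. If a + b + c > 1 then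
|h|^{-(a+b+c)} is square summable. On the line a + b + c = 1 this fails logarithmically; keeping the
power 1 - a on |l| and summing |h|^{-2a} only over the ball of radius |l| gives exactly the
compensating growth. -/
theorem exists_kernel {a b c : ℝ} (habc : Admissible a b c) :
    ∃ (K : ℤ × ℤ → ℤ × ℤ → ℝ≥0∞) (C : ℝ≥0∞), C < ∞ ∧ (∀ l, ∑' h, K h l ^ 2 ≤ C) ∧
      ∀ h l, h ≠ 0 → l ≠ 0 → h + l ≠ 0 → modeNorm h ≤ modeNorm l → modeNorm h ≤ modeNorm (h + l) →
        1 ≤ K h l * (ENNReal.ofReal (modeNorm h ^ a) * ENNReal.ofReal (modeNorm l ^ b) *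
          ENNReal.ofReal (modeNorm (h + l) ^ c)) := by
  obtain ⟨ha, hb, hc, hs⟩ := habc
  rcases hs with hs | ⟨hs, ha1, -, -⟩
  · refine ⟨fun h _ => ENNReal.ofReal (modeNorm h ^ (-(a + b + c))), _,
      tsum_ofReal_modeNorm_lt_top (s := 2 * (a + b + c)) (by linarith), fun l => le_of_eq ?_, ?_⟩
    · refine tsum_congr fun h => ?_
      rw [← ENNReal.ofReal_pow (Real.rpow_nonneg (modeNorm_nonneg h) _), ← Real.rpow_natCast,
        ← Real.rpow_mul (modeNorm_nonneg h)]
      congr 2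
      push_cast; ring
    · intro h l hh hl hk h1 h2
      have hp := modeNorm_pos hh
      rw [← ENNReal.ofReal_mul (by positivity), ← ENNReal.ofReal_mul
        (mul_nonneg (by positivity) (Real.rpow_nonneg (modeNorm_nonneg _) _)),
        ← ENNReal.ofReal_mul (by positivity), ← ENNReal.ofReal_one]
      apply ENNReal.ofReal_le_ofReal
      calc (1 : ℝ) = modeNorm h ^ (-(a + b + c)) *
            (modeNorm h ^ a * modeNorm h ^ b * modeNorm h ^ c) := by
            rw [← Real.rpow_add hp, ← Real.rpow_add hp, ← Real.rpow_add hp, neg_add_cancel,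
              Real.rpow_zero]
        _ ≤ _ := by
            have := modeNorm_nonneg l
            gcongr
  · obtain ⟨C, hC0, hC⟩ := exists_tsum_ball_le ha ha1
    have hbc : b + c = 1 - a := by linarith
    refine ⟨fun h l => if h ≠ 0 ∧ l ≠ 0 ∧ modeNorm h ≤ modeNorm l then
      ENNReal.ofReal (2 * modeNorm h ^ (-a) * modeNorm l ^ (-(1 - a))) else 0,
      ENNReal.ofReal (4 * C), ENNReal.ofReal_lt_top, fun l => ?_, ?_⟩
    · by_cases hl : l = 0
      · simp [hl]
      have hlp := modeNorm_pos hl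
      calc _ = ∑' h : ℤ × ℤ, ENNReal.ofReal (4 * modeNorm l ^ (-(2 - 2 * a))) *
            (if h ≠ 0 ∧ modeNorm h ≤ modeNorm l then
              ENNReal.ofReal (modeNorm h ^ (-(2 * a))) else 0) := by
            refine tsum_congr fun h => ?_
            by_cases hc : h ≠ 0 ∧ modeNorm h ≤ modeNorm l
            · have hhp := modeNorm_pos hc.1
              simp only
              rw [if_pos hc, if_pos ⟨hc.1, hl, hc.2⟩, ← ENNReal.ofReal_pow (by positivity),
                ← ENNReal.ofReal_mul (by positivity)]
              congr 1
              rw [mul_pow, mul_pow, ← Real.rpow_natCast (modeNorm h ^ (-a)),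
                ← Real.rpow_natCast (modeNorm l ^ (-(1 - a))), ← Real.rpow_mul hhp.le,
                ← Real.rpow_mul hlp.le]
              push_cast
              rw [show -a * 2 = -(2 * a) by ring, show -(1 - a) * 2 = -(2 - 2 * a) by ring]
              ring
            · simp only
              rw [if_neg hc, if_neg (fun h' => hc ⟨h'.1, h'.2.2⟩)]
              simp
        _ ≤ ENNReal.ofReal (4 * modeNorm l ^ (-(2 - 2 * a))) *
            ENNReal.ofReal (C * modeNorm l ^ (2 - 2 * a)) := by
            rw [ENNReal.tsum_mul_left]
            gcongr
            exact hC l hl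
        _ = _ := by
            rw [← ENNReal.ofReal_mul (by positivity)]
            congr 1
            rw [Real.rpow_neg hlp.le]
            field_simp
    · intro h l hh hl hk h1 h2
      have hhp := modeNorm_pos hh
      have hlp := modeNorm_pos hl
      have hkp := modeNorm_pos hk
      simp only
      rw [if_pos ⟨hh, hl, h1⟩, ← ENNReal.ofReal_mul (by positivity),
        ← ENNReal.ofReal_mul (by positivity), ← ENNReal.ofReal_mul (by positivity),
        ← ENNReal.ofReal_one]
      apply ENNReal.ofReal_le_ofReal
      -- As h is the smallest mode, l and h + l are comparable; the factor 2 in the kernel pays for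
      -- this, since c ≤ 1.
      have hlk : modeNorm l ≤ 2 * modeNorm (h + l) := by
        have := modeNorm_add_le (-h) (h + l)
        rw [neg_add_cancel_left, modeNorm_neg] at this
        linarith
      have h3 : modeNorm l ^ c ≤ 2 * modeNorm (h + l) ^ c := by
        calc modeNorm l ^ c ≤ (2 * modeNorm (h + l)) ^ c := by gcongr
          _ = 2 ^ c * modeNorm (h + l) ^ c := Real.mul_rpow (by norm_num) hkp.le
          _ ≤ 2 ^ (1 : ℝ) * modeNorm (h + l) ^ c := by
              gcongr
              · norm_num
              · linarith
          _ = _ := by simp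
      have h4 : modeNorm h ^ (-a) * modeNorm h ^ a = 1 := by
        rw [← Real.rpow_add hhp]; simp
      have h5 : modeNorm l ^ (-(1 - a)) * (modeNorm l ^ b * modeNorm l ^ c) = 1 := by
        rw [← Real.rpow_add hlp, ← Real.rpow_add hlp, hbc]; simp
      calc (1 : ℝ) = (modeNorm h ^ (-a) * modeNorm h ^ a) *
            (modeNorm l ^ (-(1 - a)) * (modeNorm l ^ b * modeNorm l ^ c)) := by rw [h4, h5]; simp
        _ ≤ (modeNorm h ^ (-a) * modeNorm h ^ a) *
            (modeNorm l ^ (-(1 - a)) * (modeNorm l ^ b * (2 * modeNorm (h + l) ^ c))) := by gcongr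
        _ = _ := by ring

theorem sq_ofReal_rpow_mul (s : ℝ) (k : ℤ × ℤ) (x : ℝ≥0∞) :
    (ENNReal.ofReal (modeNorm k ^ s) * x) ^ 2 = ENNReal.ofReal (modeNorm k ^ (2 * s)) * x ^ 2 := by
  rw [mul_pow, ← ENNReal.ofReal_pow (Real.rpow_nonneg (modeNorm_nonneg k) _), mul_comm 2 s,
    Real.rpow_mul (modeNorm_nonneg k), Real.rpow_two]

-- This is the trilinear sum restricted to the region where h is the smallest mode. The other two
-- regions reduce to it by symmetry.
open Classical in
theorem exists_region_le {a b c : ℝ} (habc : Admissible a b c) :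
    ∃ C : ℝ≥0∞, C < ∞ ∧ ∀ f g w : ℤ × ℤ → ℝ≥0∞, f 0 = 0 → g 0 = 0 → w 0 = 0 →
      (∑' h, ∑' l, if modeNorm h ≤ modeNorm l ∧ modeNorm h ≤ modeNorm (h + l) then
        f h * g l * w (h + l) else 0) ^ 2 ≤ C * (sobSq a f * sobSq b g * sobSq c w) := by
  obtain ⟨K, C, hC, hK, hK'⟩ := exists_kernel habc
  refine ⟨C, hC, fun f g w hf hg hw => ?_⟩
  refine le_trans ?_ ((tsum_kernel_sq_le K C hK
    (fun k => ENNReal.ofReal (modeNorm k ^ a) * f k)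
    (fun k => ENNReal.ofReal (modeNorm k ^ b) * g k)
    (fun k => ENNReal.ofReal (modeNorm k ^ c) * w k)).trans (le_of_eq ?_))
  · gcongr with h l
    split_ifs with hc
    · by_cases h0 : h = 0
      · simp [h0, hf]
      by_cases l0 : l = 0
      · simp [l0, hg]
      by_cases k0 : h + l = 0
      · simp [k0, hw]
      calc f h * g l * w (h + l) = 1 * (f h * g l * w (h + l)) := (one_mul _).symm
        _ ≤ _ := mul_le_mul_left (hK' h l h0 l0 k0 hc.1 hc.2) _
        _ = _ := by ring
    · exact zero_le
  · simp only [sq_ofReal_rpow_mul, sobSq]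

open Classical in
/-- `∑ f_h g_l w_{h+l} ≤ C ‖f‖_a ‖g‖_b ‖w‖_c` for admissible exponents. -/
theorem exists_trilinear_le {a b c : ℝ} (habc : Admissible a b c) :
    ∃ C : ℝ≥0∞, C < ∞ ∧ ∀ f g w : ℤ × ℤ → ℝ≥0∞, f 0 = 0 → g 0 = 0 → w 0 = 0 →
      (∑' h, ∑' l, f h * g l * w (h + l)) ^ 2 ≤ C * (sobSq a f * sobSq b g * sobSq c w) := by
  have hab : Admissible b a c := by
    obtain ⟨h1, h2, h3, h4⟩ := habc
    refine ⟨h2, h1, h3, ?_⟩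
    rcases h4 with h4 | h4
    · left; linarith
    · right; exact ⟨by linarith, h4.2.2.1, h4.2.1, h4.2.2.2⟩
  have hcb : Admissible c b a := by
    obtain ⟨h1, h2, h3, h4⟩ := habc
    refine ⟨h3, h2, h1, ?_⟩
    rcases h4 with h4 | h4
    · left; linarith
    · right; exact ⟨by linarith, h4.2.2.2, h4.2.2.1, h4.2.1⟩
  obtain ⟨C₁, hC₁, H₁⟩ := exists_region_le habc
  obtain ⟨C₂, hC₂, H₂⟩ := exists_region_le hab
  obtain ⟨C₃, hC₃, H₃⟩ := exists_region_le hcb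
  refine ⟨3 * (C₁ + C₂ + C₃), by finiteness, fun f g w hf hg hw => ?_⟩
  specialize H₁ f g w hf hg hw
  specialize H₂ g f w hg hf hw
  -- Where h + l is the smallest mode it takes over the role of h: the pair (h + l, -l) has sum h,
  -- so w and f exchange places and g is reflected.
  specialize H₃ w (fun k => g (-k)) f hw (by simpa using hg) hf
  rw [sobSq_comp_neg] at H₃
  set S₁ := ∑' h, ∑' l, if modeNorm h ≤ modeNorm l ∧ modeNorm h ≤ modeNorm (h + l) then
        f h * g l * w (h + l) else 0 with hS₁
  set S₂ := ∑' h, ∑' l, if modeNorm h ≤ modeNorm l ∧ modeNorm h ≤ modeNorm (h + l) then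
        g h * f l * w (h + l) else 0 with hS₂
  set S₃ := ∑' h, ∑' l, if modeNorm h ≤ modeNorm l ∧ modeNorm h ≤ modeNorm (h + l) then
        w h * g (-l) * f (h + l) else 0 with hS₃
  have e₂ : S₂ = ∑' h, ∑' l, if modeNorm l ≤ modeNorm h ∧ modeNorm l ≤ modeNorm (h + l) then
        f h * g l * w (h + l) else 0 := by
    rw [hS₂, ENNReal.tsum_comm]
    refine tsum_congr fun h => tsum_congr fun l => ?_
    rw [add_comm l h, mul_comm (g l)]
  have e₃ : S₃ = ∑' h, ∑' l, if modeNorm (h + l) ≤ modeNorm l ∧ modeNorm (h + l) ≤ modeNorm h then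
        f h * g l * w (h + l) else 0 := by
    rw [hS₃, ENNReal.tsum_comm, ← (Equiv.neg (ℤ × ℤ)).tsum_eq]
    conv_rhs => rw [ENNReal.tsum_comm]
    refine tsum_congr fun l => ?_
    rw [← (Equiv.addRight l).tsum_eq]
    refine tsum_congr fun h => ?_
    simp only [Equiv.neg_apply, Equiv.coe_addRight, modeNorm_neg, neg_neg]
    rw [add_neg_cancel_right]
    congr 1
    ring
  have hle : ∑' h, ∑' l, f h * g l * w (h + l) ≤ S₁ + S₂ + S₃ := by
    rw [e₂, e₃, hS₁]
    simp only [← ENNReal.tsum_add]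
    refine ENNReal.tsum_le_tsum fun h => ENNReal.tsum_le_tsum fun l => ?_
    by_cases h1 : modeNorm h ≤ modeNorm l ∧ modeNorm h ≤ modeNorm (h + l)
    · rw [if_pos h1, add_assoc]; exact le_self_add
    by_cases h2 : modeNorm l ≤ modeNorm h ∧ modeNorm l ≤ modeNorm (h + l)
    · rw [if_pos h2, add_assoc, add_left_comm]; exact le_self_add
    rw [if_pos (_ : modeNorm (h + l) ≤ modeNorm l ∧ modeNorm (h + l) ≤ modeNorm h)]
    · exact le_add_self
    · rw [not_and_or, not_le, not_le] at h1 h2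
      constructor
      · by_contra hc; rw [not_le] at hc
        rcases h1 with h1 | h1 <;> rcases h2 with h2 | h2 <;> linarith
      · by_contra hc; rw [not_le] at hc
        rcases h1 with h1 | h1 <;> rcases h2 with h2 | h2 <;> linarith
  have hsq : ∀ x y z : ℝ≥0∞, (x + y + z) ^ 2 ≤ 3 * (x ^ 2 + y ^ 2 + z ^ 2) := by
    intro x y z
    induction x with
    | top => simp
    | coe x =>
      induction y with
      | top => simp
      | coe y =>
        induction z with
        | top => simp
        | coe z =>
          norm_cast
          rw [← NNReal.coe_le_coe]
          push_cast
          nlinarith [sq_nonneg ((x : ℝ) - y), sq_nonneg ((x : ℝ) - z), sq_nonneg ((y : ℝ) - z)]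
  calc _ ≤ (S₁ + S₂ + S₃) ^ 2 := pow_le_pow_left₀ zero_le hle 2
    _ ≤ 3 * (S₁ ^ 2 + S₂ ^ 2 + S₃ ^ 2) := hsq _ _ _
    _ ≤ 3 * (C₁ * (sobSq a f * sobSq b g * sobSq c w) + C₂ * (sobSq b g * sobSq a f * sobSq c w) +
        C₃ * (sobSq c w * sobSq b g * sobSq a f)) := by gcongr
    _ = _ := by ring

/-! ### The nonlinearity -/

theorem modePerp_dot_self (h : ℤ × ℤ) : modeDot (modePerp h) h = 0 := by
  simp only [modeDot, modePerp]; push_cast; ring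

theorem modeDot_sub_right (h k l : ℤ × ℤ) : modeDot h (k - l) = modeDot h k - modeDot h l := by
  simp only [modeDot, Prod.fst_sub, Prod.snd_sub]; push_cast; ring

theorem modeDot_neg_left (h k : ℤ × ℤ) : modeDot (-h) k = -modeDot h k := by
  simp only [modeDot, Prod.fst_neg, Prod.snd_neg]; push_cast; ring

theorem modeDot_neg_right (h k : ℤ × ℤ) : modeDot h (-k) = -modeDot h k := by
  simp only [modeDot, Prod.fst_neg, Prod.snd_neg]; push_cast; ring

theorem modeDot_comm (h k : ℤ × ℤ) : modeDot h k = modeDot k h := by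
  simp only [modeDot]; ring

theorem modePerp_neg (h : ℤ × ℤ) : modePerp (-h) = -modePerp h := by
  simp [modePerp]

theorem gammaCoeff_neg (h k : ℤ × ℤ) : gammaCoeff (-h) (-k) = gammaCoeff h k := by
  have e : -k - -h = -(k - h) := by abel
  simp only [gammaCoeff, e, modePerp_neg, modeDot_neg_left, modeDot_neg_right, modeNorm_neg]
  ring

/-- Source of energy conservation: under k ↦ h - k the factor h^⊥ · k changes sign because h^⊥ · h =
0, while (k - h) · k and the product of the norms are invariant. -/
theorem gammaCoeff_sub (h k : ℤ × ℤ) : gammaCoeff h (h - k) = -gammaCoeff h k := by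
  have e : h - k - h = -k := by abel
  have e2 : modeNorm (h - k) = modeNorm (k - h) := by rw [← modeNorm_neg]; congr 1; abel
  have e3 : modeDot k (h - k) = -modeDot (k - h) k := by
    rw [modeDot_comm (k - h), ← modeDot_neg_right]; congr 1; abel
  simp only [gammaCoeff, e, modeDot_neg_left, modeNorm_neg, e2, e3,
    modeDot_sub_right (modePerp h), modePerp_dot_self]
  ring

theorem gammaCoeff_zero_left (k : ℤ × ℤ) : gammaCoeff 0 k = 0 := by simp [gammaCoeff]

theorem gammaCoeff_self (k : ℤ × ℤ) : gammaCoeff k k = 0 := by simp [gammaCoeff]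

theorem gammaCoeff_zero_right (h : ℤ × ℤ) : gammaCoeff h 0 = 0 := by simp [gammaCoeff]

theorem abs_div_prod_le {x y a b c : ℝ} (ha : 0 ≤ a) (hb : 0 ≤ b) (hc : 0 ≤ c) (d : ℝ)
    (hd : 0 ≤ d) (hxy : |x| * |y| ≤ d * (a * b * c)) :
    |1 / (2 * Real.pi) * (x * y) / (a * b * c)| ≤ d := by
  have hpi : 1 / (2 * Real.pi) ≤ 1 := by
    rw [div_le_one (by positivity)]
    linarith [Real.pi_gt_three]
  have hp : 0 ≤ a * b * c := by positivity
  rw [abs_div, abs_mul, abs_mul, abs_of_nonneg (by positivity : 0 ≤ 1 / (2 * Real.pi)),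
    abs_of_nonneg hp]
  apply div_le_of_le_mul₀ hp hd
  calc 1 / (2 * Real.pi) * (|x| * |y|) ≤ 1 * (|x| * |y|) := by gcongr
    _ ≤ _ := by rw [one_mul]; exact hxy

theorem abs_gammaCoeff_le (h k : ℤ × ℤ) : |gammaCoeff h k| ≤ modeNorm k := by
  have h1 := modeNorm_nonneg h
  have h2 := modeNorm_nonneg k
  have h3 := modeNorm_nonneg (k - h)
  apply abs_div_prod_le h1 h3 h2 _ h2
  have h4 := abs_modeDot_le (modePerp h) k
  have h5 := abs_modeDot_le (k - h) k
  rw [modeNorm_perp] at h4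
  calc _ ≤ (modeNorm h * modeNorm k) * (modeNorm (k - h) * modeNorm k) := by gcongr
    _ = _ := by ring

/-- Incompressibility gives h^⊥ · k = h^⊥ · (k - h), so the derivative can be charged to the second
factor of B instead of the output as in `abs_gammaCoeff_le`. -/
theorem abs_gammaCoeff_le' (h k : ℤ × ℤ) : |gammaCoeff h k| ≤ modeNorm (k - h) := by
  have h1 := modeNorm_nonneg h
  have h2 := modeNorm_nonneg k
  have h3 := modeNorm_nonneg (k - h)
  apply abs_div_prod_le h1 h3 h2 _ h3
  have h4 := abs_modeDot_le (modePerp h) (k - h)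
  have h5 := abs_modeDot_le (k - h) k
  rw [modeNorm_perp, modeDot_sub_right, modePerp_dot_self, sub_zero] at h4
  calc _ ≤ (modeNorm h * modeNorm (k - h)) * (modeNorm (k - h) * modeNorm k) := by gcongr
    _ = _ := by ring

/-- At the excluded modes h = 0 and h = k the coefficient γ is 0, so the restriction of the sum can
be dropped. -/
theorem nonlin_eq (u v : ℤ × ℤ → ℂ) (k : ℤ × ℤ) :
    nonlin u v k = Complex.I * ∑' h, (gammaCoeff h k : ℂ) * u h * v (k - h) := by
  rw [nonlin]
  congr 1
  refine tsum_subtype_eq_of_support_subset (s := {h : ℤ × ℤ | h ≠ 0 ∧ h ≠ k})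
    (f := fun h => (gammaCoeff h k : ℂ) * u h * v (k - h)) ?_
  intro h hh
  constructor
  · rintro rfl
    simp [gammaCoeff_zero_left] at hh
  · rintro rfl
    simp [gammaCoeff_self] at hh

theorem nonlin_zero (u v : ℤ × ℤ → ℂ) : nonlin u v 0 = 0 := by
  simp [nonlin_eq, gammaCoeff_zero_right]

theorem nonlin_neg {u v : ℤ × ℤ → ℂ} (hu : ∀ k, u (-k) = -conj (u k))
    (hv : ∀ k, v (-k) = -conj (v k)) (k : ℤ × ℤ) : nonlin u v (-k) = -conj (nonlin u v k) := by
  rw [nonlin_eq, nonlin_eq, map_mul, Complex.conj_I, Complex.conj_tsum,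
    ← (Equiv.neg (ℤ × ℤ)).tsum_eq, neg_mul, neg_neg]
  congr 1
  refine tsum_congr fun h => ?_
  have e : -k - -h = -(k - h) := by abel
  simp only [Equiv.neg_apply, gammaCoeff_neg, e, hu, hv, map_mul, Complex.conj_ofReal]
  ring

/-- The moduli of the coefficients, as extended nonnegative reals. -/
def emod (u : ℤ × ℤ → ℂ) (k : ℤ × ℤ) : ℝ≥0∞ := ‖u k‖ₑ

theorem enorm_ofReal_gammaCoeff_le (h k : ℤ × ℤ) :
    ‖(gammaCoeff h k : ℂ)‖ₑ ≤ ENNReal.ofReal (modeNorm k) := by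
  rw [← ofReal_norm, Complex.norm_real]
  exact ENNReal.ofReal_le_ofReal (abs_gammaCoeff_le h k)

theorem enorm_nonlin_le (u v : ℤ × ℤ → ℂ) (k : ℤ × ℤ) :
    ‖nonlin u v k‖ₑ ≤ ENNReal.ofReal (modeNorm k) * ∑' h, emod u h * emod v (k - h) := by
  rw [nonlin_eq, enorm_mul, ← ENNReal.tsum_mul_left]
  have hI : ‖Complex.I‖ₑ = 1 := by rw [← ofReal_norm]; simp
  rw [hI, one_mul]
  refine enorm_tsum_le_tsum_enorm.trans (ENNReal.tsum_le_tsum fun h => ?_)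
  rw [enorm_mul, enorm_mul, mul_assoc]
  exact mul_le_mul_left (enorm_ofReal_gammaCoeff_le h k) _

theorem ofReal_rpow_add {k : ℤ × ℤ} (hk : k ≠ 0) (s t : ℝ) :
    ENNReal.ofReal (modeNorm k ^ s) * ENNReal.ofReal (modeNorm k ^ t) =
      ENNReal.ofReal (modeNorm k ^ (s + t)) := by
  rw [Real.rpow_add (modeNorm_pos hk), ENNReal.ofReal_mul]
  exact Real.rpow_nonneg (modeNorm_nonneg k) _

/-- `‖B(u, v)‖_{-(1+c)} ≤ C ‖u‖_a ‖v‖_b`. -/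
theorem exists_sobSq_nonlin_le {a b c : ℝ} (habc : Admissible a b c) :
    ∃ C : ℝ≥0∞, C < ∞ ∧ ∀ u v : ℤ × ℤ → ℂ, u 0 = 0 → v 0 = 0 →
      sobSq (-(1 + c)) (emod (nonlin u v)) ≤ C * (sobSq a (emod u) * sobSq b (emod v)) := by
  obtain ⟨C, hC, H⟩ := exists_trilinear_le habc
  refine ⟨C, hC, fun u v hu hv => ?_⟩
  unfold sobSq
  rw [ENNReal.tsum_eq_iSup_sum]
  refine iSup_le fun S => ?_
  classical
  set X := ∑ k ∈ S, ENNReal.ofReal (modeNorm k ^ (2 * (-(1 + c)))) * emod (nonlin u v) k ^ 2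
  -- Duality argument: this test sequence has squared norm X in ℋ^c, and its pairing with the
  -- convolution dominates X. Restricting to a finite set keeps X finite, so that one factor X can
  -- be cancelled at the end.
  set w : ℤ × ℤ → ℝ≥0∞ := fun k => if k ∈ S then
    ENNReal.ofReal (modeNorm k ^ (-(1 + 2 * c))) * emod (nonlin u v) k else 0 with hw
  have hX : X ≠ ∞ := by
    refine ENNReal.sum_ne_top.2 fun k _ => ENNReal.mul_ne_top ENNReal.ofReal_ne_top ?_
    simp [emod]
  have h0 : emod (nonlin u v) 0 = 0 := by simp [emod, nonlin_zero]
  have hw0 : w 0 = 0 := by simp [hw, h0]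
  have hN : sobSq c w = X := by
    rw [sobSq, tsum_eq_sum (s := S)]
    · refine Finset.sum_congr rfl fun k hk => ?_
      rw [hw]
      simp only [if_pos hk]
      by_cases hk0 : k = 0
      · simp [hk0, h0]
      · rw [sq_ofReal_rpow_mul, ← mul_assoc, ofReal_rpow_add hk0]
        congr 4; ring
    · intro k hk
      simp [hw, hk]
  have h1 : X ≤ ∑' h, ∑' l, emod u h * emod v l * w (h + l) := by
    have e : ∑' h, ∑' l, emod u h * emod v l * w (h + l) =
        ∑' k, (∑' h, emod u h * emod v (k - h)) * w k := by
      simp_rw [← ENNReal.tsum_mul_right]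
      conv_rhs => rw [ENNReal.tsum_comm]
      refine tsum_congr fun h => ?_
      rw [← (Equiv.addLeft h).tsum_eq]
      conv_rhs => rw [← (Equiv.addLeft h).tsum_eq]
      rw [← (Equiv.addLeft (-h)).tsum_eq]
      simp
    rw [e]
    refine le_trans (Finset.sum_le_sum fun k hk => ?_) (ENNReal.sum_le_tsum S)
    by_cases hk0 : k = 0
    · simp [hk0, h0]
    rw [hw]
    simp only [if_pos hk]
    calc _ = ENNReal.ofReal (modeNorm k ^ (2 * (-(1 + c)))) * emod (nonlin u v) k *
          emod (nonlin u v) k := by ring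
      _ ≤ ENNReal.ofReal (modeNorm k ^ (2 * (-(1 + c)))) *
          (ENNReal.ofReal (modeNorm k) * ∑' h, emod u h * emod v (k - h)) *
          emod (nonlin u v) k := by
          gcongr
          exact enorm_nonlin_le u v k
      _ = (ENNReal.ofReal (modeNorm k ^ (2 * (-(1 + c)))) *
          ENNReal.ofReal (modeNorm k ^ (1 : ℝ))) * ((∑' h, emod u h * emod v (k - h)) *
          emod (nonlin u v) k) := by rw [Real.rpow_one]; ring
      _ = _ := by
          rw [ofReal_rpow_add hk0, show 2 * (-(1 + c)) + 1 = -(1 + 2 * c) by ring]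
          ring
  have h2 : X * X ≤ C * (sobSq a (emod u) * sobSq b (emod v)) * X := by
    calc X * X = X ^ 2 := (sq X).symm
      _ ≤ _ := pow_le_pow_left₀ zero_le h1 2
      _ ≤ _ := H _ _ w (by simp [emod, hu]) (by simp [emod, hv]) hw0
      _ = _ := by rw [hN]; ring
  rcases eq_or_ne X 0 with hX0 | hX0
  · rw [hX0]; exact zero_le
  · exact (ENNReal.mul_le_mul_iff_left hX0 hX).1 h2

/-! ### The Hilbert spaces `ℋ^r` -/

theorem HSob.ext {r : ℝ} {u v : HSob r} (h : ∀ k, u.coeff k = v.coeff k) : u = v :=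
  Subtype.ext (funext h)

@[simp] theorem HSob.coeff_add {r : ℝ} (u v : HSob r) (k : ℤ × ℤ) :
    (u + v).coeff k = u.coeff k + v.coeff k := rfl

@[simp] theorem HSob.coeff_sub {r : ℝ} (u v : HSob r) (k : ℤ × ℤ) :
    (u - v).coeff k = u.coeff k - v.coeff k := rfl

@[simp] theorem HSob.coeff_smul {r : ℝ} (c : ℝ) (u : HSob r) (k : ℤ × ℤ) :
    (c • u).coeff k = c • u.coeff k := rfl

@[simp] theorem HSob.coeff_zero {r : ℝ} (k : ℤ × ℤ) : (0 : HSob r).coeff k = 0 := rfl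

theorem HSob.coeff_zero_mode {r : ℝ} (u : HSob r) : u.coeff 0 = 0 := u.isSobolev.1

theorem HSob.coeff_neg_mode {r : ℝ} (u : HSob r) (k : ℤ × ℤ) :
    u.coeff (-k) = -conj (u.coeff k) := u.isSobolev.2.1 k

theorem ofReal_weight_mul_sq (r : ℝ) (v : ℤ × ℤ → ℂ) (k : ℤ × ℤ) :
    ENNReal.ofReal (modeNorm k ^ (2 * r) * ‖v k‖ ^ 2) =
      ENNReal.ofReal (modeNorm k ^ (2 * r)) * emod v k ^ 2 := by
  rw [ENNReal.ofReal_mul (Real.rpow_nonneg (modeNorm_nonneg k) _),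
    ENNReal.ofReal_pow (norm_nonneg _), ofReal_norm]
  rfl

theorem summable_iff_sobSq_lt_top (r : ℝ) (v : ℤ × ℤ → ℂ) :
    (Summable fun k => modeNorm k ^ (2 * r) * ‖v k‖ ^ 2) ↔ sobSq r (emod v) < ∞ := by
  have hnn : ∀ k, 0 ≤ modeNorm k ^ (2 * r) * ‖v k‖ ^ 2 := fun k =>
    mul_nonneg (Real.rpow_nonneg (modeNorm_nonneg k) _) (by positivity)
  have e : sobSq r (emod v) = ∑' k, ENNReal.ofReal (modeNorm k ^ (2 * r) * ‖v k‖ ^ 2) := by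
    simp only [ofReal_weight_mul_sq, sobSq]
  rw [e]
  constructor
  · intro h
    rw [← ENNReal.ofReal_tsum_of_nonneg hnn h]
    exact ENNReal.ofReal_lt_top
  · intro h
    have := ENNReal.summable_toReal h.ne
    simpa only [ENNReal.toReal_ofReal (hnn _)] using this

theorem HSob.enorm_sq {r : ℝ} (v : HSob r) : ‖v‖ₑ ^ 2 = sobSq r (emod v.coeff) := by
  have hnn : ∀ k, 0 ≤ modeNorm k ^ (2 * r) * ‖v.coeff k‖ ^ 2 := fun k =>
    mul_nonneg (Real.rpow_nonneg (modeNorm_nonneg k) _) (by positivity)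
  rw [← ofReal_norm, ← ENNReal.ofReal_pow (norm_nonneg _), HSob.norm_sq,
    ENNReal.ofReal_tsum_of_nonneg hnn v.isSobolev.2.2]
  simp only [ofReal_weight_mul_sq, sobSq]

/-- The element of `ℋ^r` with given coefficients. -/
def HSob.mk {r : ℝ} (f : ℤ × ℤ → ℂ) (h0 : f 0 = 0) (hneg : ∀ k, f (-k) = -conj (f k))
    (hf : sobSq r (emod f) < ∞) : HSob r :=
  ⟨f, h0, hneg, (summable_iff_sobSq_lt_top r f).2 hf⟩

@[simp] theorem HSob.coeff_mk {r : ℝ} (f : ℤ × ℤ → ℂ) (h0 : f 0 = 0)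
    (hneg : ∀ k, f (-k) = -conj (f k)) (hf : sobSq r (emod f) < ∞) :
    (HSob.mk f h0 hneg hf : HSob r).coeff = f := rfl

theorem weight_mul_enorm_sq_le {r : ℝ} (v : HSob r) (k : ℤ × ℤ) :
    ENNReal.ofReal (modeNorm k ^ (2 * r)) * ‖v.coeff k‖ₑ ^ 2 ≤ ‖v‖ₑ ^ 2 := by
  rw [HSob.enorm_sq]
  exact ENNReal.le_tsum k

theorem HSob.norm_coeff_le {r : ℝ} (hr : 0 ≤ r) (v : HSob r) (k : ℤ × ℤ) :
    ‖v.coeff k‖ ≤ ‖v‖ := by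
  by_cases hk : k = 0
  · rw [hk, v.coeff_zero_mode, norm_zero]; exact norm_nonneg _
  have h1 : ‖v.coeff k‖ₑ ^ 2 ≤ ‖v‖ₑ ^ 2 := by
    refine le_trans ?_ (weight_mul_enorm_sq_le v k)
    refine le_mul_of_one_le_left zero_le ?_
    rw [← ENNReal.ofReal_one]
    exact ENNReal.ofReal_le_ofReal (Real.one_le_rpow (one_le_modeNorm hk) (by linarith))
  have h2 := (ENNReal.pow_le_pow_left_iff two_ne_zero).1 h1
  exact enorm_le_iff_norm_le.1 h2

theorem sobSq_mono_exponent {s t : ℝ} (hst : s ≤ t) {f : ℤ × ℤ → ℝ≥0∞} (hf : f 0 = 0) :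
    sobSq s f ≤ sobSq t f := by
  refine ENNReal.tsum_le_tsum fun k => ?_
  by_cases hk : k = 0
  · simp [hk, hf]
  gcongr
  exact one_le_modeNorm hk

/-- The coefficient functionals. -/
def HSob.coeffL (r : ℝ) (hr : 0 ≤ r) (k : ℤ × ℤ) : HSob r →L[ℝ] ℂ :=
  LinearMap.mkContinuous
    { toFun := fun v => v.coeff k
      map_add' := fun _ _ => rfl
      map_smul' := fun _ _ => rfl } 1 fun v => by
    rw [one_mul]
    exact HSob.norm_coeff_le hr v k

@[simp] theorem HSob.coeffL_apply (r : ℝ) (hr : 0 ≤ r) (k : ℤ × ℤ) (v : HSob r) :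
    HSob.coeffL r hr k v = v.coeff k := rfl

theorem HSob.isometry_toLp (r : ℝ) : Isometry (HSob.toLp r) :=
  AddMonoidHomClass.isometry_of_norm (HSob.toLp r) fun _ => rfl

theorem HSob.toLp_apply (r : ℝ) (v : HSob r) (k : ℤ × ℤ) :
    HSob.toLp r v k = ((modeNorm k ^ r : ℝ) : ℂ) * v.coeff k := rfl

theorem HSob.range_toLp (r : ℝ) : Set.range (HSob.toLp r) =
    {x : lp (fun _ : ℤ × ℤ => ℂ) 2 | x 0 = 0 ∧ ∀ k, x (-k) = -conj (x k)} := by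
  ext x
  constructor
  · rintro ⟨v, rfl⟩
    refine ⟨by rw [HSob.toLp_apply, v.coeff_zero_mode, mul_zero], fun k => ?_⟩
    rw [HSob.toLp_apply, HSob.toLp_apply, v.coeff_neg_mode, modeNorm_neg, map_mul,
      Complex.conj_ofReal]
    ring
  · rintro ⟨h0, hneg⟩
    have hw : weighted r (fun k => ((modeNorm k ^ (-r) : ℝ) : ℂ) * x k) = x := by
      funext k
      rw [weighted]
      by_cases hk : k = 0
      · rw [hk, h0]; simp
      · rw [← mul_assoc, ← Complex.ofReal_mul, ← Real.rpow_add (modeNorm_pos hk)]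
        simp
    refine ⟨⟨fun k => ((modeNorm k ^ (-r) : ℝ) : ℂ) * x k, by simp [h0], fun k => ?_, ?_⟩, ?_⟩
    · change ((modeNorm (-k) ^ (-r) : ℝ) : ℂ) * x (-k) =
        -conj (((modeNorm k ^ (-r) : ℝ) : ℂ) * x k)
      rw [modeNorm_neg, hneg, map_mul, Complex.conj_ofReal]; ring
    · rw [summable_iff_memℓp, hw]
      exact x.2
    · exact Subtype.ext hw

instance (r : ℝ) : CompleteSpace (HSob r) := by
  -- ℋ^r embeds isometrically onto the real, mean zero sequences, which are cut out of ℓ² by closed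
  -- conditions on the coordinates.
  rw [completeSpace_iff_isComplete_range (HSob.isometry_toLp r).isUniformInducing,
    HSob.range_toLp]
  apply IsClosed.isComplete
  have hc : ∀ k, Continuous fun x : lp (fun _ : ℤ × ℤ => ℂ) 2 => x k := fun k =>
    (continuous_apply k).comp lp.uniformContinuous_coe.continuous
  have e : {x : lp (fun _ : ℤ × ℤ => ℂ) 2 | x 0 = 0 ∧ ∀ k, x (-k) = -conj (x k)} =
      {x | x 0 = 0} ∩ ⋂ k, {x | x (-k) = -conj (x k)} := by
    ext x; simp
  rw [e]
  refine (isClosed_eq (hc 0) continuous_const).inter (isClosed_iInter fun k => ?_)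
  exact isClosed_eq (hc (-k)) ((Complex.continuous_conj.comp (hc k)).neg)

/-! ### Truncation to finitely many modes -/

/-- The modes with `|k₁|, |k₂| ≤ N`. -/
def boxModes (N : ℕ) : Finset (ℤ × ℤ) := Finset.Icc (-(N : ℤ)) N ×ˢ Finset.Icc (-(N : ℤ)) N

theorem neg_mem_boxModes {N : ℕ} {k : ℤ × ℤ} : -k ∈ boxModes N ↔ k ∈ boxModes N := by
  simp only [boxModes, Finset.mem_product, Finset.mem_Icc, Prod.fst_neg, Prod.snd_neg]
  constructor <;> rintro ⟨⟨h1, h2⟩, h3, h4⟩ <;> refine ⟨⟨?_, ?_⟩, ?_, ?_⟩ <;> omega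

theorem boxModes_mono {M N : ℕ} (h : M ≤ N) : boxModes M ⊆ boxModes N := by
  intro k
  simp only [boxModes, Finset.mem_product, Finset.mem_Icc]
  rintro ⟨⟨h1, h2⟩, h3, h4⟩
  refine ⟨⟨?_, ?_⟩, ?_, ?_⟩ <;> omega

theorem eventually_mem_boxModes (k : ℤ × ℤ) : ∀ᶠ N in Filter.atTop, k ∈ boxModes N := by
  filter_upwards [Filter.eventually_ge_atTop (max k.1.natAbs k.2.natAbs)] with N hN
  simp only [boxModes, Finset.mem_product, Finset.mem_Icc]
  refine ⟨⟨?_, ?_⟩, ?_, ?_⟩ <;> omega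

theorem tendsto_boxModes : Filter.Tendsto boxModes Filter.atTop Filter.atTop :=
  Filter.tendsto_atTop_finset_of_monotone (fun _ _ h => boxModes_mono h)
    fun k => (eventually_mem_boxModes k).exists

theorem sobSq_mono {s : ℝ} {f g : ℤ × ℤ → ℝ≥0∞} (h : ∀ k, f k ≤ g k) : sobSq s f ≤ sobSq s g :=
  ENNReal.tsum_le_tsum fun k => by gcongr; exact h k

theorem sobSq_lt_top_of_support {s : ℝ} {f : ℤ × ℤ → ℂ} (S : Finset (ℤ × ℤ))
    (hf : ∀ k, k ∉ S → f k = 0) : sobSq s (emod f) < ∞ := by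
  rw [sobSq, tsum_eq_sum (s := S)]
  · exact ENNReal.sum_lt_top.2 fun k _ => ENNReal.mul_lt_top ENNReal.ofReal_lt_top (by simp [emod])
  · intro k hk
    simp [emod, hf k hk]

theorem emod_ite_le (f : ℤ × ℤ → ℂ) (S : Finset (ℤ × ℤ)) (k : ℤ × ℤ) :
    emod (fun k => if k ∈ S then f k else 0) k ≤ emod f k := by
  simp only [emod]
  split_ifs <;> simp

theorem enorm_le_of_emod_le {r : ℝ} {u v : HSob r} (h : ∀ k, emod u.coeff k ≤ emod v.coeff k) :
    ‖u‖ ≤ ‖v‖ := by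
  rw [← enorm_le_iff_norm_le, ← ENNReal.pow_le_pow_left_iff two_ne_zero, HSob.enorm_sq,
    HSob.enorm_sq]
  exact sobSq_mono h

/-- The truncation of an element of `ℋ^r` to the modes in `boxModes N`. -/
def proj (r : ℝ) (N : ℕ) : HSob r →L[ℝ] HSob r :=
  LinearMap.mkContinuous
    { toFun := fun v => HSob.mk (fun k => if k ∈ boxModes N then v.coeff k else 0)
        (by simp [v.coeff_zero_mode])
        (fun k => by by_cases h : k ∈ boxModes N <;> simp [neg_mem_boxModes, h, v.coeff_neg_mode])
        ((sobSq_mono (emod_ite_le _ _)).trans_lt (by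
          rw [← HSob.enorm_sq]; exact ENNReal.pow_lt_top enorm_lt_top))
      map_add' := fun u v => HSob.ext fun k => by
        by_cases h : k ∈ boxModes N <;> simp [h]
      map_smul' := fun c v => HSob.ext fun k => by
        by_cases h : k ∈ boxModes N <;> simp [h] } 1 fun v => by
    rw [one_mul]
    exact enorm_le_of_emod_le (emod_ite_le _ _)

theorem proj_coeff (r : ℝ) (N : ℕ) (v : HSob r) (k : ℤ × ℤ) :
    (proj r N v).coeff k = if k ∈ boxModes N then v.coeff k else 0 := rfl

theorem norm_proj_le (r : ℝ) (N : ℕ) : ‖proj r N‖ ≤ 1 :=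
  LinearMap.mkContinuous_norm_le _ zero_le_one _

theorem norm_proj_apply_le (r : ℝ) (N : ℕ) (v : HSob r) : ‖proj r N v‖ ≤ ‖v‖ :=
  enorm_le_of_emod_le (emod_ite_le _ _)

theorem antitone_norm_sub_proj {r : ℝ} (v : HSob r) : Antitone fun N => ‖v - proj r N v‖ := by
  intro M N hMN
  refine enorm_le_of_emod_le fun k => ?_
  simp only [emod, HSob.coeff_sub, proj_coeff]
  by_cases hM : k ∈ boxModes M
  · simp [hM, boxModes_mono hMN hM]
  · rw [if_neg hM]
    split_ifs <;> simp

theorem tendsto_proj {r : ℝ} (v : HSob r) :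
    Filter.Tendsto (fun N => ‖v - proj r N v‖) Filter.atTop (𝓝 0) := by
  have h1 : ∀ N, ‖v - proj r N v‖ ^ 2 =
      ∑' k : {k // k ∉ boxModes N}, modeNorm k.1 ^ (2 * r) * ‖v.coeff k.1‖ ^ 2 := by
    intro N
    rw [HSob.norm_sq]
    refine Eq.trans ?_ (tsum_subtype {k | k ∉ boxModes N}
      (fun k => modeNorm k ^ (2 * r) * ‖v.coeff k‖ ^ 2)).symm
    refine tsum_congr fun k => ?_
    by_cases hk : k ∈ boxModes N <;> simp [proj_coeff, hk]
  have h2 := (tendsto_tsum_compl_atTop_zero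
    (fun k => modeNorm k ^ (2 * r) * ‖v.coeff k‖ ^ 2)).comp tendsto_boxModes
  have h3 : Filter.Tendsto (fun N => ‖v - proj r N v‖ ^ 2) Filter.atTop (𝓝 0) := by
    simp only [h1]
    exact h2
  have h4 := (Real.continuous_sqrt.tendsto 0).comp h3
  simpa [Function.comp_def, Real.sqrt_sq (norm_nonneg _)] using h4

/-- The element of `ℋ^r` obtained by symmetrizing finitely many coefficients. -/
def synth (r : ℝ) (N : ℕ) : (boxModes N → ℂ) →L[ℝ] HSob r :=
  LinearMap.toContinuousLinearMap
    { toFun := fun a => HSob.mk (fun k => if h : k ∈ boxModes N then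
          (a ⟨k, h⟩ - conj (a ⟨-k, neg_mem_boxModes.2 h⟩)) / 2 * (if k = 0 then 0 else 1) else 0)
        (by simp)
        (fun k => by
          by_cases h : k ∈ boxModes N
          · by_cases h0 : k = 0
            · simp [h0]
            · simp [neg_mem_boxModes, h, h0, neg_div', map_div₀, Complex.conj_ofNat]
          · simp [neg_mem_boxModes, h])
        (sobSq_lt_top_of_support (boxModes N) fun k hk => by simp [hk])
      map_add' := fun a b => HSob.ext fun k => by
        by_cases h : k ∈ boxModes N <;> by_cases h0 : k = 0 <;> simp [h, h0]
        ring
      map_smul' := fun c a => HSob.ext fun k => by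
        by_cases h : k ∈ boxModes N <;> by_cases h0 : k = 0 <;> simp [h, h0]
        ring }

theorem synth_coeff (r : ℝ) (N : ℕ) (a : boxModes N → ℂ) (k : ℤ × ℤ) :
    (synth r N a).coeff k = if h : k ∈ boxModes N then
      (a ⟨k, h⟩ - conj (a ⟨-k, neg_mem_boxModes.2 h⟩)) / 2 * (if k = 0 then 0 else 1) else 0 := rfl

theorem synth_coeff_self (r : ℝ) (N : ℕ) (v : HSob r) :
    synth r N (fun k => v.coeff k) = proj r N v := by
  refine HSob.ext fun k => ?_
  rw [synth_coeff, proj_coeff]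
  by_cases h : k ∈ boxModes N
  · by_cases h0 : k = 0
    · simp [h0, v.coeff_zero_mode]
    · simp [h, h0, v.coeff_neg_mode]
  · simp [h]

/-! ### Measurability and continuity through coefficients -/

/-- Each truncation is a continuous function of finitely many coefficients, and truncations converge
in norm. `synth` symmetrizes so as to be defined on arbitrary finite families; on true coefficients
it is the truncation. -/
theorem HSob.stronglyMeasurable_of_coeff {α : Type*} [MeasurableSpace α] {r : ℝ} {f : α → HSob r}
    (h : ∀ k, Measurable fun a => (f a).coeff k) : StronglyMeasurable f := by
  refine stronglyMeasurable_of_tendsto Filter.atTop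
    (f := fun N a => synth r N (fun k => (f a).coeff k)) (fun N => ?_) ?_
  · have h1 : Measurable fun a => (fun k : boxModes N => (f a).coeff k) :=
      measurable_pi_lambda _ fun k => h k
    exact (synth r N).continuous.comp_stronglyMeasurable h1.stronglyMeasurable
  · rw [tendsto_pi_nhds]
    intro a
    simp only [synth_coeff_self]
    rw [tendsto_iff_norm_sub_tendsto_zero]
    simpa only [norm_sub_rev] using tendsto_proj (f a)

theorem HSob.continuous_of_dominated {X : Type*} [TopologicalSpace X] {r : ℝ} {f : X → HSob r}
    (hf : ∀ k, Continuous fun x => (f x).coeff k) {a : ℤ × ℤ → ℝ}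
    (ha : ∀ x k, ‖(f x).coeff k‖ ≤ a k)
    (hs : Summable fun k => modeNorm k ^ (2 * r) * a k ^ 2) : Continuous f := by
  rw [continuous_iff_continuousAt]
  intro x
  rw [ContinuousAt, tendsto_iff_norm_sub_tendsto_zero]
  have h3 : Filter.Tendsto (fun y => ‖f y - f x‖ ^ 2) (𝓝 x) (𝓝 0) := by
    simp only [HSob.norm_sq, HSob.coeff_sub]
    have h0 : (0 : ℝ) = ∑' k : ℤ × ℤ, modeNorm k ^ (2 * r) * ‖(f x).coeff k - (f x).coeff k‖ ^ 2 := by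
      simp
    rw [h0]
    refine tendsto_tsum_of_dominated_convergence
      (bound := fun k => 4 * (modeNorm k ^ (2 * r) * a k ^ 2)) (hs.mul_left 4) (fun k => ?_) ?_
    · have h1 : Continuous fun y => modeNorm k ^ (2 * r) * ‖(f y).coeff k - (f x).coeff k‖ ^ 2 :=
        continuous_const.mul ((((hf k).sub continuous_const).norm).pow 2)
      exact h1.tendsto x
    · refine Filter.Eventually.of_forall fun y k => ?_
      have hw := Real.rpow_nonneg (modeNorm_nonneg k) (2 * r)
      rw [Real.norm_of_nonneg (by positivity)]
      have h1 : ‖(f y).coeff k - (f x).coeff k‖ ≤ 2 * a k :=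
        (norm_sub_le _ _).trans (by linarith [ha y k, ha x k])
      calc _ ≤ modeNorm k ^ (2 * r) * (2 * a k) ^ 2 := by gcongr
        _ = _ := by ring
  have h4 := (Real.continuous_sqrt.tendsto 0).comp h3
  simpa [Function.comp_def, Real.sqrt_sq (norm_nonneg _)] using h4

/-! ### The heat semigroup applied to the nonlinearity -/

theorem summable_nonlin {σ : ℝ} (hσ : 0 ≤ σ) (u v : HSob σ) (k : ℤ × ℤ) :
    Summable fun h => (gammaCoeff h k : ℂ) * u.coeff h * v.coeff (k - h) := by
  have hfin : ∀ w : HSob σ, ∑' h, emod w.coeff h ^ 2 < ∞ := by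
    intro w
    have h1 : sobSq 0 (emod w.coeff) < ∞ :=
      (sobSq_mono_exponent hσ (by simp [emod, w.coeff_zero_mode])).trans_lt (by
        rw [← HSob.enorm_sq]; exact ENNReal.pow_lt_top enorm_lt_top)
    simpa [sobSq] using h1
  have h2 : ∑' h, emod v.coeff (k - h) ^ 2 < ∞ := by
    exact ((Equiv.subLeft k).tsum_eq (fun h => emod v.coeff h ^ 2)).trans_lt (hfin v)
  have h3 : ∑' h, ‖(gammaCoeff h k : ℂ) * u.coeff h * v.coeff (k - h)‖ₑ < ∞ := by
    calc _ ≤ ∑' h, ENNReal.ofReal (modeNorm k) * (emod u.coeff h * emod v.coeff (k - h)) := by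
          refine ENNReal.tsum_le_tsum fun h => ?_
          rw [enorm_mul, enorm_mul, mul_assoc]
          exact mul_le_mul_left (enorm_ofReal_gammaCoeff_le h k) _
      _ < ∞ := by
          rw [ENNReal.tsum_mul_left]
          refine ENNReal.mul_lt_top ENNReal.ofReal_lt_top ?_
          have h4 := (tsum_mul_sq_le (emod u.coeff) (fun h => emod v.coeff (k - h))).trans_lt
            (ENNReal.mul_lt_top (hfin u) h2)
          exact (ENNReal.pow_lt_top_iff.1 h4).resolve_right two_ne_zero
  exact Summable.of_enorm h3.ne

theorem nonlin_add_left {σ : ℝ} (hσ : 0 ≤ σ) (u u' v : HSob σ) (k : ℤ × ℤ) :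
    nonlin (u + u').coeff v.coeff k = nonlin u.coeff v.coeff k + nonlin u'.coeff v.coeff k := by
  simp only [nonlin_eq]
  rw [← mul_add, ← (summable_nonlin hσ u v k).tsum_add (summable_nonlin hσ u' v k)]
  congr 1
  exact tsum_congr fun h => by rw [HSob.coeff_add]; ring

theorem nonlin_add_right {σ : ℝ} (hσ : 0 ≤ σ) (u v v' : HSob σ) (k : ℤ × ℤ) :
    nonlin u.coeff (v + v').coeff k = nonlin u.coeff v.coeff k + nonlin u.coeff v'.coeff k := by
  simp only [nonlin_eq]
  rw [← mul_add, ← (summable_nonlin hσ u v k).tsum_add (summable_nonlin hσ u v' k)]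
  congr 1
  exact tsum_congr fun h => by rw [HSob.coeff_add]; ring

theorem nonlin_smul_left {σ : ℝ} (c : ℝ) (u v : HSob σ) (k : ℤ × ℤ) :
    nonlin (c • u).coeff v.coeff k = c • nonlin u.coeff v.coeff k := by
  simp only [nonlin_eq]
  rw [← mul_smul_comm, ← tsum_const_smul'']
  congr 1
  exact tsum_congr fun h => by rw [HSob.coeff_smul, Complex.real_smul, Complex.real_smul]; ring

theorem nonlin_smul_right {σ : ℝ} (c : ℝ) (u v : HSob σ) (k : ℤ × ℤ) :
    nonlin u.coeff (c • v).coeff k = c • nonlin u.coeff v.coeff k := by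
  simp only [nonlin_eq]
  rw [← mul_smul_comm, ← tsum_const_smul'']
  congr 1
  exact tsum_congr fun h => by rw [HSob.coeff_smul, Complex.real_smul, Complex.real_smul]; ring

/-- The order of the singularity of the heat semigroup from `ℋ^{-1-(1-σ)²}` to `ℋ^σ`. -/
def heatExponent (σ : ℝ) : ℝ := 1 - σ * (1 - σ) / 2

/-- The exponent (1-σ)² is a compromise: 2σ + (1-σ)² = 1 + σ² exceeds 1, while the total smoothing
needed, σ + 1 + (1-σ)² = 2 - σ(1-σ), stays below 2 when σ < 1. -/
theorem admissible_self {σ : ℝ} (hσ : 0 < σ) : Admissible σ σ ((1 - σ) ^ 2) :=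
  ⟨hσ.le, hσ.le, sq_nonneg _, Or.inl (by nlinarith)⟩

theorem rpow_mul_exp_neg_le_one {x p : ℝ} (hx : 0 ≤ x) (hp : 0 ≤ p) (hp1 : p ≤ 1) :
    x ^ p * Real.exp (-x) ≤ 1 := by
  have h1 : x ^ p ≤ Real.exp x := by
    rcases le_total x 1 with h | h
    · exact (Real.rpow_le_one hx h hp).trans (Real.one_le_exp hx)
    · calc x ^ p ≤ x ^ (1 : ℝ) := Real.rpow_le_rpow_of_exponent_le h hp1
        _ = x := Real.rpow_one x
        _ ≤ Real.exp x := by linarith [Real.add_one_le_exp x]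
  calc x ^ p * Real.exp (-x) ≤ Real.exp x * Real.exp (-x) := by gcongr
    _ = 1 := by rw [← Real.exp_add]; simp

/-- The coefficients of `e^{rA} B(u, v)`. -/
def heatNonlin (r : ℝ) (u v : ℤ × ℤ → ℂ) (k : ℤ × ℤ) : ℂ :=
  (Real.exp (-(modeNorm k ^ 2 * r)) : ℂ) * nonlin u v k

/-- Mode by mode, x^θ e^{-x} ≤ 1 at x = |k|² r trades 2θ derivatives for r^{-θ}; the estimate of B
in the space of negative order supplies the rest. -/
theorem exists_heatNonlin_bound {σ : ℝ} (hσ : 0 < σ) (hσ1 : σ < 1) : ∃ K : ℝ, 0 ≤ K ∧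
    ∀ r : ℝ, 0 < r → ∀ u v : HSob σ, sobSq σ (emod (heatNonlin r u.coeff v.coeff)) ≤
      (ENNReal.ofReal (K * r ^ (-heatExponent σ)) * ‖u‖ₑ * ‖v‖ₑ) ^ 2 := by
  obtain ⟨C, hC, H⟩ := exists_sobSq_nonlin_le (admissible_self hσ)
  refine ⟨Real.sqrt C.toReal, Real.sqrt_nonneg _, fun r hr u v => ?_⟩
  specialize H u.coeff v.coeff u.coeff_zero_mode v.coeff_zero_mode
  set c := (1 - σ) ^ 2 with hc
  have hθ : 2 * heatExponent σ = σ + (1 + c) := by rw [heatExponent, hc]; ring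
  have hθ0 : 0 ≤ heatExponent σ := by rw [heatExponent]; nlinarith
  have hθ1 : heatExponent σ ≤ 1 := by rw [heatExponent]; nlinarith
  have h1 : sobSq σ (emod (heatNonlin r u.coeff v.coeff)) ≤
      ENNReal.ofReal (r ^ (-heatExponent σ)) ^ 2 *
        sobSq (-(1 + c)) (emod (nonlin u.coeff v.coeff)) := by
    rw [sobSq, sobSq, ← ENNReal.tsum_mul_left]
    refine ENNReal.tsum_le_tsum fun k => ?_
    by_cases hk : k = 0
    · simp [hk, emod, heatNonlin, nonlin_zero]
    have hkp := modeNorm_pos hk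
    have e1 : emod (heatNonlin r u.coeff v.coeff) k =
        ENNReal.ofReal (Real.exp (-(modeNorm k ^ 2 * r))) * emod (nonlin u.coeff v.coeff) k := by
      rw [emod, heatNonlin, enorm_mul, emod]
      congr 1
      rw [← ofReal_norm, Complex.norm_real, Real.norm_of_nonneg (Real.exp_pos _).le]
    rw [e1, mul_pow, ← mul_assoc, ← mul_assoc]
    refine mul_le_mul_left ?_ _
    rw [← ENNReal.ofReal_pow (by positivity), ← ENNReal.ofReal_pow (by positivity),
      ← ENNReal.ofReal_mul (by positivity), ← ENNReal.ofReal_mul (by positivity)]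
    apply ENNReal.ofReal_le_ofReal
    have h2 := rpow_mul_exp_neg_le_one (x := modeNorm k ^ 2 * r) (by positivity) hθ0 hθ1
    rw [Real.mul_rpow (by positivity) hr.le] at h2
    have h3 : (modeNorm k ^ 2) ^ heatExponent σ = modeNorm k ^ σ * modeNorm k ^ (1 + c) := by
      rw [← Real.rpow_natCast, ← Real.rpow_mul hkp.le, ← Real.rpow_add hkp]
      congr 1
    rw [h3] at h2
    have h4 : modeNorm k ^ σ * Real.exp (-(modeNorm k ^ 2 * r)) ≤
        r ^ (-heatExponent σ) * modeNorm k ^ (-(1 + c)) := by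
      rw [Real.rpow_neg hr.le, Real.rpow_neg hkp.le, ← mul_inv, ← one_div,
        le_div_iff₀ (by positivity)]
      exact (le_of_eq (by ring)).trans h2
    calc _ = (modeNorm k ^ σ * Real.exp (-(modeNorm k ^ 2 * r))) ^ 2 := by
          rw [mul_pow, ← Real.rpow_natCast (modeNorm k ^ σ), ← Real.rpow_mul hkp.le]
          congr 2
          push_cast; ring
      _ ≤ (r ^ (-heatExponent σ) * modeNorm k ^ (-(1 + c))) ^ 2 := by gcongr
      _ = _ := by
          rw [mul_pow, ← Real.rpow_natCast (modeNorm k ^ (-(1 + c))), ← Real.rpow_mul hkp.le]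
          congr 2
          push_cast; ring
  refine h1.trans ?_
  rw [← HSob.enorm_sq, ← HSob.enorm_sq] at H
  calc _ ≤ ENNReal.ofReal (r ^ (-heatExponent σ)) ^ 2 * (C * (‖u‖ₑ ^ 2 * ‖v‖ₑ ^ 2)) := by gcongr
    _ = _ := by
      have hCe : C = ENNReal.ofReal (Real.sqrt C.toReal) ^ 2 := by
        rw [← ENNReal.ofReal_pow (Real.sqrt_nonneg _), Real.sq_sqrt ENNReal.toReal_nonneg,
          ENNReal.ofReal_toReal hC.ne]
      conv_lhs => rw [hCe]
      rw [ENNReal.ofReal_mul (Real.sqrt_nonneg _)]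
      ring

theorem HSob.norm_le_of_sobSq_le {r c : ℝ} (hc : 0 ≤ c) {u : HSob r}
    (h : sobSq r (emod u.coeff) ≤ ENNReal.ofReal c ^ 2) : ‖u‖ ≤ c := by
  rw [← HSob.enorm_sq, ENNReal.pow_le_pow_left_iff two_ne_zero, ← ofReal_norm] at h
  exact (ENNReal.ofReal_le_ofReal_iff hc).1 h

/-- The constant in the bound of `e^{rA} B(u, v)` in `ℋ^σ`. -/
def heatConst (σ : ℝ) : ℝ :=
  if h : 0 < σ ∧ σ < 1 then (exists_heatNonlin_bound h.1 h.2).choose else 0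

theorem heatConst_nonneg (σ : ℝ) : 0 ≤ heatConst σ := by
  rw [heatConst]
  split_ifs with h
  · exact (exists_heatNonlin_bound h.1 h.2).choose_spec.1
  · exact le_rfl

theorem sobSq_heatNonlin_le {σ : ℝ} (hσ : 0 < σ) (hσ1 : σ < 1) {r : ℝ} (hr : 0 < r)
    (u v : HSob σ) : sobSq σ (emod (heatNonlin r u.coeff v.coeff)) ≤
      (ENNReal.ofReal (heatConst σ * r ^ (-heatExponent σ)) * ‖u‖ₑ * ‖v‖ₑ) ^ 2 := by
  rw [heatConst, dif_pos ⟨hσ, hσ1⟩]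
  exact (exists_heatNonlin_bound hσ hσ1).choose_spec.2 r hr u v

/-- The bilinear map `(u, v) ↦ e^{rA} B(u, v)` on `ℋ^σ`, for `0 < σ < 1` and `r > 0`. -/
def heatBilin (σ r : ℝ) : HSob σ →L[ℝ] HSob σ →L[ℝ] HSob σ :=
  if h : 0 < σ ∧ σ < 1 ∧ 0 < r then
    LinearMap.mkContinuous₂ (LinearMap.mk₂ ℝ
      (fun u v => (HSob.mk (heatNonlin r u.coeff v.coeff) (by simp [heatNonlin, nonlin_zero])
        (fun k => by
          rw [heatNonlin, heatNonlin, nonlin_neg u.coeff_neg_mode v.coeff_neg_mode, modeNorm_neg,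
            map_mul, Complex.conj_ofReal]
          ring)
        ((sobSq_heatNonlin_le h.1 h.2.1 h.2.2 u v).trans_lt (by finiteness)) : HSob σ))
      (fun u u' v => HSob.ext fun k => by
        simp only [HSob.coeff_mk, HSob.coeff_add, heatNonlin, nonlin_add_left h.1.le]; ring)
      (fun c u v => HSob.ext fun k => by
        simp only [HSob.coeff_mk, HSob.coeff_smul, heatNonlin, nonlin_smul_left,
          mul_smul_comm])
      (fun u v v' => HSob.ext fun k => by
        simp only [HSob.coeff_mk, HSob.coeff_add, heatNonlin, nonlin_add_right h.1.le]; ring)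
      (fun c u v => HSob.ext fun k => by
        simp only [HSob.coeff_mk, HSob.coeff_smul, heatNonlin, nonlin_smul_right,
          mul_smul_comm]))
      (heatConst σ * r ^ (-heatExponent σ)) (fun u v => by
        have hK := heatConst_nonneg σ
        have hr := h.2.2
        have h1 := sobSq_heatNonlin_le h.1 h.2.1 h.2.2 u v
        refine HSob.norm_le_of_sobSq_le (by positivity) (h1.trans (le_of_eq ?_))
        have hp : 0 ≤ heatConst σ * r ^ (-heatExponent σ) := by positivity
        rw [ENNReal.ofReal_mul (mul_nonneg hp (norm_nonneg u)), ENNReal.ofReal_mul hp,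
          ofReal_norm, ofReal_norm])
  else 0

theorem heatBilin_of_nonpos {σ r : ℝ} (hr : r ≤ 0) : heatBilin σ r = 0 := by
  rw [heatBilin, dif_neg]
  rintro ⟨-, -, h⟩
  linarith

theorem heatBilin_coeff {σ : ℝ} (hσ : 0 < σ) (hσ1 : σ < 1) {r : ℝ} (hr : 0 < r) (u v : HSob σ)
    (k : ℤ × ℤ) : (heatBilin σ r u v).coeff k =
      (Real.exp (-(modeNorm k ^ 2 * r)) : ℂ) * nonlin u.coeff v.coeff k := by
  rw [heatBilin, dif_pos ⟨hσ, hσ1, hr⟩]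
  rfl

theorem norm_heatBilin_le (σ : ℝ) {r : ℝ} (hr : 0 < r) (u v : HSob σ) :
    ‖heatBilin σ r u v‖ ≤ heatConst σ * r ^ (-heatExponent σ) * ‖u‖ * ‖v‖ := by
  have hK : 0 ≤ heatConst σ * r ^ (-heatExponent σ) :=
    mul_nonneg (heatConst_nonneg σ) (by positivity)
  refine ContinuousLinearMap.le_of_opNorm₂_le_of_le _ ?_ le_rfl le_rfl
  rw [heatBilin]
  split_ifs
  · exact LinearMap.mkContinuous₂_norm_le _ hK _
  · exact (norm_zero (E := HSob σ →L[ℝ] HSob σ →L[ℝ] HSob σ)).trans_le hK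

/-- A coefficient of B is e^{|k|²} times that of e^{A}B, and the latter is a bounded bilinear map on
ℋ^σ. -/
theorem continuous_nonlin {σ : ℝ} (hσ : 0 < σ) (hσ1 : σ < 1) (k : ℤ × ℤ) :
    Continuous fun p : HSob σ × HSob σ => nonlin p.1.coeff p.2.coeff k := by
  have h1 : (fun p : HSob σ × HSob σ => nonlin p.1.coeff p.2.coeff k) = fun p =>
      (Real.exp (modeNorm k ^ 2) : ℂ) * (HSob.coeffL σ hσ.le k (heatBilin σ 1 p.1 p.2)) := by
    funext p
    rw [HSob.coeffL_apply, heatBilin_coeff hσ hσ1 one_pos, ← mul_assoc, ← Complex.ofReal_mul,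
      ← Real.exp_add]
    simp
  rw [h1]
  have h2 : Continuous fun p : HSob σ × HSob σ => heatBilin σ 1 p.1 p.2 := by fun_prop
  exact continuous_const.mul ((HSob.coeffL σ hσ.le k).continuous.comp h2)

/-! ### Volterra equations with an integrable kernel -/

section Volterra

variable {E : Type*} [NormedAddCommGroup E]

/-- `Ψ r s x` is Lipschitz in `x` with the integrable constant `k r`, and depends continuously on
`(s, x)`. -/
structure IsVolterraKernel (T : ℝ) (k : ℝ → ℝ) (Ψ : ℝ → ℝ → E → E) : Prop where
  integrable : IntervalIntegrable k volume 0 T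
  nonneg : ∀ r, 0 ≤ k r
  continuous : ∀ r, Continuous fun p : ℝ × E => Ψ r p.1 p.2
  measurable : ∀ x : ℝ → E, Continuous x → ∀ t,
    StronglyMeasurable fun r => Ψ r (t - r) (x (t - r))
  lipschitz : ∀ r ∈ Set.Ioc 0 T, ∀ s x y, ‖Ψ r s x - Ψ r s y‖ ≤ k r * ‖x - y‖
  map_zero : ∀ r s, Ψ r s 0 = 0

variable {T : ℝ} {k : ℝ → ℝ} {Ψ : ℝ → ℝ → E → E}

theorem intervalIntegrable_mul_comp_sub (hk : IntervalIntegrable k volume 0 T) {t : ℝ}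
    (ht : t ∈ Set.Icc 0 T) {f : ℝ → ℝ} (hf : Continuous f) :
    IntervalIntegrable (fun r => k r * f (t - r)) volume 0 t := by
  have h1 : IntervalIntegrable k volume 0 t := hk.mono_set (by
    rw [Set.uIcc_of_le ht.1, Set.uIcc_of_le (ht.1.trans ht.2)]
    exact Set.Icc_subset_Icc_right ht.2)
  exact h1.mul_continuousOn (by fun_prop)

theorem IsVolterraKernel.norm_le (h : IsVolterraKernel T k Ψ) {r : ℝ} (hr : r ∈ Set.Ioc 0 T)
    (s : ℝ) (x : E) : ‖Ψ r s x‖ ≤ k r * ‖x‖ := by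
  have := h.lipschitz r hr s x 0
  rwa [h.map_zero, sub_zero, sub_zero] at this

theorem IsVolterraKernel.intervalIntegrable (h : IsVolterraKernel T k Ψ) {t : ℝ}
    (ht : t ∈ Set.Icc 0 T) {x : ℝ → E} (hx : Continuous x) :
    IntervalIntegrable (fun r => Ψ r (t - r) (x (t - r))) volume 0 t := by
  refine (intervalIntegrable_mul_comp_sub h.integrable ht hx.norm).mono_fun'
    (h.measurable x hx t).aestronglyMeasurable ?_
  rw [Set.uIoc_of_le ht.1]
  filter_upwards [ae_restrict_mem measurableSet_Ioc] with r hr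
  exact h.norm_le ⟨hr.1, hr.2.trans ht.2⟩ _ _

variable [NormedSpace ℝ E]

/-- The convolution `∫₀ᵗ Ψ(r, t - r, x(t - r)) dr`. -/
def volterraInt (Ψ : ℝ → ℝ → E → E) (x : ℝ → E) (t : ℝ) : E :=
  ∫ r in (0 : ℝ)..t, Ψ r (t - r) (x (t - r))

theorem IsVolterraKernel.norm_volterraInt_sub_le (h : IsVolterraKernel T k Ψ) {t : ℝ}
    (ht : t ∈ Set.Icc 0 T) {x y : ℝ → E} (hx : Continuous x) (hy : Continuous y) :
    ‖volterraInt Ψ x t - volterraInt Ψ y t‖ ≤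
      ∫ r in (0 : ℝ)..t, k r * ‖x (t - r) - y (t - r)‖ := by
  rw [volterraInt, volterraInt, ← intervalIntegral.integral_sub (h.intervalIntegrable ht hx)
    (h.intervalIntegrable ht hy)]
  refine intervalIntegral.norm_integral_le_of_norm_le ht.1 ?_
    (intervalIntegrable_mul_comp_sub h.integrable ht (hx.sub hy).norm)
  exact Filter.Eventually.of_forall fun r hr => h.lipschitz r ⟨hr.1, hr.2.trans ht.2⟩ _ _ _

/-- Extending the integrand by zero for r > t gives a fixed domain of integration, and dominated
convergence applies with the majorant k(r) times a bound for x. -/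
theorem IsVolterraKernel.continuous_volterraInt (h : IsVolterraKernel T k Ψ) (hT : 0 ≤ T)
    {x : ℝ → E} (hx : Continuous x) :
    Continuous fun t : Set.Icc (0 : ℝ) T => volterraInt Ψ x t := by
  classical
  obtain ⟨B, hB⟩ := (isCompact_Icc (a := (0 : ℝ)) (b := T)).exists_bound_of_continuousOn
    hx.continuousOn
  have hB0 : 0 ≤ B := (norm_nonneg _).trans (hB 0 ⟨le_rfl, hT⟩)
  set F : Set.Icc (0 : ℝ) T → ℝ → E := fun t => (Set.Ioc 0 (t : ℝ)).indicator
    (fun r => Ψ r (t - r) (x (t - r))) with hF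
  have e : ∀ t : Set.Icc (0 : ℝ) T, volterraInt Ψ x t = ∫ r in Set.Ioc 0 T, F t r := by
    intro t
    rw [volterraInt, intervalIntegral.integral_of_le t.2.1, hF,
      setIntegral_indicator measurableSet_Ioc, Set.inter_eq_self_of_subset_right
        (Set.Ioc_subset_Ioc_right t.2.2)]
  simp only [e]
  have hk1 : IntegrableOn k (Set.Ioc 0 T) :=
    (intervalIntegrable_iff_integrableOn_Ioc_of_le hT).1 h.integrable
  rw [continuous_iff_continuousAt]
  intro t₀
  refine continuousAt_of_dominated (bound := fun r => k r * B) ?_ ?_ (hk1.mul_const B) ?_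
  · exact Filter.Eventually.of_forall fun t =>
      ((h.measurable x hx t).indicator measurableSet_Ioc).aestronglyMeasurable
  · refine Filter.Eventually.of_forall fun t => ?_
    filter_upwards [ae_restrict_mem measurableSet_Ioc] with r hr
    have hkr : 0 ≤ k r * B := mul_nonneg (h.nonneg r) hB0
    rw [hF]
    simp only
    rw [Set.indicator_apply]
    split_ifs with hrt
    · refine (h.norm_le hr _ _).trans ?_
      exact mul_le_mul_of_nonneg_left
        (hB _ ⟨by linarith [hrt.2], by linarith [hrt.1, t.2.2]⟩) (h.nonneg r)
    · rw [norm_zero]; exact hkr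
  · have hne : ∀ᵐ r ∂((volume : Measure ℝ).restrict (Set.Ioc (0 : ℝ) T)), r ≠ (t₀ : ℝ) :=
      ae_restrict_of_ae (Measure.ae_ne (volume : Measure ℝ) (t₀ : ℝ))
    filter_upwards [hne, ae_restrict_mem measurableSet_Ioc] with r hr hr'
    have hcont : Continuous fun t : Set.Icc (0 : ℝ) T => Ψ r (t - r) (x (t - r)) :=
      (h.continuous r).comp (by fun_prop : Continuous fun t : Set.Icc (0 : ℝ) T =>
        ((t : ℝ) - r, x (t - r)))
    rcases lt_or_gt_of_ne hr with hlt | hgt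
    · refine hcont.continuousAt.congr ?_
      have : ∀ᶠ t : Set.Icc (0 : ℝ) T in 𝓝 t₀, r < t :=
        continuous_subtype_val.continuousAt.eventually (lt_mem_nhds hlt)
      filter_upwards [this] with t ht
      rw [hF]
      simp only
      rw [Set.indicator_of_mem (show r ∈ Set.Ioc 0 (t : ℝ) from ⟨hr'.1, ht.le⟩)]
    · refine (continuousAt_const (y := (0 : E))).congr ?_
      have : ∀ᶠ t : Set.Icc (0 : ℝ) T in 𝓝 t₀, (t : ℝ) < r :=
        continuous_subtype_val.continuousAt.eventually (gt_mem_nhds hgt)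
      filter_upwards [this] with t ht
      rw [hF]
      simp only
      rw [Set.indicator_of_notMem]
      rintro ⟨-, h2⟩
      linarith

/-- By dominated convergence a strong exponential weight makes the mass of any integrable kernel
small. This replaces iteration over short time intervals. -/
theorem exists_exp_weight (hT : 0 ≤ T) (hk : IntervalIntegrable k volume 0 T)
    (hk0 : ∀ r, 0 ≤ k r) : ∃ m : ℝ, 0 ≤ m ∧
      ∫ r in (0 : ℝ)..T, k r * Real.exp (-(m * r)) ≤ 1 / 2 := by
  have h1 : Filter.Tendsto (fun n : ℕ => ∫ r in (0 : ℝ)..T, k r * Real.exp (-(n * r)))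
      Filter.atTop (𝓝 (∫ _r in (0 : ℝ)..T, (0 : ℝ))) := by
    refine intervalIntegral.tendsto_integral_filter_of_dominated_convergence k ?_ ?_ hk ?_
    · refine Filter.Eventually.of_forall fun n => ?_
      exact hk.def'.aestronglyMeasurable.mul (by fun_prop : Continuous fun r : ℝ =>
        Real.exp (-(n * r))).aestronglyMeasurable
    · refine Filter.Eventually.of_forall fun n => Filter.Eventually.of_forall fun r hr => ?_
      rw [Set.uIoc_of_le hT] at hr
      rw [Real.norm_of_nonneg (mul_nonneg (hk0 r) (Real.exp_pos _).le)]
      refine mul_le_of_le_one_right (hk0 r) (Real.exp_le_one_iff.2 ?_)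
      have : 0 ≤ (n : ℝ) * r := mul_nonneg (Nat.cast_nonneg n) hr.1.le
      linarith
    · refine Filter.Eventually.of_forall fun r hr => ?_
      rw [Set.uIoc_of_le hT] at hr
      rw [← mul_zero (k r)]
      refine Filter.Tendsto.const_mul _ (Real.tendsto_exp_neg_atTop_nhds_zero.comp ?_)
      exact tendsto_natCast_atTop_atTop.atTop_mul_const hr.1
  rw [intervalIntegral.integral_zero] at h1
  obtain ⟨n, hn⟩ := (h1.eventually (ge_mem_nhds (by norm_num : (0 : ℝ) < 1 / 2))).exists
  exact ⟨n, Nat.cast_nonneg n, hn⟩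

/-- Convolution with k halves the exponentially weighted sup norm, because e^{m(t-r)} = e^{mt}
e^{-mr}. -/
theorem integral_mul_exp_le (hk : IntervalIntegrable k volume 0 T) (hk0 : ∀ r, 0 ≤ k r) {m : ℝ}
    (hm : ∫ r in (0 : ℝ)..T, k r * Real.exp (-(m * r)) ≤ 1 / 2) {t : ℝ} (ht : t ∈ Set.Icc 0 T)
    {f : ℝ → ℝ} (hf : Continuous f) {M : ℝ} (hM : 0 ≤ M)
    (hfM : ∀ s ∈ Set.Icc 0 T, f s ≤ M * Real.exp (m * s)) :
    ∫ r in (0 : ℝ)..t, k r * f (t - r) ≤ M * Real.exp (m * t) / 2 := by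
  have hw : IntervalIntegrable (fun r => k r * Real.exp (-(m * r))) volume 0 T :=
    hk.mul_continuousOn (by fun_prop)
  have hsub : Set.uIcc 0 t ⊆ Set.uIcc 0 T := by
    rw [Set.uIcc_of_le ht.1, Set.uIcc_of_le (ht.1.trans ht.2)]
    exact Set.Icc_subset_Icc_right ht.2
  have hmono : ∫ r in (0 : ℝ)..t, k r * Real.exp (-(m * r)) ≤
      ∫ r in (0 : ℝ)..T, k r * Real.exp (-(m * r)) := by
    refine intervalIntegral.integral_mono_interval le_rfl ht.1 ht.2 ?_ hw
    exact Filter.Eventually.of_forall fun r => mul_nonneg (hk0 r) (Real.exp_pos _).le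
  calc _ ≤ ∫ r in (0 : ℝ)..t, (M * Real.exp (m * t)) * (k r * Real.exp (-(m * r))) := by
        refine intervalIntegral.integral_mono_on ht.1
          (intervalIntegrable_mul_comp_sub hk ht hf) ((hw.mono_set hsub).const_mul _) ?_
        intro r hr
        have h1 := hfM (t - r) ⟨by linarith [hr.2], by linarith [hr.1, ht.2]⟩
        calc k r * f (t - r) ≤ k r * (M * Real.exp (m * (t - r))) :=
              mul_le_mul_of_nonneg_left h1 (hk0 r)
          _ = _ := by
              rw [mul_sub, sub_eq_add_neg, Real.exp_add]; ring
    _ = (M * Real.exp (m * t)) * ∫ r in (0 : ℝ)..t, k r * Real.exp (-(m * r)) := by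
        rw [intervalIntegral.integral_const_mul]
    _ ≤ (M * Real.exp (m * t)) * (1 / 2) := by
        gcongr
        exact hmono.trans hm
    _ = _ := by ring

/-- Gronwall's inequality for an integrable convolution kernel. -/
theorem exists_gronwall (hT : 0 ≤ T) (hk : IntervalIntegrable k volume 0 T)
    (hk0 : ∀ r, 0 ≤ k r) : ∃ C : ℝ, 0 ≤ C ∧ ∀ (e : ℝ → ℝ) (d : ℝ), Continuous e →
      0 ≤ d → (∀ t ∈ Set.Icc 0 T, 0 ≤ e t) →
      (∀ t ∈ Set.Icc 0 T, e t ≤ d + ∫ r in (0 : ℝ)..t, k r * e (t - r)) →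
      ∀ t ∈ Set.Icc 0 T, e t ≤ C * d := by
  obtain ⟨m, hm0, hm⟩ := exists_exp_weight hT hk hk0
  refine ⟨2 * Real.exp (m * T), by positivity, fun e d he hd he0 h t ht => ?_⟩
  -- At the maximum of the weighted function the integral term is at most half of the left side and
  -- can be absorbed.
  obtain ⟨t₀, ht₀, hmax⟩ := (isCompact_Icc (a := (0 : ℝ)) (b := T)).exists_isMaxOn
    ⟨0, le_rfl, hT⟩ (f := fun t => Real.exp (-(m * t)) * e t) (by fun_prop)
  set M := Real.exp (-(m * t₀)) * e t₀ with hMdef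
  have hM0 : 0 ≤ M := mul_nonneg (Real.exp_pos _).le (he0 t₀ ht₀)
  have hee : ∀ s : ℝ, Real.exp (m * s) * Real.exp (-(m * s)) = 1 := fun s => by
    rw [← Real.exp_add]; simp
  have heM : ∀ s ∈ Set.Icc 0 T, e s ≤ M * Real.exp (m * s) := by
    intro s hs
    have h1 : Real.exp (-(m * s)) * e s ≤ M := hmax hs
    calc e s = Real.exp (-(m * s)) * e s * Real.exp (m * s) := by linear_combination (-e s) * hee s
      _ ≤ _ := by gcongr
  have h2 := (h t₀ ht₀).trans (add_le_add_right
    (integral_mul_exp_le hk hk0 hm ht₀ he hM0 heM) d)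
  have h3 : e t₀ = M * Real.exp (m * t₀) := by rw [hMdef]; linear_combination (-e t₀) * hee t₀
  have h4 : M * Real.exp (m * t₀) ≤ 2 * d := by linarith
  have h5 : M ≤ 2 * d := by
    have : 1 ≤ Real.exp (m * t₀) := Real.one_le_exp (mul_nonneg hm0 ht₀.1)
    nlinarith
  calc e t ≤ M * Real.exp (m * t) := heM t ht
    _ ≤ (2 * d) * Real.exp (m * T) := by
        gcongr
        exact ht.2
    _ = _ := by ring

/-- Banach's fixed point theorem in an exponentially weighted sup norm. -/
theorem IsVolterraKernel.exists_solution [CompleteSpace E] (h : IsVolterraKernel T k Ψ)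
    (hT : 0 ≤ T) (g : C(Set.Icc (0 : ℝ) T, E)) :
    ∃ x : C(Set.Icc (0 : ℝ) T, E), ∀ t : Set.Icc (0 : ℝ) T,
      x t = g t - volterraInt Ψ (Set.IccExtend hT x) t := by
  obtain ⟨m, hm0, hm⟩ := exists_exp_weight hT h.integrable h.nonneg
  have hext : ∀ y : C(Set.Icc (0 : ℝ) T, E),
      Continuous fun s => Real.exp (m * s) • Set.IccExtend hT y s := fun y =>
    (by fun_prop : Continuous fun s : ℝ => Real.exp (m * s)).smul (y.continuous.Icc_extend')
  -- Conjugating by e^{mt} moves the weight into the map, so the usual metric on continuous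
  -- functions serves.
  set A : C(Set.Icc (0 : ℝ) T, E) → C(Set.Icc (0 : ℝ) T, E) := fun y =>
    ⟨fun t => Real.exp (-(m * t)) • (g t -
      volterraInt Ψ (fun s => Real.exp (m * s) • Set.IccExtend hT y s) t),
      (by fun_prop : Continuous fun t : Set.Icc (0 : ℝ) T => Real.exp (-(m * t))).smul
        (g.continuous.sub (h.continuous_volterraInt hT (hext y)))⟩ with hA
  have hcontr : ContractingWith (1 / 2) A := by
    refine ⟨by rw [← NNReal.coe_lt_coe]; norm_num, LipschitzWith.of_dist_le_mul fun y z => ?_⟩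
    rw [ContinuousMap.dist_le (by positivity)]
    intro t
    rw [dist_eq_norm, dist_eq_norm]
    have e1 : A y t - A z t = Real.exp (-(m * t)) •
        (volterraInt Ψ (fun s => Real.exp (m * s) • Set.IccExtend hT z s) t -
          volterraInt Ψ (fun s => Real.exp (m * s) • Set.IccExtend hT y s) t) := by
      simp only [hA, ContinuousMap.coe_mk]
      rw [← smul_sub]
      congr 1
      abel
    rw [e1, norm_smul, Real.norm_of_nonneg (Real.exp_pos _).le]
    have h2 := (h.norm_volterraInt_sub_le t.2 (hext z) (hext y)).trans
      (integral_mul_exp_le h.integrable h.nonneg hm t.2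
        (f := fun s => ‖Real.exp (m * s) • Set.IccExtend hT z s -
          Real.exp (m * s) • Set.IccExtend hT y s‖) (((hext z).sub (hext y)).norm)
        (norm_nonneg (y - z)) (fun s _ => by
          rw [← smul_sub, norm_smul, Real.norm_of_nonneg (Real.exp_pos _).le, mul_comm,
            norm_sub_rev]
          gcongr
          exact (y - z).norm_coe_le_norm (Set.projIcc 0 T hT s)))
    calc _ ≤ Real.exp (-(m * t)) * (‖y - z‖ * Real.exp (m * t) / 2) := by gcongr
      _ = (Real.exp (-(m * t)) * Real.exp (m * t)) * (‖y - z‖ / 2) := by ring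
      _ = _ := by
          rw [← Real.exp_add]
          simp
          ring
  obtain ⟨y, hy, -⟩ := hcontr.exists_fixedPoint (0 : C(Set.Icc (0 : ℝ) T, E)) (edist_ne_top _ _)
  refine ⟨⟨fun t => Real.exp (m * t) • y t,
    (by fun_prop : Continuous fun t : Set.Icc (0 : ℝ) T => Real.exp (m * t)).smul y.continuous⟩,
    fun t => ?_⟩
  have h1 : y t = Real.exp (-(m * t)) • (g t -
      volterraInt Ψ (fun s => Real.exp (m * s) • Set.IccExtend hT y s) t) :=
    (congrArg (fun f : C(Set.Icc (0 : ℝ) T, E) => f t) hy).symm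
  have h2 : volterraInt Ψ (fun s => Real.exp (m * s) • Set.IccExtend hT y s) t = volterraInt Ψ
      (Set.IccExtend hT fun t : Set.Icc (0 : ℝ) T => Real.exp (m * t) • y t) t := by
    refine intervalIntegral.integral_congr fun r hr => ?_
    rw [Set.uIcc_of_le t.2.1] at hr
    have hmem : (t : ℝ) - r ∈ Set.Icc 0 T := ⟨by linarith [hr.2], by linarith [hr.1, t.2.2]⟩
    simp only [Set.IccExtend_of_mem hT _ hmem]
  change Real.exp (m * t) • y t = _
  rw [h1, smul_smul, ← Real.exp_add, add_neg_cancel, Real.exp_zero, one_smul, h2]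
  rfl

end Volterra

/-! ### Truncated Navier-Stokes equations in mild form -/

/-- The factor by which the radial retraction on the ball of radius `R` multiplies `x`. -/
def retractFactor {E : Type*} [NormedAddCommGroup E] (R : ℝ) (x : E) : ℝ := R / max R ‖x‖

section Retract

variable {E : Type*} [NormedAddCommGroup E]

theorem retractFactor_nonneg {R : ℝ} (hR : 0 < R) (x : E) : 0 ≤ retractFactor R x :=
  div_nonneg hR.le (hR.le.trans (le_max_left _ _))

theorem retractFactor_le_one {R : ℝ} (hR : 0 < R) (x : E) : retractFactor R x ≤ 1 :=
  div_le_one_of_le₀ (le_max_left _ _) (hR.le.trans (le_max_left _ _))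

theorem retractFactor_eq_one {R : ℝ} (hR : 0 < R) {x : E} (hx : ‖x‖ ≤ R) :
    retractFactor R x = 1 := by
  rw [retractFactor, max_eq_left hx, div_self hR.ne']

theorem continuous_retractFactor {R : ℝ} (hR : 0 < R) :
    Continuous fun x : E => retractFactor R x :=
  continuous_const.div (by fun_prop) fun _ => (hR.trans_le (le_max_left _ _)).ne'

variable [NormedSpace ℝ E]

/-- The radial retraction on the ball of radius `R`. -/
def retract (R : ℝ) (x : E) : E := retractFactor R x • x

theorem retract_eq_self {R : ℝ} (hR : 0 < R) {x : E} (hx : ‖x‖ ≤ R) : retract R x = x := by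
  rw [retract, retractFactor_eq_one hR hx, one_smul]

theorem norm_retract_le {R : ℝ} (hR : 0 < R) (x : E) : ‖retract R x‖ ≤ R := by
  have hm : 0 < max R ‖x‖ := hR.trans_le (le_max_left _ _)
  rw [retract, norm_smul, Real.norm_of_nonneg (retractFactor_nonneg hR x), retractFactor,
    div_mul_eq_mul_div, div_le_iff₀ hm]
  exact mul_le_mul_of_nonneg_left (le_max_right _ _) hR.le

theorem continuous_retract {R : ℝ} (hR : 0 < R) : Continuous fun x : E => retract R x :=
  (continuous_retractFactor hR).smul continuous_id

/-- Varying the vector and varying the scalar factor each cost at most ‖x - y‖; this works in any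
normed space. -/
theorem norm_retract_sub_le {R : ℝ} (hR : 0 < R) (x y : E) :
    ‖retract R x - retract R y‖ ≤ 2 * ‖x - y‖ := by
  set a := max R ‖x‖ with ha
  set b := max R ‖y‖ with hb
  have ha0 : 0 < a := hR.trans_le (le_max_left _ _)
  have hb0 : 0 < b := hR.trans_le (le_max_left _ _)
  have hab : |b - a| ≤ ‖x - y‖ := by
    rw [abs_sub_comm]
    refine (abs_max_sub_max_le_max R ‖x‖ R ‖y‖).trans ?_
    rw [sub_self, abs_zero, max_eq_right (abs_nonneg _)]
    exact abs_norm_sub_norm_le x y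
  have e : retract R x - retract R y = (R / a) • (x - y) + (R / a - R / b) • y := by
    simp only [retract, retractFactor, ← ha, ← hb, smul_sub, sub_smul]
    abel
  have hRa : R / a ≤ 1 := div_le_one_of_le₀ (le_max_left _ _) ha0.le
  have h1 : ‖(R / a - R / b) • y‖ ≤ ‖x - y‖ := by
    have e2 : R / a - R / b = (R / a) * ((b - a) / b) := by field_simp
    rw [norm_smul, e2, Real.norm_eq_abs, abs_mul, abs_of_nonneg (by positivity : 0 ≤ R / a),
      abs_div, abs_of_pos hb0]
    calc R / a * (|b - a| / b) * ‖y‖ ≤ 1 * (|b - a| / b) * b := by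
          gcongr
          exact le_max_right _ _
      _ = |b - a| := by field_simp
      _ ≤ _ := hab
  have h2 : ‖(R / a) • (x - y)‖ ≤ ‖x - y‖ := by
    rw [norm_smul, Real.norm_of_nonneg (by positivity)]
    exact mul_le_of_le_one_left (norm_nonneg _) hRa
  rw [e]
  exact (norm_add_le _ _).trans (by linarith)

end Retract

/-- The integrable bound of `e^{rA} B`. -/
def heatRate (σ r : ℝ) : ℝ := heatConst σ * |r| ^ (-heatExponent σ)

theorem heatRate_nonneg (σ r : ℝ) : 0 ≤ heatRate σ r :=
  mul_nonneg (heatConst_nonneg σ) (by positivity)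

theorem norm_heatBilin_le_heatRate (σ r : ℝ) (u v : HSob σ) :
    ‖heatBilin σ r u v‖ ≤ heatRate σ r * ‖u‖ * ‖v‖ := by
  rcases le_or_gt r 0 with hr | hr
  · rw [heatBilin_of_nonpos hr]
    have := heatRate_nonneg σ r
    simpa using by positivity
  · have := norm_heatBilin_le σ hr u v
    rwa [heatRate, abs_of_pos hr]

theorem intervalIntegrable_heatRate {σ : ℝ} (hσ : 0 < σ) (hσ1 : σ < 1) {T : ℝ} (hT : 0 ≤ T) :
    IntervalIntegrable (heatRate σ) volume 0 T := by
  have h1 : IntervalIntegrable (fun r : ℝ => heatConst σ * r ^ (-heatExponent σ)) volume 0 T :=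
    (intervalIntegral.intervalIntegrable_rpow' (by rw [heatExponent]; nlinarith)).const_mul _
  refine h1.congr ?_
  intro r hr
  rw [Set.uIoc_of_le hT] at hr
  simp only [heatRate, abs_of_pos hr.1]

/-- The kernel of the mild Navier-Stokes equation, with a time dependent factor `β`, truncated by
the operator `Q` and by the radial retraction on the ball of radius `R`. -/
def nsKernel {σ : ℝ} (Q : HSob σ →L[ℝ] HSob σ) (β : ℝ → ℝ) (R : ℝ) (r s : ℝ) (x : HSob σ) :
    HSob σ := β s • Q (heatBilin σ r (retract R x) (retract R x))

/-- The kernel of the mild Navier-Stokes equation. -/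
def mildKernel (σ : ℝ) (r _s : ℝ) (x : HSob σ) : HSob σ := heatBilin σ r x x

theorem norm_nsKernel_le {σ : ℝ} {Q : HSob σ →L[ℝ] HSob σ} (hQ : ‖Q‖ ≤ 1) {β : ℝ → ℝ}
    (hβ0 : ∀ s, 0 ≤ β s) (hβ1 : ∀ s, β s ≤ 1) {R : ℝ} (hR : 0 < R) (r s : ℝ) (x : HSob σ) :
    ‖nsKernel Q β R r s x‖ ≤ R ^ 2 * heatRate σ r := by
  have hx := norm_retract_le hR x
  have hk := heatRate_nonneg σ r
  rw [nsKernel, norm_smul, Real.norm_of_nonneg (hβ0 s)]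
  calc _ ≤ 1 * (1 * (heatRate σ r * R * R)) := by
        gcongr
        · exact hβ1 s
        · refine (Q.le_of_opNorm_le hQ _).trans ?_
          gcongr
          refine (norm_heatBilin_le_heatRate σ r _ _).trans ?_
          gcongr
    _ = _ := by ring

/-- On the ball of radius R, B(x',x') - B(y',y') = B(x'-y',x') + B(y',x'-y') costs 2R, and the
retraction costs another factor 2, hence the rate 4R. -/
theorem isVolterraKernel_nsKernel {σ : ℝ} (hσ : 0 < σ) (hσ1 : σ < 1) {T : ℝ} (hT : 0 ≤ T)
    {Q : HSob σ →L[ℝ] HSob σ} (hQ : ‖Q‖ ≤ 1) {β : ℝ → ℝ} (hβ : Continuous β)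
    (hβ0 : ∀ s, 0 ≤ β s) (hβ1 : ∀ s, β s ≤ 1) {R : ℝ} (hR : 0 < R) :
    IsVolterraKernel T (fun r => 4 * R * heatRate σ r) (nsKernel Q β R) where
  integrable := (intervalIntegrable_heatRate hσ hσ1 hT).const_mul _
  nonneg r := mul_nonneg (by positivity) (heatRate_nonneg σ r)
  continuous r := by
    have h1 := continuous_retract (E := HSob σ) hR
    unfold nsKernel
    fun_prop
  measurable x hx t := by
    have h1 : StronglyMeasurable fun r =>
        heatBilin σ r (retract R (x (t - r))) (retract R (x (t - r))) := by
      refine HSob.stronglyMeasurable_of_coeff fun k => ?_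
      have e : (fun r => (heatBilin σ r (retract R (x (t - r))) (retract R (x (t - r)))).coeff k) =
          fun r => if 0 < r then (Real.exp (-(modeNorm k ^ 2 * r)) : ℂ) *
            nonlin (retract R (x (t - r))).coeff (retract R (x (t - r))).coeff k else 0 := by
        funext r
        split_ifs with hr
        · exact heatBilin_coeff hσ hσ1 hr _ _ k
        · rw [heatBilin_of_nonpos (not_lt.1 hr)]; rfl
      rw [e]
      have h2 : Continuous fun r => retract R (x (t - r)) :=
        (continuous_retract hR).comp (by fun_prop)
      have h3 := (continuous_nonlin hσ hσ1 k).comp (h2.prodMk h2)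
      refine Measurable.ite measurableSet_Ioi (Continuous.measurable ?_) measurable_const
      exact (by fun_prop : Continuous fun r : ℝ =>
        (Real.exp (-(modeNorm k ^ 2 * r)) : ℂ)).mul h3
    exact ((hβ.comp (by fun_prop : Continuous fun r : ℝ => t - r)).stronglyMeasurable).smul
      (Q.continuous.comp_stronglyMeasurable h1)
  lipschitz r _ s x y := by
    have hx := norm_retract_le hR x
    have hy := norm_retract_le hR y
    have hk := heatRate_nonneg σ r
    set x' := retract R x with hx'
    set y' := retract R y with hy'
    have e : nsKernel Q β R r s x - nsKernel Q β R r s y =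
        β s • Q (heatBilin σ r (x' - y') x' + heatBilin σ r y' (x' - y')) := by
      simp only [nsKernel, ← hx', ← hy', map_sub, map_add, sub_apply,
        ← smul_sub]
      congr 1
      abel
    have hd := norm_retract_sub_le hR x y
    rw [e, norm_smul, Real.norm_of_nonneg (hβ0 s)]
    calc _ ≤ 1 * (1 * (heatRate σ r * (2 * ‖x - y‖) * R + heatRate σ r * R * (2 * ‖x - y‖))) := by
          gcongr
          · exact hβ1 s
          · refine (Q.le_of_opNorm_le hQ _).trans ?_
            gcongr
            refine (norm_add_le _ _).trans (add_le_add ?_ ?_)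
            · refine (norm_heatBilin_le_heatRate σ r _ _).trans ?_
              gcongr
            · refine (norm_heatBilin_le_heatRate σ r _ _).trans ?_
              gcongr
      _ = _ := by ring
  map_zero r s := by simp [nsKernel, retract]

/-- The bound is quadratic in R and independent of x: for small R the convolution is small compared
with R, so the truncation becomes inactive by itself. -/
theorem norm_volterraInt_nsKernel_le {σ : ℝ} (hσ : 0 < σ) (hσ1 : σ < 1) {T : ℝ}
    {Q : HSob σ →L[ℝ] HSob σ} (hQ : ‖Q‖ ≤ 1) {β : ℝ → ℝ}
    (hβ0 : ∀ s, 0 ≤ β s) (hβ1 : ∀ s, β s ≤ 1) {R : ℝ} (hR : 0 < R) {x : ℝ → HSob σ} {t : ℝ}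
    (ht : t ∈ Set.Icc 0 T) :
    ‖volterraInt (nsKernel Q β R) x t‖ ≤ R ^ 2 * ∫ r in (0 : ℝ)..T, heatRate σ r := by
  have hi := intervalIntegrable_heatRate hσ hσ1 (ht.1.trans ht.2)
  have h1 : ‖volterraInt (nsKernel Q β R) x t‖ ≤ ∫ r in (0 : ℝ)..t, R ^ 2 * heatRate σ r :=
    intervalIntegral.norm_integral_le_of_norm_le ht.1
      (Filter.Eventually.of_forall fun r _ => norm_nsKernel_le hQ hβ0 hβ1 hR _ _ _)
      ((intervalIntegrable_heatRate hσ hσ1 ht.1).const_mul _)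
  refine h1.trans ?_
  rw [intervalIntegral.integral_const_mul]
  gcongr
  exact intervalIntegral.integral_mono_interval le_rfl ht.1 ht.2
    (Filter.Eventually.of_forall fun r => heatRate_nonneg σ r) hi

/-- The constant depends on the rate k alone, not on Ψ. This uniformity is what allows comparison
with Galerkin systems of arbitrary size. -/
theorem exists_dist_le_of_isVolterraKernel {E : Type*} [NormedAddCommGroup E] [NormedSpace ℝ E]
    {T : ℝ} (hT : 0 ≤ T) {k : ℝ → ℝ} (hk : IntervalIntegrable k volume 0 T)
    (hk0 : ∀ r, 0 ≤ k r) : ∃ C : ℝ, 0 ≤ C ∧ ∀ Ψ : ℝ → ℝ → E → E, IsVolterraKernel T k Ψ →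
      ∀ (x y : C(Set.Icc (0 : ℝ) T, E)) (d : ℝ), 0 ≤ d →
      (∀ t : Set.Icc (0 : ℝ) T, ‖x t - y t‖ ≤ d + ‖volterraInt Ψ (Set.IccExtend hT x) t -
        volterraInt Ψ (Set.IccExtend hT y) t‖) → ∀ t, ‖x t - y t‖ ≤ C * d := by
  obtain ⟨C, hC, H⟩ := exists_gronwall hT hk hk0
  refine ⟨C, hC, fun Ψ h x y d hd hxy t => ?_⟩
  have hx : Continuous (Set.IccExtend hT x) := x.continuous.Icc_extend'
  have hy : Continuous (Set.IccExtend hT y) := y.continuous.Icc_extend'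
  have h1 := H (fun s => ‖Set.IccExtend hT x s - Set.IccExtend hT y s‖) d
    (hx.sub hy).norm hd (fun _ _ => norm_nonneg _) (fun s hs => by
      have h2 := hxy ⟨s, hs⟩
      rw [Set.IccExtend_of_mem hT _ hs, Set.IccExtend_of_mem hT _ hs]
      exact h2.trans (add_le_add_right (h.norm_volterraInt_sub_le hs hx hy) d)) t t.2
  simpa [Set.IccExtend_of_mem hT _ t.2] using h1

theorem IsVolterraKernel.exists_dist_le {E : Type*} [NormedAddCommGroup E] [NormedSpace ℝ E]
    {T : ℝ} {k : ℝ → ℝ} {Ψ : ℝ → ℝ → E → E} (h : IsVolterraKernel T k Ψ) (hT : 0 ≤ T) :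
    ∃ C : ℝ, 0 ≤ C ∧ ∀ (x y : C(Set.Icc (0 : ℝ) T, E)) (d : ℝ), 0 ≤ d →
      (∀ t : Set.Icc (0 : ℝ) T, ‖x t - y t‖ ≤ d + ‖volterraInt Ψ (Set.IccExtend hT x) t -
        volterraInt Ψ (Set.IccExtend hT y) t‖) → ∀ t, ‖x t - y t‖ ≤ C * d := by
  obtain ⟨C, hC, H⟩ := exists_dist_le_of_isVolterraKernel hT h.integrable h.nonneg (E := E)
  exact ⟨C, hC, H Ψ h⟩

theorem volterraInt_congr {E : Type*} [NormedAddCommGroup E] [NormedSpace ℝ E] {T : ℝ}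
    {Ψ Φ : ℝ → ℝ → E → E} {x : ℝ → E} (h : ∀ s ∈ Set.Icc 0 T, ∀ r, Ψ r s (x s) = Φ r s (x s))
    {t : ℝ} (ht : t ∈ Set.Icc 0 T) : volterraInt Ψ x t = volterraInt Φ x t := by
  refine intervalIntegral.integral_congr fun r hr => ?_
  rw [Set.uIcc_of_le ht.1] at hr
  exact h _ ⟨by linarith [hr.2], by linarith [hr.1, ht.2]⟩ r

/-- `x` solves the mild Navier-Stokes equation driven by `g`. -/
def IsMild {T : ℝ} (hT : 0 ≤ T) {σ : ℝ} (g x : C(Set.Icc (0 : ℝ) T, HSob σ)) : Prop :=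
  ∀ t : Set.Icc (0 : ℝ) T, x t = g t - volterraInt (mildKernel σ) (Set.IccExtend hT x) t

theorem volterraInt_mildKernel_eq {T : ℝ} (hT : 0 ≤ T) {σ : ℝ} {x : C(Set.Icc (0 : ℝ) T, HSob σ)}
    {R : ℝ} (hR : 0 < R) (hx : ∀ t, ‖x t‖ ≤ R) {t : ℝ} (ht : t ∈ Set.Icc 0 T) :
    volterraInt (mildKernel σ) (Set.IccExtend hT x) t =
      volterraInt (nsKernel (ContinuousLinearMap.id ℝ _) (fun _ => 1) R) (Set.IccExtend hT x) t := by
  refine volterraInt_congr (fun s hs r => ?_) ht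
  rw [nsKernel, mildKernel, retract_eq_self hR, one_smul, ContinuousLinearMap.id_apply]
  rw [Set.IccExtend_of_mem hT _ hs]
  exact hx _

/-- With R above both norms the truncation does nothing to either path, and Gronwall with zero data
applies. -/
theorem eq_of_sub_eq_volterraInt {T : ℝ} (hT : 0 ≤ T) {σ : ℝ} (hσ : 0 < σ) (hσ1 : σ < 1)
    {x y : C(Set.Icc (0 : ℝ) T, HSob σ)}
    (hxy : ∀ t : Set.Icc (0 : ℝ) T, x t - y t = volterraInt (mildKernel σ) (Set.IccExtend hT y) t -
      volterraInt (mildKernel σ) (Set.IccExtend hT x) t) : x = y := by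
  set R := ‖x‖ + ‖y‖ + 1 with hRdef
  have hR : 0 < R := by positivity
  obtain ⟨C, -, H⟩ := (isVolterraKernel_nsKernel hσ hσ1 hT ContinuousLinearMap.norm_id_le
    (β := fun _ => 1) continuous_const (fun _ => zero_le_one) (fun _ => le_rfl) hR).exists_dist_le hT
  ext1 t
  have h1 := H x y 0 le_rfl (fun t => by
    rw [hxy t, zero_add,
      volterraInt_mildKernel_eq hT hR (fun s => (x.norm_coe_le_norm s).trans ?_) t.2,
      volterraInt_mildKernel_eq hT hR (fun s => (y.norm_coe_le_norm s).trans ?_) t.2, norm_sub_rev]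
    · linarith [norm_nonneg x]
    · linarith [norm_nonneg y]) t
  rw [mul_zero] at h1
  exact sub_eq_zero.1 (norm_le_zero_iff.1 h1)

/-! ### Energy estimates for finitely many modes -/

/-- Split at M = ε^{-1/(2-p)}, above which y^{p-2} ≤ ε. -/
theorem exists_rpow_le {p : ℝ} (hp : 0 ≤ p) (hp2 : p < 2) {ε : ℝ} (hε : 0 < ε) :
    ∃ C : ℝ, 0 ≤ C ∧ ∀ y : ℝ, 0 < y → y ^ p ≤ ε * y ^ 2 + C := by
  have h2p : 0 < 2 - p := by linarith
  set M := ε ^ (-(1 / (2 - p))) with hM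
  have hMp : 0 < M := by positivity
  refine ⟨M ^ p, by positivity, fun y hy => ?_⟩
  rcases le_total y M with h | h
  · have : y ^ p ≤ M ^ p := by gcongr
    have : 0 ≤ ε * y ^ 2 := by positivity
    linarith
  · have h1 : y ^ p = y ^ (p - 2) * y ^ 2 := by
      rw [← Real.rpow_natCast y 2, ← Real.rpow_add hy]
      congr 1
      push_cast; ring
    have h2 : y ^ (p - 2) ≤ ε := by
      calc y ^ (p - 2) ≤ M ^ (p - 2) := Real.rpow_le_rpow_of_nonpos hMp h (by linarith)
        _ = ε := by
            rw [hM, ← Real.rpow_mul hε.le]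
            have : -(1 / (2 - p)) * (p - 2) = 1 := by field_simp; ring
            rw [this, Real.rpow_one]
    have h3 : 0 ≤ M ^ p := by positivity
    rw [h1]
    have : y ^ (p - 2) * y ^ 2 ≤ ε * y ^ 2 := by gcongr
    linarith

/-- All the modes of `u` lie in `boxModes N`. -/
def HSob.SuppIn {σ : ℝ} (N : ℕ) (u : HSob σ) : Prop := ∀ k, k ∉ boxModes N → u.coeff k = 0

theorem HSob.SuppIn.add {σ : ℝ} {N : ℕ} {u v : HSob σ} (hu : u.SuppIn N) (hv : v.SuppIn N) :
    (u + v).SuppIn N := fun k hk => by rw [HSob.coeff_add, hu k hk, hv k hk, add_zero]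

theorem HSob.suppIn_proj {σ : ℝ} (N : ℕ) (u : HSob σ) : (proj σ N u).SuppIn N :=
  fun k hk => by rw [proj_coeff, if_neg hk]

/-- The square of the Sobolev norm of order `s`, as a real number. -/
def sobR {σ : ℝ} (s : ℝ) (u : HSob σ) : ℝ := (sobSq s (emod u.coeff)).toReal

theorem sobR_nonneg {σ : ℝ} (s : ℝ) (u : HSob σ) : 0 ≤ sobR s u := ENNReal.toReal_nonneg

theorem HSob.SuppIn.sobR_eq {σ : ℝ} {N : ℕ} {u : HSob σ} (hu : u.SuppIn N) (s : ℝ) :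
    sobR s u = ∑ k ∈ boxModes N, modeNorm k ^ (2 * s) * ‖u.coeff k‖ ^ 2 := by
  rw [sobR, sobSq, tsum_eq_sum (s := boxModes N), ENNReal.toReal_sum]
  · refine Finset.sum_congr rfl fun k _ => ?_
    rw [ENNReal.toReal_mul, ENNReal.toReal_ofReal (Real.rpow_nonneg (modeNorm_nonneg k) _),
      ENNReal.toReal_pow, emod, toReal_enorm]
  · exact fun k _ => ENNReal.mul_ne_top ENNReal.ofReal_ne_top (by simp [emod])
  · intro k hk
    simp [emod, hu k hk]

theorem HSob.SuppIn.sobSq_eq {σ : ℝ} {N : ℕ} {u : HSob σ} (hu : u.SuppIn N) (s : ℝ) :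
    sobSq s (emod u.coeff) = ENNReal.ofReal (sobR s u) :=
  (ENNReal.ofReal_toReal (sobSq_lt_top_of_support (boxModes N) hu).ne).symm

theorem sobR_self {σ : ℝ} (u : HSob σ) : sobR σ u = ‖u‖ ^ 2 := by
  rw [sobR, ← HSob.enorm_sq, ENNReal.toReal_pow, toReal_enorm]

theorem HSob.SuppIn.sobR_mono {σ : ℝ} {N : ℕ} {u : HSob σ} (hu : u.SuppIn N) {s t : ℝ}
    (hst : s ≤ t) : sobR s u ≤ sobR t u := by
  refine ENNReal.toReal_mono (sobSq_lt_top_of_support (boxModes N) hu).ne ?_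
  exact sobSq_mono_exponent hst (by simp [emod, u.coeff_zero_mode])

theorem HSob.SuppIn.sobR_add_le {σ : ℝ} {N : ℕ} {u v : HSob σ} (hu : u.SuppIn N)
    (hv : v.SuppIn N) (s : ℝ) : sobR s (u + v) ≤ 2 * sobR s u + 2 * sobR s v := by
  rw [(hu.add hv).sobR_eq, hu.sobR_eq, hv.sobR_eq, Finset.mul_sum, Finset.mul_sum,
    ← Finset.sum_add_distrib]
  refine Finset.sum_le_sum fun k _ => ?_
  have hw := Real.rpow_nonneg (modeNorm_nonneg k) (2 * s)
  have h1 : ‖u.coeff k + v.coeff k‖ ^ 2 ≤ 2 * ‖u.coeff k‖ ^ 2 + 2 * ‖v.coeff k‖ ^ 2 := by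
    have := norm_add_le (u.coeff k) (v.coeff k)
    nlinarith [norm_nonneg (u.coeff k + v.coeff k), sq_nonneg (‖u.coeff k‖ - ‖v.coeff k‖)]
  rw [HSob.coeff_add]
  nlinarith

/-- Young's inequality in each mode. The constant sees only q and ε, so norms just below the
dissipation can be absorbed uniformly in N. -/
theorem exists_sobR_interp {q : ℝ} (hq : 0 ≤ q) (hq1 : q < 1) {ε : ℝ} (hε : 0 < ε) :
    ∃ C : ℝ, 0 ≤ C ∧ ∀ {σ : ℝ} {N : ℕ} {u : HSob σ} (_ : u.SuppIn N) (s : ℝ),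
      sobR (s + q) u ≤ ε * sobR (s + 1) u + C * sobR s u := by
  obtain ⟨C, hC, H⟩ := exists_rpow_le (p := 2 * q) (by linarith) (by linarith) hε
  refine ⟨C, hC, fun {σ N u} hu s => ?_⟩
  rw [hu.sobR_eq, hu.sobR_eq, hu.sobR_eq, Finset.mul_sum, Finset.mul_sum,
    ← Finset.sum_add_distrib]
  refine Finset.sum_le_sum fun k _ => ?_
  by_cases hk : k = 0
  · simp [hk, u.coeff_zero_mode]
  have hkp := modeNorm_pos hk
  have e1 : modeNorm k ^ (2 * (s + q)) = modeNorm k ^ (2 * s) * modeNorm k ^ (2 * q) := by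
    rw [← Real.rpow_add hkp]; congr 1; ring
  have e2 : modeNorm k ^ (2 * (s + 1)) = modeNorm k ^ (2 * s) * modeNorm k ^ 2 := by
    rw [← Real.rpow_natCast, ← Real.rpow_add hkp]; congr 1; push_cast; ring
  rw [e1, e2]
  have h1 := H _ hkp
  have hw : 0 ≤ modeNorm k ^ (2 * s) * ‖u.coeff k‖ ^ 2 := by positivity
  nlinarith [mul_le_mul_of_nonneg_left h1 hw]

theorem HSob.SuppIn.sobR_mid_sq_le {σ : ℝ} {N : ℕ} {u : HSob σ} (hu : u.SuppIn N) (s t : ℝ) :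
    sobR ((s + t) / 2) u ^ 2 ≤ sobR s u * sobR t u := by
  rw [hu.sobR_eq, hu.sobR_eq, hu.sobR_eq]
  have h1 := Finset.sum_mul_sq_le_sq_mul_sq (boxModes N)
    (fun k => modeNorm k ^ s * ‖u.coeff k‖) (fun k => modeNorm k ^ t * ‖u.coeff k‖)
  have e : ∀ (s : ℝ) (k : ℤ × ℤ), (modeNorm k ^ s * ‖u.coeff k‖) ^ 2 =
      modeNorm k ^ (2 * s) * ‖u.coeff k‖ ^ 2 := by
    intro s k
    rw [mul_pow, mul_comm 2 s, Real.rpow_mul (modeNorm_nonneg k), Real.rpow_two]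
  simp only [e] at h1
  refine le_trans (le_of_eq ?_) h1
  congr 1
  refine Finset.sum_congr rfl fun k _ => ?_
  by_cases hk : k = 0
  · simp [hk, u.coeff_zero_mode]
  rw [show 2 * ((s + t) / 2) = s + t by ring, Real.rpow_add (modeNorm_pos hk)]
  ring

/-! ### The trilinear form -/

/-- `⟨B(p, q), r⟩`. -/
def triForm (p q r : ℤ × ℤ → ℂ) : ℂ := bracket (nonlin p q) r

theorem triForm_eq_sum {σ : ℝ} (p q : ℤ × ℤ → ℂ) {N : ℕ} {r : HSob σ} (hr : r.SuppIn N) :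
    triForm p q r.coeff = ∑ k ∈ boxModes N, nonlin p q k * conj (r.coeff k) := by
  rw [triForm, bracket, tsum_eq_sum (s := boxModes N)]
  intro k hk
  rw [hr k hk, map_zero, mul_zero]

/-- For fixed h, substitute k ↦ h - k and use `gammaCoeff_sub` with the reality condition. Finite
supports justify the rearrangement. -/
theorem triForm_antisymm {σ : ℝ} {N : ℕ} {p q r : HSob σ} (hp : p.SuppIn N) (hq : q.SuppIn N)
    (hr : r.SuppIn N) :
    triForm p.coeff q.coeff r.coeff = -triForm p.coeff r.coeff q.coeff := by
  have key : ∀ {q r : HSob σ}, r.SuppIn N → triForm p.coeff q.coeff r.coeff =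
      ∑ h ∈ boxModes N, ∑' k, Complex.I * (gammaCoeff h k * p.coeff h * q.coeff (k - h)) *
        conj (r.coeff k) := by
    intro q r hr
    rw [triForm_eq_sum _ _ hr]
    have e1 : ∀ k, nonlin p.coeff q.coeff k * conj (r.coeff k) = ∑ h ∈ boxModes N,
        Complex.I * (gammaCoeff h k * p.coeff h * q.coeff (k - h)) * conj (r.coeff k) := by
      intro k
      rw [nonlin_eq, tsum_eq_sum (s := boxModes N), Finset.mul_sum, Finset.sum_mul]
      intro h hh
      rw [hp h hh]
      ring
    simp only [e1]
    rw [Finset.sum_comm]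
    refine Finset.sum_congr rfl fun h _ => ?_
    rw [tsum_eq_sum (s := boxModes N)]
    intro k hk
    rw [hr k hk, map_zero, mul_zero]
  rw [key hr, key hq, ← Finset.sum_neg_distrib]
  refine Finset.sum_congr rfl fun h _ => ?_
  rw [← tsum_neg, ← (Equiv.subLeft h).tsum_eq]
  refine tsum_congr fun k => ?_
  have e1 : h - k - h = -k := by abel
  have e2 : h - k = -(k - h) := by abel
  rw [Equiv.subLeft_apply, gammaCoeff_sub, e1, q.coeff_neg_mode, e2, r.coeff_neg_mode, map_neg,
    Complex.conj_conj]
  push_cast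
  ring

theorem triForm_self {σ : ℝ} {N : ℕ} {p q : HSob σ} (hp : p.SuppIn N) (hq : q.SuppIn N) :
    triForm p.coeff q.coeff q.coeff = 0 := by
  have := triForm_antisymm hp hq hq
  exact self_eq_neg.1 this

theorem triForm_add_left {σ : ℝ} (hσ : 0 ≤ σ) {N : ℕ} (p p' q : HSob σ) {r : HSob σ}
    (hr : r.SuppIn N) : triForm (p + p').coeff q.coeff r.coeff =
      triForm p.coeff q.coeff r.coeff + triForm p'.coeff q.coeff r.coeff := by
  simp only [triForm_eq_sum _ _ hr, nonlin_add_left hσ, add_mul, Finset.sum_add_distrib]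

theorem triForm_add_mid {σ : ℝ} (hσ : 0 ≤ σ) {N : ℕ} (p q q' : HSob σ) {r : HSob σ}
    (hr : r.SuppIn N) : triForm p.coeff (q + q').coeff r.coeff =
      triForm p.coeff q.coeff r.coeff + triForm p.coeff q'.coeff r.coeff := by
  simp only [triForm_eq_sum _ _ hr, nonlin_add_right hσ, add_mul, Finset.sum_add_distrib]

theorem enorm_ofReal_gammaCoeff_le' (h k : ℤ × ℤ) :
    ‖(gammaCoeff h k : ℂ)‖ₑ ≤ ENNReal.ofReal (modeNorm (k - h)) := by
  rw [← ofReal_norm, Complex.norm_real]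
  exact ENNReal.ofReal_le_ofReal (abs_gammaCoeff_le' h k)

theorem tsum_conv_eq (F : ℤ × ℤ → ℤ × ℤ → ℤ × ℤ → ℝ≥0∞) :
    ∑' k, ∑' h, F h (k - h) k = ∑' h, ∑' l, F h l (h + l) := by
  rw [ENNReal.tsum_comm]
  refine tsum_congr fun h => ?_
  have := (Equiv.addLeft h).tsum_eq (fun k => F h (k - h) k)
  rw [← this]
  simp

theorem sobSq_weight (s t : ℝ) {f : ℤ × ℤ → ℝ≥0∞} (hf : f 0 = 0) :
    sobSq s (fun k => ENNReal.ofReal (modeNorm k ^ t) * f k) = sobSq (s + t) f := by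
  refine tsum_congr fun k => ?_
  by_cases hk : k = 0
  · simp [hk, hf]
  rw [sq_ofReal_rpow_mul, ← mul_assoc, ofReal_rpow_add hk, mul_add]

/-- Here the derivative is charged to q, by `abs_gammaCoeff_le'`, so that r needs no extra
regularity. -/
theorem exists_triForm_le {a b c : ℝ} (habc : Admissible a b c) : ∃ C : ℝ, 0 ≤ C ∧
    ∀ {σ : ℝ} {N : ℕ} {p q r : HSob σ}, p.SuppIn N → q.SuppIn N → r.SuppIn N →
      ‖triForm p.coeff q.coeff r.coeff‖ ^ 2 ≤ C * (sobR a p * sobR (b + 1) q * sobR c r) := by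
  obtain ⟨C, hC, H⟩ := exists_trilinear_le habc
  refine ⟨C.toReal, ENNReal.toReal_nonneg, fun {σ N p q r} hp hq hr => ?_⟩
  have hq0 : emod q.coeff 0 = 0 := by simp [emod, q.coeff_zero_mode]
  have h1 : ‖triForm p.coeff q.coeff r.coeff‖ₑ ≤ ∑' h, ∑' l, emod p.coeff h *
      (ENNReal.ofReal (modeNorm l ^ (1 : ℝ)) * emod q.coeff l) * emod r.coeff (h + l) := by
    rw [← tsum_conv_eq (fun h l k => emod p.coeff h *
      (ENNReal.ofReal (modeNorm l ^ (1 : ℝ)) * emod q.coeff l) * emod r.coeff k)]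
    refine enorm_tsum_le_tsum_enorm.trans (ENNReal.tsum_le_tsum fun k => ?_)
    rw [enorm_mul, ENNReal.tsum_mul_right]
    have e : ‖conj (r.coeff k)‖ₑ = emod r.coeff k := by
      rw [emod, ← ofReal_norm, ← ofReal_norm, RCLike.norm_conj]
    rw [e]
    gcongr
    rw [nonlin_eq, enorm_mul]
    have hI : ‖Complex.I‖ₑ = 1 := by rw [← ofReal_norm]; simp
    rw [hI, one_mul]
    refine enorm_tsum_le_tsum_enorm.trans (ENNReal.tsum_le_tsum fun h => ?_)
    rw [enorm_mul, enorm_mul, Real.rpow_one]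
    calc _ ≤ ENNReal.ofReal (modeNorm (k - h)) * ‖p.coeff h‖ₑ * ‖q.coeff (k - h)‖ₑ := by
          gcongr
          exact enorm_ofReal_gammaCoeff_le' h k
      _ = _ := by simp only [emod]; ring
  have h2 := (pow_le_pow_left₀ zero_le h1 2).trans (H (emod p.coeff)
    (fun l => ENNReal.ofReal (modeNorm l ^ (1 : ℝ)) * emod q.coeff l) (emod r.coeff)
    (by simp [emod, p.coeff_zero_mode]) (by simp [hq0]) (by simp [emod, r.coeff_zero_mode]))
  rw [sobSq_weight b 1 hq0] at h2
  have h3 := ENNReal.toReal_mono (by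
    rw [hp.sobSq_eq, hq.sobSq_eq, hr.sobSq_eq]; finiteness) h2
  simpa only [ENNReal.toReal_mul, ENNReal.toReal_pow, toReal_enorm, sobR] using h3

/-- The weighted sum `∑ |k|^{2σ} |B_k(p, q)| |r_k|`. -/
def weightedForm (s : ℝ) (p q r : ℤ × ℤ → ℂ) : ℝ≥0∞ :=
  ∑' k, ENNReal.ofReal (modeNorm k ^ (2 * s)) * (‖nonlin p q k‖ₑ * emod r k)

/-- A fractional Leibniz rule: |k|^s ≤ |h|^s + |k-h|^s for 0 ≤ s ≤ 1. Of the 2s + 1 derivatives, s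
fall on one of the inputs and 1 + s on r, where the dissipation can absorb them. -/
theorem weightedForm_le {s : ℝ} (hs : 0 ≤ s) (hs1 : s ≤ 1) (p q r : ℤ × ℤ → ℂ) (hr : r 0 = 0) :
    weightedForm s p q r ≤
      (∑' h, ∑' l, (ENNReal.ofReal (modeNorm h ^ s) * emod p h) * emod q l *
        (ENNReal.ofReal (modeNorm (h + l) ^ (1 + s)) * emod r (h + l))) +
      ∑' h, ∑' l, emod p h * (ENNReal.ofReal (modeNorm l ^ s) * emod q l) *
        (ENNReal.ofReal (modeNorm (h + l) ^ (1 + s)) * emod r (h + l)) := by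
  rw [← tsum_conv_eq (fun h l k => (ENNReal.ofReal (modeNorm h ^ s) * emod p h) * emod q l *
        (ENNReal.ofReal (modeNorm k ^ (1 + s)) * emod r k)),
    ← tsum_conv_eq (fun h l k => emod p h * (ENNReal.ofReal (modeNorm l ^ s) * emod q l) *
        (ENNReal.ofReal (modeNorm k ^ (1 + s)) * emod r k)), ← ENNReal.tsum_add]
  refine ENNReal.tsum_le_tsum fun k => ?_
  by_cases hk : k = 0
  · simp [hk, emod, hr]
  rw [← ENNReal.tsum_add]
  have hkp := modeNorm_pos hk
  have hsub : ∀ h, ENNReal.ofReal (modeNorm k ^ s) ≤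
      ENNReal.ofReal (modeNorm h ^ s) + ENNReal.ofReal (modeNorm (k - h) ^ s) := by
    intro h
    have h0 := Real.rpow_nonneg (modeNorm_nonneg h) s
    have h0' := Real.rpow_nonneg (modeNorm_nonneg (k - h)) s
    rw [← ENNReal.ofReal_add h0 h0']
    apply ENNReal.ofReal_le_ofReal
    have h1 := modeNorm_add_le h (k - h)
    rw [add_sub_cancel] at h1
    exact (Real.rpow_le_rpow hkp.le h1 hs).trans
      (Real.rpow_add_le_add_rpow (modeNorm_nonneg _) (modeNorm_nonneg _) hs hs1)
  have e : ENNReal.ofReal (modeNorm k ^ (2 * s)) * ENNReal.ofReal (modeNorm k) =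
      ENNReal.ofReal (modeNorm k ^ (1 + s)) * ENNReal.ofReal (modeNorm k ^ s) := by
    nth_rw 2 [← Real.rpow_one (modeNorm k)]
    rw [ofReal_rpow_add hk, ofReal_rpow_add hk]
    congr 2; ring
  calc _ ≤ ENNReal.ofReal (modeNorm k ^ (2 * s)) * ((ENNReal.ofReal (modeNorm k) *
        ∑' h, emod p h * emod q (k - h)) * emod r k) := by
        gcongr
        exact enorm_nonlin_le p q k
    _ = (ENNReal.ofReal (modeNorm k ^ (2 * s)) * ENNReal.ofReal (modeNorm k)) *
        (emod r k * ∑' h, emod p h * emod q (k - h)) := by ring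
    _ = ∑' h, ENNReal.ofReal (modeNorm k ^ s) * (ENNReal.ofReal (modeNorm k ^ (1 + s)) *
        emod r k * (emod p h * emod q (k - h))) := by
        rw [e, ENNReal.tsum_mul_left, ENNReal.tsum_mul_left]; ring
    _ ≤ ∑' h, (ENNReal.ofReal (modeNorm h ^ s) + ENNReal.ofReal (modeNorm (k - h) ^ s)) *
        (ENNReal.ofReal (modeNorm k ^ (1 + s)) * emod r k * (emod p h * emod q (k - h))) := by
        gcongr with h
        exact hsub h
    _ = _ := tsum_congr fun h => by ring

theorem exists_weightedForm_le {s a b a' b' : ℝ} (hs : 0 ≤ s) (hs1 : s ≤ 1)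
    (hab : Admissible a b 0) (hab' : Admissible a' b' 0) : ∃ C : ℝ, 0 ≤ C ∧
    ∀ {σ : ℝ} {N : ℕ} {p q r : HSob σ}, p.SuppIn N → q.SuppIn N → r.SuppIn N →
      weightedForm s p.coeff q.coeff r.coeff < ∞ ∧
      (weightedForm s p.coeff q.coeff r.coeff).toReal ^ 2 ≤
        C * sobR (1 + s) r * (sobR (a + s) p * sobR b q + sobR a' p * sobR (b' + s) q) := by
  obtain ⟨C, hC, H⟩ := exists_trilinear_le hab
  obtain ⟨C', hC', H'⟩ := exists_trilinear_le hab'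
  refine ⟨2 * (C.toReal + C'.toReal), by positivity, fun {σ N p q r} hp hq hr => ?_⟩
  have hp0 : emod p.coeff 0 = 0 := by simp [emod, p.coeff_zero_mode]
  have hq0 : emod q.coeff 0 = 0 := by simp [emod, q.coeff_zero_mode]
  have hr0 : emod r.coeff 0 = 0 := by simp [emod, r.coeff_zero_mode]
  have h1 := weightedForm_le hs hs1 p.coeff q.coeff r.coeff r.coeff_zero_mode
  have h2 := H (fun h => ENNReal.ofReal (modeNorm h ^ s) * emod p.coeff h) (emod q.coeff)
    (fun k => ENNReal.ofReal (modeNorm k ^ (1 + s)) * emod r.coeff k) (by simp [hp0]) hq0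
    (by simp [hr0])
  have h3 := H' (emod p.coeff) (fun l => ENNReal.ofReal (modeNorm l ^ s) * emod q.coeff l)
    (fun k => ENNReal.ofReal (modeNorm k ^ (1 + s)) * emod r.coeff k) hp0 (by simp [hq0])
    (by simp [hr0])
  rw [sobSq_weight a s hp0, sobSq_weight 0 (1 + s) hr0, zero_add] at h2
  rw [sobSq_weight b' s hq0, sobSq_weight 0 (1 + s) hr0, zero_add] at h3
  set A := ∑' h, ∑' l, (ENNReal.ofReal (modeNorm h ^ s) * emod p.coeff h) * emod q.coeff l *
        (ENNReal.ofReal (modeNorm (h + l) ^ (1 + s)) * emod r.coeff (h + l))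
  set B := ∑' h, ∑' l, emod p.coeff h * (ENNReal.ofReal (modeNorm l ^ s) * emod q.coeff l) *
        (ENNReal.ofReal (modeNorm (h + l) ^ (1 + s)) * emod r.coeff (h + l))
  rw [hp.sobSq_eq, hq.sobSq_eq, hr.sobSq_eq] at h2 h3
  have hA : A < ∞ := by
    have : A ^ 2 < ∞ := h2.trans_lt (by finiteness)
    exact (ENNReal.pow_lt_top_iff.1 this).resolve_right two_ne_zero
  have hB : B < ∞ := by
    have : B ^ 2 < ∞ := h3.trans_lt (by finiteness)
    exact (ENNReal.pow_lt_top_iff.1 this).resolve_right two_ne_zero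
  refine ⟨h1.trans_lt (ENNReal.add_lt_top.2 ⟨hA, hB⟩), ?_⟩
  have h4 := ENNReal.toReal_mono (ENNReal.add_lt_top.2 ⟨hA, hB⟩).ne h1
  rw [ENNReal.toReal_add hA.ne hB.ne] at h4
  have h5 := ENNReal.toReal_mono (by finiteness) h2
  have h6 := ENNReal.toReal_mono (by finiteness) h3
  simp only [ENNReal.toReal_mul, ENNReal.toReal_pow, ENNReal.toReal_ofReal (sobR_nonneg _ _)]
    at h5 h6
  set W := (weightedForm s p.coeff q.coeff r.coeff).toReal
  have hW : 0 ≤ W := ENNReal.toReal_nonneg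
  have n1 := sobR_nonneg (a + s) p
  have n2 := sobR_nonneg b q
  have n3 := sobR_nonneg a' p
  have n4 := sobR_nonneg (b' + s) q
  have n5 := sobR_nonneg (1 + s) r
  have m1 : 0 ≤ C.toReal * (sobR a' p * sobR (b' + s) q * sobR (1 + s) r) := by positivity
  have m2 : 0 ≤ C'.toReal * (sobR (a + s) p * sobR b q * sobR (1 + s) r) := by positivity
  calc W ^ 2 ≤ (A.toReal + B.toReal) ^ 2 := by gcongr
    _ ≤ 2 * A.toReal ^ 2 + 2 * B.toReal ^ 2 := by nlinarith [sq_nonneg (A.toReal - B.toReal)]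
    _ ≤ 2 * (C.toReal * (sobR (a + s) p * sobR b q * sobR (1 + s) r)) +
        2 * (C'.toReal * (sobR a' p * sobR (b' + s) q * sobR (1 + s) r)) := by gcongr
    _ ≤ _ := by linarith

/-! ### A priori bounds -/

theorem le_half_add_of_sq_le {X P Q : ℝ} (hP : 0 ≤ P) (hQ : 0 ≤ Q) (h : X ^ 2 ≤ P * Q) :
    X ≤ (P + Q) / 2 :=
  (abs_le.1 (abs_le_of_sq_le_sq (h.trans (by nlinarith [sq_nonneg (P - Q)] :
    P * Q ≤ ((P + Q) / 2) ^ 2)) (by positivity))).2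

/-- Terms with u in the last two slots vanish. Antisymmetry moves the derivative off the rough x
onto u, which costs ‖u‖₁ times norms of order below 1; in the terms that keep it on ζ, the bound for
ζ in ℋ³ pays. -/
theorem exists_energy_le {σ : ℝ} (hσ : 0 < σ) (hσ1 : σ < 1) {B : ℝ} (hB : 0 ≤ B) :
    ∃ C : ℝ, 0 ≤ C ∧ ∀ {N : ℕ} {u ζ x : HSob σ}, u.SuppIn N → ζ.SuppIn N → x.SuppIn N →
      sobR σ x ≤ B → sobR 3 ζ ≤ B →
      ‖triForm (u + ζ).coeff (u + ζ).coeff u.coeff + triForm (u + ζ).coeff x.coeff u.coeff +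
        triForm x.coeff (u + ζ).coeff u.coeff‖ ≤ sobR 1 u / 2 + C * (1 + sobR 0 u) := by
  obtain ⟨C₁, hC₁, H₁⟩ := exists_triForm_le (a := 0) (b := 2) (c := 0)
    ⟨le_rfl, by norm_num, le_rfl, Or.inl (by norm_num)⟩
  -- The σ derivatives of x let the first u stay at order 1 - σ/2, strictly below the dissipation.
  obtain ⟨C₂, hC₂, H₂⟩ := exists_triForm_le (a := 1 - σ / 2) (b := 0) (c := σ)
    ⟨by linarith, le_rfl, hσ.le, Or.inl (by linarith)⟩
  obtain ⟨C₃, hC₃, H₃⟩ := exists_triForm_le (a := 2) (b := 0) (c := 0)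
    ⟨by norm_num, le_rfl, le_rfl, Or.inl (by norm_num)⟩
  have hε : 0 < 1 / (16 * (C₂ * B + 1)) := by positivity
  obtain ⟨C₄, hC₄, H₄⟩ := exists_sobR_interp (q := 1 - σ / 2) (by linarith) (by linarith) hε
  refine ⟨C₁ * B + C₁ * B * B + 1 / 2 + (C₁ * B ^ 2 + 1) + 2 * C₂ * B * C₄ + 2 * C₃ * B ^ 2,
    by positivity, fun {N u ζ x} hu hζ hx hxB hζB => ?_⟩
  have hw := hu.add hζ
  have e : triForm (u + ζ).coeff (u + ζ).coeff u.coeff + triForm (u + ζ).coeff x.coeff u.coeff +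
      triForm x.coeff (u + ζ).coeff u.coeff =
      triForm (u + ζ).coeff ζ.coeff u.coeff + triForm x.coeff ζ.coeff u.coeff -
        triForm u.coeff u.coeff x.coeff - triForm ζ.coeff u.coeff x.coeff := by
    rw [triForm_add_mid hσ.le (u + ζ) u ζ hu, triForm_self hw hu, zero_add,
      triForm_add_mid hσ.le x u ζ hu, triForm_self hx hu, zero_add,
      triForm_antisymm hw hx hu, triForm_add_left hσ.le u ζ u hx]
    ring
  have a0 := sobR_nonneg 0 u
  have a1 := sobR_nonneg 1 u
  have z3 := sobR_nonneg 3 ζ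
  have x0 : sobR 0 x ≤ B := (hx.sobR_mono hσ.le).trans hxB
  have z0 : sobR 0 ζ ≤ B := (hζ.sobR_mono (by norm_num)).trans hζB
  have z2 : sobR 2 ζ ≤ B := (hζ.sobR_mono (by norm_num)).trans hζB
  have w0 : sobR 0 (u + ζ) ≤ 2 * (sobR 0 u + B) := (hu.sobR_add_le hζ 0).trans (by linarith)
  have nx0 := sobR_nonneg 0 x
  have nxσ := sobR_nonneg σ x
  have nz2 := sobR_nonneg 2 ζ
  have nw0 := sobR_nonneg 0 (u + ζ)
  have nq := sobR_nonneg (1 - σ / 2) u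
  have i1 : ‖triForm (u + ζ).coeff ζ.coeff u.coeff‖ ≤
      (C₁ * (2 * (sobR 0 u + B)) * B + sobR 0 u) / 2 := by
    apply le_half_add_of_sq_le (by positivity) a0
    have h := H₁ hw hζ hu
    norm_num at h
    calc _ ≤ _ := h
      _ ≤ C₁ * (2 * (sobR 0 u + B) * B * sobR 0 u) := by gcongr
      _ = _ := by ring
  have i2 : ‖triForm x.coeff ζ.coeff u.coeff‖ ≤ (C₁ * B ^ 2 + sobR 0 u) / 2 := by
    apply le_half_add_of_sq_le (by positivity) a0
    have h := H₁ hx hζ hu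
    norm_num at h
    calc _ ≤ _ := h
      _ ≤ C₁ * (B * B * sobR 0 u) := by gcongr
      _ = _ := by ring
  have i3 : ‖triForm u.coeff u.coeff x.coeff‖ ≤
      (4 * C₂ * B * sobR (1 - σ / 2) u + sobR 1 u / 4) / 2 := by
    apply le_half_add_of_sq_le (by positivity) (by positivity)
    have h := H₂ hu hu hx
    norm_num at h
    calc _ ≤ _ := h
      _ ≤ C₂ * (sobR (1 - σ / 2) u * sobR 1 u * B) := by gcongr
      _ = _ := by ring
  have i4 : ‖triForm ζ.coeff u.coeff x.coeff‖ ≤ (4 * C₃ * B ^ 2 + sobR 1 u / 4) / 2 := by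
    apply le_half_add_of_sq_le (by positivity) (by positivity)
    have h := H₃ hζ hu hx
    norm_num at h
    calc _ ≤ _ := h
      _ ≤ C₃ * (B * sobR 1 u * B) := by gcongr
      _ = _ := by ring
  have i5 : 2 * C₂ * B * sobR (1 - σ / 2) u ≤ sobR 1 u / 8 + 2 * C₂ * B * C₄ * sobR 0 u := by
    have h := H₄ hu 0
    rw [zero_add, zero_add] at h
    have h5 : 2 * C₂ * B * (1 / (16 * (C₂ * B + 1))) ≤ 1 / 8 := by
      rw [mul_one_div, div_le_iff₀ (by positivity)]
      linarith
    calc _ ≤ 2 * C₂ * B * (1 / (16 * (C₂ * B + 1)) * sobR 1 u + C₄ * sobR 0 u) := by gcongr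
      _ = 2 * C₂ * B * (1 / (16 * (C₂ * B + 1))) * sobR 1 u + 2 * C₂ * B * C₄ * sobR 0 u := by ring
      _ ≤ 1 / 8 * sobR 1 u + 2 * C₂ * B * C₄ * sobR 0 u := by gcongr
      _ = _ := by ring
  rw [e]
  have tri : ∀ a b c d : ℂ, ‖a + b - c - d‖ ≤ ‖a‖ + ‖b‖ + ‖c‖ + ‖d‖ := fun a b c d =>
    (norm_sub_le _ _).trans (add_le_add_left ((norm_sub_le _ _).trans
      (add_le_add_left (norm_add_le _ _) _)) _)
  refine (tri _ _ _ _).trans ?_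
  have p1 : 0 ≤ C₁ * B * sobR 0 u := by positivity
  have p2 : 0 ≤ C₁ * B * B * sobR 0 u := by positivity
  have p3 : 0 ≤ C₁ * B ^ 2 * sobR 0 u := by positivity
  have p4 : 0 ≤ C₂ * B * C₄ := by positivity
  have p5 : 0 ≤ C₃ * B ^ 2 * sobR 0 u := by positivity
  have p6 : 0 ≤ C₁ * B := by positivity
  have p7 : 0 ≤ C₁ * B ^ 2 := by positivity
  nlinarith

-- Each term pairs the dissipative norm of u with a product of norms of the inputs. The term
-- quadratic in w = u + ζ must grow no faster than ‖w‖_σ²‖w‖₁², since that is all a logarithmic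
-- Gronwall argument tolerates.
set_option maxHeartbeats 800000 in
theorem exists_weighted_energy_le {σ : ℝ} (hσ : 0 < σ) (hσ1 : σ < 1) {B : ℝ} (hB : 0 ≤ B) :
    ∃ C : ℝ, 0 ≤ C ∧ ∀ {N : ℕ} {u ζ x : HSob σ}, u.SuppIn N → ζ.SuppIn N → x.SuppIn N →
      sobR σ x ≤ B → sobR 3 ζ ≤ B →
      weightedForm σ (u + ζ).coeff (u + ζ).coeff u.coeff +
        weightedForm σ (u + ζ).coeff x.coeff u.coeff +
        weightedForm σ x.coeff (u + ζ).coeff u.coeff ≤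
      ENNReal.ofReal (sobR (1 + σ) u + C * ((1 + sobR σ u) * (1 + sobR 1 u))) := by
  -- The borderline case of `Admissible`: both factors w are measured at order (1+σ)/2, the midpoint
  -- of σ and 1, so `sobR_mid_sq_le` yields exactly the product of the two norms.
  obtain ⟨C₁, hC₁, H₁⟩ := exists_weightedForm_le (s := σ) (a := (1 - σ) / 2) (b := (1 + σ) / 2)
    (a' := (1 + σ) / 2) (b' := (1 - σ) / 2) hσ.le hσ1.le
    ⟨by linarith, by linarith, le_rfl, Or.inr ⟨by ring, by linarith, by linarith, by norm_num⟩⟩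
    ⟨by linarith, by linarith, le_rfl, Or.inr ⟨by ring, by linarith, by linarith, by norm_num⟩⟩
  -- In the mixed terms x is always measured in ℋ^σ, and the other input at order 1 + σ/2, below 1 +
  -- σ.
  obtain ⟨C₂, hC₂, H₂⟩ := exists_weightedForm_le (s := σ) (a := 1 - σ / 2) (b := σ)
    (a' := 1 + σ / 2) (b' := 0) hσ.le hσ1.le
    ⟨by linarith, by linarith, le_rfl, Or.inl (by linarith)⟩
    ⟨by linarith, by linarith, le_rfl, Or.inl (by linarith)⟩
  obtain ⟨C₃, hC₃, H₃⟩ := exists_weightedForm_le (s := σ) (a := 0) (b := 1 + σ / 2)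
    (a' := σ) (b' := 1 - σ / 2) hσ.le hσ1.le
    ⟨by linarith, by linarith, le_rfl, Or.inl (by linarith)⟩
    ⟨by linarith, by linarith, le_rfl, Or.inl (by linarith)⟩
  set D := C₂ + C₃ with hD
  have hD0 : 0 ≤ D := by positivity
  -- Chosen so that the mixed terms use at most the half of the dissipation that the other terms
  -- leave.
  have hε : 0 < 1 / (32 * (D * B + 1)) := by positivity
  obtain ⟨C₄, hC₄, H₄⟩ := exists_sobR_interp (q := 1 - σ / 2) (by linarith) (by linarith) hε
  refine ⟨16 * C₁ * (1 + B) ^ 2 + 16 * D * B * C₄ + 16 * D * B * B,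
    by positivity, fun {N u ζ x} hu hζ hx hxB hζB => ?_⟩
  have hw := hu.add hζ
  obtain ⟨f₁, h₁⟩ := H₁ hw hw hu
  obtain ⟨f₂, h₂⟩ := H₂ hw hx hu
  obtain ⟨f₃, h₃⟩ := H₃ hx hw hu
  rw [← ENNReal.ofReal_toReal f₁.ne, ← ENNReal.ofReal_toReal f₂.ne, ← ENNReal.ofReal_toReal f₃.ne,
    ← ENNReal.ofReal_add (by positivity) (by positivity),
    ← ENNReal.ofReal_add (by positivity) (by positivity)]
  apply ENNReal.ofReal_le_ofReal
  have aP := sobR_nonneg (1 + σ) u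
  have aσ := sobR_nonneg σ u
  have a1 := sobR_nonneg 1 u
  have nxσ := sobR_nonneg σ x
  have wσ : sobR σ (u + ζ) ≤ 2 * (1 + B) * (1 + sobR σ u) := by
    have z := (hζ.sobR_mono (s := σ) (t := 3) (by linarith)).trans hζB
    have := hu.sobR_add_le hζ σ
    nlinarith [mul_nonneg hB aσ]
  have w1 : sobR 1 (u + ζ) ≤ 2 * (1 + B) * (1 + sobR 1 u) := by
    have z := (hζ.sobR_mono (s := 1) (t := 3) (by norm_num)).trans hζB
    have := hu.sobR_add_le hζ 1
    nlinarith [mul_nonneg hB a1]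
  have wq : sobR (1 + σ / 2) (u + ζ) ≤
      2 * (1 / (32 * (D * B + 1)) * sobR (1 + σ) u + C₄ * sobR σ u) + 2 * B := by
    have z := (hζ.sobR_mono (s := 1 + σ / 2) (t := 3) (by linarith)).trans hζB
    have h := hu.sobR_add_le hζ (1 + σ / 2)
    have h' := H₄ hu σ
    rw [show σ + (1 - σ / 2) = 1 + σ / 2 by ring, add_comm σ 1] at h'
    linarith
  have nwσ := sobR_nonneg σ (u + ζ)
  have nw1 := sobR_nonneg 1 (u + ζ)
  have nwq := sobR_nonneg (1 + σ / 2) (u + ζ)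
  have i1 : (weightedForm σ (u + ζ).coeff (u + ζ).coeff u.coeff).toReal ≤
      (sobR (1 + σ) u / 2 + 4 * C₁ * (sobR σ (u + ζ) * sobR 1 (u + ζ))) / 2 := by
    apply le_half_add_of_sq_le (by positivity) (by positivity)
    have hm := hw.sobR_mid_sq_le σ 1
    rw [show (1 - σ) / 2 + σ = (σ + 1) / 2 by ring, add_comm 1 σ] at h₁
    rw [add_comm 1 σ]
    calc _ ≤ _ := h₁
      _ = C₁ * sobR (σ + 1) u * (2 * sobR ((σ + 1) / 2) (u + ζ) ^ 2) := by ring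
      _ ≤ C₁ * sobR (σ + 1) u * (2 * (sobR σ (u + ζ) * sobR 1 (u + ζ))) := by
          have := sobR_nonneg (σ + 1) u
          gcongr
      _ = _ := by ring
  have i2 : (weightedForm σ (u + ζ).coeff x.coeff u.coeff).toReal ≤
      (sobR (1 + σ) u / 4 + 8 * C₂ * B * sobR (1 + σ / 2) (u + ζ)) / 2 := by
    apply le_half_add_of_sq_le (by positivity) (by positivity)
    rw [show 1 - σ / 2 + σ = 1 + σ / 2 by ring, zero_add] at h₂
    calc _ ≤ _ := h₂
      _ ≤ C₂ * sobR (1 + σ) u * (sobR (1 + σ / 2) (u + ζ) * B + sobR (1 + σ / 2) (u + ζ) * B) := by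
          gcongr
      _ = _ := by ring
  have i3 : (weightedForm σ x.coeff (u + ζ).coeff u.coeff).toReal ≤
      (sobR (1 + σ) u / 4 + 8 * C₃ * B * sobR (1 + σ / 2) (u + ζ)) / 2 := by
    apply le_half_add_of_sq_le (by positivity) (by positivity)
    rw [show 1 - σ / 2 + σ = 1 + σ / 2 by ring, zero_add] at h₃
    calc _ ≤ _ := h₃
      _ ≤ C₃ * sobR (1 + σ) u * (B * sobR (1 + σ / 2) (u + ζ) + B * sobR (1 + σ / 2) (u + ζ)) := by
          gcongr
      _ = _ := by ring
  have i4 : 4 * D * B * sobR (1 + σ / 2) (u + ζ) ≤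
      sobR (1 + σ) u / 2 + 8 * D * B * C₄ * sobR σ u + 8 * D * B * B := by
    have h5 : 8 * D * B * (1 / (32 * (D * B + 1))) ≤ 1 / 2 := by
      rw [mul_one_div, div_le_iff₀ (by positivity)]
      nlinarith [mul_nonneg hD0 hB]
    calc _ ≤ 4 * D * B * (2 * (1 / (32 * (D * B + 1)) * sobR (1 + σ) u + C₄ * sobR σ u) +
          2 * B) := by gcongr
      _ = 8 * D * B * (1 / (32 * (D * B + 1))) * sobR (1 + σ) u + 8 * D * B * C₄ * sobR σ u +
          8 * D * B * B := by ring
      _ ≤ 1 / 2 * sobR (1 + σ) u + 8 * D * B * C₄ * sobR σ u + 8 * D * B * B := by gcongr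
      _ = _ := by ring
  have i5 : sobR σ (u + ζ) * sobR 1 (u + ζ) ≤
      4 * (1 + B) ^ 2 * ((1 + sobR σ u) * (1 + sobR 1 u)) := by
    calc _ ≤ (2 * (1 + B) * (1 + sobR σ u)) * (2 * (1 + B) * (1 + sobR 1 u)) := by gcongr
      _ = _ := by ring
  have i6 : 2 * C₁ * (sobR σ (u + ζ) * sobR 1 (u + ζ)) ≤
      8 * C₁ * (1 + B) ^ 2 * ((1 + sobR σ u) * (1 + sobR 1 u)) := by
    calc _ ≤ 2 * C₁ * (4 * (1 + B) ^ 2 * ((1 + sobR σ u) * (1 + sobR 1 u))) := by gcongr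
      _ = _ := by ring
  have q1 : 1 ≤ (1 + sobR σ u) * (1 + sobR 1 u) := by nlinarith [mul_nonneg aσ a1]
  have q2 : sobR σ u ≤ (1 + sobR σ u) * (1 + sobR 1 u) := by nlinarith [mul_nonneg aσ a1]
  have r1 : 8 * D * B * C₄ * sobR σ u ≤ 8 * D * B * C₄ * ((1 + sobR σ u) * (1 + sobR 1 u)) := by
    gcongr
  have r2 : 8 * D * B * B ≤ 8 * D * B * B * ((1 + sobR σ u) * (1 + sobR 1 u)) :=
    le_mul_of_one_le_right (by positivity) q1
  have r3 : 0 ≤ C₁ * (1 + B) ^ 2 * ((1 + sobR σ u) * (1 + sobR 1 u)) := by positivity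
  have r4 : 0 ≤ D * B * C₄ * ((1 + sobR σ u) * (1 + sobR 1 u)) := by positivity
  have r5 : 0 ≤ D * B * B * ((1 + sobR σ u) * (1 + sobR 1 u)) := by positivity
  rw [hD] at i4 r1 r2 r4 r5 ⊢
  linarith

/-! ### The energy method -/

theorem hasDerivAt_norm_sq {f : ℝ → ℂ} {f' : ℂ} {t : ℝ} (h : HasDerivAt f f' t) :
    HasDerivAt (fun s => ‖f s‖ ^ 2) (2 * (f' * conj (f t)).re) t := by
  have h1 := h.norm_sq
  convert h1 using 2
  rw [Complex.inner, mul_comm]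

theorem hasDerivAt_sobR {σ : ℝ} {N : ℕ} {u : ℝ → HSob σ} (hu : ∀ t, (u t).SuppIn N)
    {f : ℤ × ℤ → ℂ} {t : ℝ}
    (h : ∀ k ∈ boxModes N, HasDerivAt (fun s => (u s).coeff k)
      (-((modeNorm k ^ 2 : ℝ) : ℂ) * (u t).coeff k - f k) t) (s : ℝ) :
    HasDerivAt (fun τ => sobR s (u τ)) (-2 * sobR (1 + s) (u t) -
      2 * ∑ k ∈ boxModes N, modeNorm k ^ (2 * s) * (f k * conj ((u t).coeff k)).re) t := by
  have e : (fun τ => sobR s (u τ)) = fun τ => ∑ k ∈ boxModes N,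
      modeNorm k ^ (2 * s) * ‖(u τ).coeff k‖ ^ 2 := funext fun τ => (hu τ).sobR_eq s
  rw [e]
  have h1 := HasDerivAt.fun_sum fun k hk =>
    (hasDerivAt_norm_sq (h k hk)).const_mul (modeNorm k ^ (2 * s))
  refine h1.congr_deriv ?_
  rw [(hu t).sobR_eq, Finset.mul_sum, Finset.mul_sum, ← Finset.sum_sub_distrib]
  refine Finset.sum_congr rfl fun k _ => ?_
  by_cases hk : k = 0
  · simp [hk, (u t).coeff_zero_mode]
  have e2 : modeNorm k ^ (2 * (1 + s)) = modeNorm k ^ 2 * modeNorm k ^ (2 * s) := by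
    rw [← Real.rpow_natCast, ← Real.rpow_add (modeNorm_pos hk)]; congr 1; push_cast; ring
  have e3 : (-((modeNorm k ^ 2 : ℝ) : ℂ) * (u t).coeff k - f k) * conj ((u t).coeff k) =
      ((-(modeNorm k ^ 2 * ‖(u t).coeff k‖ ^ 2) : ℝ) : ℂ) - f k * conj ((u t).coeff k) := by
    rw [sub_mul, mul_assoc, Complex.mul_conj, Complex.normSq_eq_norm_sq]
    push_cast
    ring
  rw [e2, e3, Complex.sub_re, Complex.ofReal_re]
  ring

/-- The nonlinearity `B(w + x, w + x) - B(x, x)`. -/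
def relNonlin {σ : ℝ} (w x : HSob σ) (k : ℤ × ℤ) : ℂ :=
  nonlin w.coeff w.coeff k + nonlin w.coeff x.coeff k + nonlin x.coeff w.coeff k

theorem re_sum_relNonlin {σ : ℝ} {N : ℕ} {u : HSob σ} (hu : u.SuppIn N) (w x : HSob σ) :
    |∑ k ∈ boxModes N, (relNonlin w x k * conj (u.coeff k)).re| ≤
      ‖triForm w.coeff w.coeff u.coeff + triForm w.coeff x.coeff u.coeff +
        triForm x.coeff w.coeff u.coeff‖ := by
  rw [triForm_eq_sum _ _ hu, triForm_eq_sum _ _ hu, triForm_eq_sum _ _ hu,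
    ← Finset.sum_add_distrib, ← Finset.sum_add_distrib, ← Complex.re_sum]
  refine (Complex.abs_re_le_norm _).trans (le_of_eq ?_)
  congr 1
  exact Finset.sum_congr rfl fun k _ => by rw [relNonlin]; ring

theorem weighted_re_sum_relNonlin {σ : ℝ} {N : ℕ} {u : HSob σ} (w x : HSob σ) (s : ℝ) {M : ℝ}
    (hM : 0 ≤ M) (h : weightedForm s w.coeff w.coeff u.coeff +
      weightedForm s w.coeff x.coeff u.coeff + weightedForm s x.coeff w.coeff u.coeff ≤
      ENNReal.ofReal M) :
    |∑ k ∈ boxModes N, modeNorm k ^ (2 * s) * (relNonlin w x k * conj (u.coeff k)).re| ≤ M := by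
  refine (Finset.abs_sum_le_sum_abs _ _).trans ?_
  rw [← ENNReal.ofReal_le_ofReal_iff hM]
  refine le_trans ?_ h
  rw [ENNReal.ofReal_sum_of_nonneg fun _ _ => abs_nonneg _]
  simp only [weightedForm, ← ENNReal.tsum_add]
  refine le_trans (Finset.sum_le_sum fun k _ => ?_) (ENNReal.sum_le_tsum (boxModes N))
  have hw := Real.rpow_nonneg (modeNorm_nonneg k) (2 * s)
  rw [abs_mul, abs_of_nonneg hw, ENNReal.ofReal_mul hw, ← mul_add, ← mul_add, ← add_mul, ← add_mul]
  gcongr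
  calc ENNReal.ofReal |(relNonlin w x k * conj (u.coeff k)).re|
      ≤ ENNReal.ofReal ‖relNonlin w x k * conj (u.coeff k)‖ :=
        ENNReal.ofReal_le_ofReal (Complex.abs_re_le_norm _)
    _ = ‖relNonlin w x k‖ₑ * emod u.coeff k := by
        rw [ofReal_norm, enorm_mul, emod, ← ofReal_norm (conj (u.coeff k)), RCLike.norm_conj,
          ofReal_norm]
    _ ≤ _ := by
        gcongr
        exact (enorm_add_le _ _).trans (by gcongr; exact enorm_add_le _ _)

/-- A bound in `ℋ^σ` for the solutions of the Galerkin systems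
`u' = Au - ρ (B(w, w) + B(w, x) + B(x, w))`, `w = u + ζ`, `u(0) = 0`, which depends only on bounds
for `x` in `ℋ^σ` and for `ζ` in `ℋ³`. -/
theorem exists_galerkin_bound {σ : ℝ} (hσ : 0 < σ) (hσ1 : σ < 1) {T : ℝ} (hT : 0 ≤ T) {B : ℝ}
    (hB : 0 ≤ B) : ∃ K : ℝ, ∀ (N : ℕ) (u ζ x : ℝ → HSob σ) (ρ : ℝ → ℝ),
      (∀ t, (u t).SuppIn N) → (∀ t, (ζ t).SuppIn N) → (∀ t, (x t).SuppIn N) →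
      ContinuousOn u (Set.Icc 0 T) → u 0 = 0 →
      (∀ t ∈ Set.Icc 0 T, sobR σ (x t) ≤ B ∧ sobR 3 (ζ t) ≤ B ∧ 0 ≤ ρ t ∧ ρ t ≤ 1) →
      (∀ t ∈ Set.Ioo 0 T, ∀ k ∈ boxModes N, HasDerivAt (fun s => (u s).coeff k)
        (-((modeNorm k ^ 2 : ℝ) : ℂ) * (u t).coeff k -
          ρ t * relNonlin (u t + ζ t) (x t) k) t) →
      ∀ t ∈ Set.Icc 0 T, sobR σ (u t) ≤ K := by
  obtain ⟨C₁, hC₁, H₁⟩ := exists_energy_le hσ hσ1 hB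
  obtain ⟨C₂, hC₂, H₂⟩ := exists_weighted_energy_le hσ hσ1 hB
  -- This makes L e^{-2C₁t} ≥ 2C₂ on [0,T]: the L² dissipation then pays for the term 2C₂‖u‖₁² in
  -- the derivative of the logarithm.
  set L := 2 * C₂ * Real.exp (2 * C₁ * T) with hL
  have hL0 : 0 ≤ L := by positivity
  refine ⟨Real.exp (L + 2 * C₂ * T), fun N u ζ x ρ hu hζ hx hcont hu0 hb hd => ?_⟩
  -- A Lyapunov function combining both energy estimates. It decreases, so the integrated bound on
  -- ‖u‖₁² is never needed explicitly, and Q(0) = L because u starts at zero.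
  set Q : ℝ → ℝ := fun t => Real.log (1 + sobR σ (u t)) +
    L * (Real.exp (-(2 * C₁ * t)) * (1 + sobR 0 (u t))) - 2 * C₂ * t with hQ
  have hsobcont : ∀ s, ContinuousOn (fun t => sobR s (u t)) (Set.Icc 0 T) := by
    intro s
    have e : (fun τ => sobR s (u τ)) = fun τ => ∑ k ∈ boxModes N,
      modeNorm k ^ (2 * s) * ‖(u τ).coeff k‖ ^ 2 := funext fun τ => (hu τ).sobR_eq s
    rw [e]
    refine continuousOn_finsetSum _ fun k _ => ?_
    exact continuousOn_const.mul
      (((HSob.coeffL σ hσ.le k).continuous.comp_continuousOn hcont).norm.pow 2)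
  have hpos : ∀ s t, 0 < 1 + sobR s (u t) := fun s t => by
    have := sobR_nonneg s (u t); linarith
  have hQc : ContinuousOn Q (Set.Icc 0 T) := by
    refine ((ContinuousOn.log (continuousOn_const.add (hsobcont σ)) fun t _ =>
      (hpos σ t).ne').add (continuousOn_const.mul (ContinuousOn.mul (by fun_prop)
        (continuousOn_const.add (hsobcont 0))))).sub (by fun_prop)
  have hQd : ∀ t ∈ Set.Ioo 0 T, ∃ q ≤ 0, HasDerivAt Q q t := by
    intro t ht
    obtain ⟨hxB, hζB, hρ0, hρ1⟩ := hb t (Set.Ioo_subset_Icc_self ht)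
    have d0 := hasDerivAt_sobR hu (hd t ht) 0
    have dσ := hasDerivAt_sobR hu (hd t ht) σ
    have e1 := (re_sum_relNonlin (hu t) (u t + ζ t) (x t)).trans (H₁ (hu t) (hζ t) (hx t) hxB hζB)
    have a0 := sobR_nonneg 0 (u t)
    have a1 := sobR_nonneg 1 (u t)
    have aσ := sobR_nonneg σ (u t)
    have aσ1 := sobR_nonneg (1 + σ) (u t)
    have e2 := weighted_re_sum_relNonlin (N := N) (u t + ζ t) (x t) σ (by positivity)
      (H₂ (hu t) (hζ t) (hx t) hxB hζB)
    have r0 : ∑ k ∈ boxModes N, modeNorm k ^ (2 * (0 : ℝ)) *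
        ((ρ t : ℂ) * relNonlin (u t + ζ t) (x t) k * conj ((u t).coeff k)).re =
        ρ t * ∑ k ∈ boxModes N, (relNonlin (u t + ζ t) (x t) k * conj ((u t).coeff k)).re := by
      rw [Finset.mul_sum]
      refine Finset.sum_congr rfl fun k _ => ?_
      rw [mul_zero, Real.rpow_zero, one_mul, mul_assoc, Complex.re_ofReal_mul]
    have rσ : ∑ k ∈ boxModes N, modeNorm k ^ (2 * σ) *
        ((ρ t : ℂ) * relNonlin (u t + ζ t) (x t) k * conj ((u t).coeff k)).re =
        ρ t * ∑ k ∈ boxModes N, modeNorm k ^ (2 * σ) *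
          (relNonlin (u t + ζ t) (x t) k * conj ((u t).coeff k)).re := by
      rw [Finset.mul_sum]
      refine Finset.sum_congr rfl fun k _ => ?_
      rw [mul_assoc, Complex.re_ofReal_mul]
      ring
    rw [r0, add_zero] at d0
    rw [rσ] at dσ
    set S₀ := ∑ k ∈ boxModes N, (relNonlin (u t + ζ t) (x t) k * conj ((u t).coeff k)).re
    set Sσ := ∑ k ∈ boxModes N, modeNorm k ^ (2 * σ) *
          (relNonlin (u t + ζ t) (x t) k * conj ((u t).coeff k)).re
    have b0 : |ρ t * S₀| ≤ sobR 1 (u t) / 2 + C₁ * (1 + sobR 0 (u t)) := by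
      rw [abs_mul, abs_of_nonneg hρ0]
      exact (mul_le_of_le_one_left (abs_nonneg _) hρ1).trans e1
    have bσ : |ρ t * Sσ| ≤ sobR (1 + σ) (u t) +
        C₂ * ((1 + sobR σ (u t)) * (1 + sobR 1 (u t))) := by
      rw [abs_mul, abs_of_nonneg hρ0]
      exact (mul_le_of_le_one_left (abs_nonneg _) hρ1).trans e2
    have dl := (dσ.const_add 1).log (hpos σ t).ne'
    have de : HasDerivAt (fun τ : ℝ => Real.exp (-(2 * C₁ * τ)))
        (Real.exp (-(2 * C₁ * t)) * -(2 * C₁)) t := by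
      have := ((hasDerivAt_id t).const_mul (2 * C₁)).neg.exp
      simpa using this
    have dl2 := (de.mul (d0.const_add 1)).const_mul L
    refine ⟨_, ?_, (dl.add dl2).sub ((hasDerivAt_id t).const_mul (2 * C₂))⟩
    have m1 : (-2 * sobR (1 + σ) (u t) - 2 * (ρ t * Sσ)) / (1 + sobR σ (u t)) ≤
        2 * C₂ * (1 + sobR 1 (u t)) := by
      rw [div_le_iff₀ (hpos σ t)]
      have := (abs_le.1 bσ).1
      linarith
    set X := Real.exp (-(2 * C₁ * t)) with hX
    have hX0 : 0 < X := Real.exp_pos _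
    have hLX : 2 * C₂ ≤ L * X := by
      rw [hL, hX, mul_assoc, ← Real.exp_add]
      refine le_mul_of_one_le_right (by positivity) (Real.one_le_exp ?_)
      have : 0 ≤ 2 * C₁ * (T - t) := mul_nonneg (by positivity) (by linarith [ht.2])
      linarith
    have m2 : L * (X * -(2 * C₁) * (1 + sobR 0 (u t)) +
        X * (-2 * sobR 1 (u t) - 2 * (ρ t * S₀))) ≤ -(L * X) * sobR 1 (u t) := by
      have hLX0 : 0 ≤ L * X := by positivity
      have h1 := (abs_le.1 b0).1
      have h2 : -(2 * C₁) * (1 + sobR 0 (u t)) + (-2 * sobR 1 (u t) - 2 * (ρ t * S₀)) ≤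
          -sobR 1 (u t) := by linarith
      have := mul_le_mul_of_nonneg_left h2 hLX0
      linarith
    have m3 : 2 * C₂ * sobR 1 (u t) ≤ L * X * sobR 1 (u t) := by gcongr
    simp only [mul_one]
    linarith
  have hanti : AntitoneOn Q (Set.Icc 0 T) := by
    refine antitoneOn_of_deriv_nonpos (convex_Icc 0 T) hQc ?_ ?_
    · rw [interior_Icc]
      intro t ht
      obtain ⟨q, -, hq⟩ := hQd t ht
      exact hq.differentiableAt.differentiableWithinAt
    · rw [interior_Icc]
      intro t ht
      obtain ⟨q, hq0, hq⟩ := hQd t ht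
      rw [hq.deriv]
      exact hq0
  intro t ht
  have h1 := hanti ⟨le_rfl, hT⟩ ht ht.1
  have h0 : ∀ s, sobR s (0 : HSob σ) = 0 := fun s => by
    simp [sobR, sobSq, emod]
  have h2 : Q 0 = L := by simp [hQ, hu0, h0]
  rw [h2] at h1
  have h3 : 0 ≤ L * (Real.exp (-(2 * C₁ * t)) * (1 + sobR 0 (u t))) :=
    mul_nonneg hL0 (mul_nonneg (Real.exp_pos _).le (hpos 0 t).le)
  have h4 : 2 * C₂ * t ≤ 2 * C₂ * T := by gcongr; exact ht.2
  have h5 : Real.log (1 + sobR σ (u t)) ≤ L + 2 * C₂ * T := by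
    simp only [hQ] at h1
    linarith
  have h6 := (Real.log_le_iff_le_exp (hpos σ t)).1 h5
  linarith

/-! ### Duhamel's formula for a single mode -/

/-- The convolution `∫₀ᵗ e^{-λ r} h(t - r) dr`. -/
def duhamel (l : ℝ) (h : ℝ → ℂ) (t : ℝ) : ℂ :=
  ∫ r in (0 : ℝ)..t, (Real.exp (-(l * r)) : ℂ) * h (t - r)

@[simp] theorem duhamel_zero (l : ℝ) (h : ℝ → ℂ) : duhamel l h 0 = 0 := by simp [duhamel]

theorem continuous_duhamel_integrand (l : ℝ) {h : ℝ → ℂ} (hh : Continuous h) (t : ℝ) :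
    Continuous fun r => (Real.exp (-(l * r)) : ℂ) * h (t - r) := by fun_prop

theorem duhamel_eq (l : ℝ) (h : ℝ → ℂ) (t : ℝ) : duhamel l h t =
    (Real.exp (-(l * t)) : ℂ) * ∫ s in (0 : ℝ)..t, (Real.exp (l * s) : ℂ) * h s := by
  rw [duhamel, ← intervalIntegral.integral_const_mul]
  have h1 := intervalIntegral.integral_comp_sub_left (a := 0) (b := t)
    (fun s => (Real.exp (-(l * t)) : ℂ) * ((Real.exp (l * s) : ℂ) * h s)) t
  rw [sub_self, sub_zero] at h1
  rw [← h1]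
  refine intervalIntegral.integral_congr fun r _ => ?_
  rw [← mul_assoc, ← Complex.ofReal_mul, ← Real.exp_add]
  congr 4
  ring

theorem hasDerivAt_duhamel (l : ℝ) {h : ℝ → ℂ} (hh : Continuous h) (t : ℝ) :
    HasDerivAt (duhamel l h) (-(l : ℂ) * duhamel l h t + h t) t := by
  have e : duhamel l h = fun t => (Real.exp (-(l * t)) : ℂ) *
      ∫ s in (0 : ℝ)..t, (Real.exp (l * s) : ℂ) * h s := funext (duhamel_eq l h)
  have hc : Continuous fun s => (Real.exp (l * s) : ℂ) * h s := by fun_prop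
  have d1 := (hc.integral_hasStrictDerivAt 0 t).hasDerivAt
  have d2 : HasDerivAt (fun τ : ℝ => ((Real.exp (-(l * τ)) : ℝ) : ℂ))
      ((Real.exp (-(l * t)) * -l : ℝ) : ℂ) t := by
    have := ((hasDerivAt_id t).const_mul l).neg.exp
    simp only [id_eq, mul_one] at this
    exact this.ofReal_comp
  have d3 := d2.mul d1
  rw [e]
  refine d3.congr_deriv ?_
  have h2 : ((Real.exp (-(l * t)) : ℝ) : ℂ) * (Real.exp (l * t) : ℂ) = 1 := by
    rw [← Complex.ofReal_mul, ← Real.exp_add]; simp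
  push_cast at h2 ⊢
  linear_combination h t * h2

theorem continuous_duhamel (l : ℝ) {h : ℝ → ℂ} (hh : Continuous h) : Continuous (duhamel l h) :=
  continuous_iff_continuousAt.2 fun t => (hasDerivAt_duhamel l hh t).continuousAt

theorem duhamel_congr (l : ℝ) {h h' : ℝ → ℂ} {t : ℝ} (ht : 0 ≤ t)
    (hh : ∀ s ∈ Set.Icc 0 t, h s = h' s) : duhamel l h t = duhamel l h' t := by
  refine intervalIntegral.integral_congr fun r hr => ?_
  rw [Set.uIcc_of_le ht] at hr
  rw [hh _ ⟨by linarith [hr.2], by linarith [hr.1]⟩]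

/-- Taking a coefficient is a bounded functional and commutes with the integral. For a Fourier
multiplier Q the vector equation thus splits into scalar Duhamel formulas, which can be
differentiated. -/
theorem volterraInt_nsKernel_coeff {σ : ℝ} (hσ : 0 < σ) (hσ1 : σ < 1) {T : ℝ} (hT : 0 ≤ T)
    {Q : HSob σ →L[ℝ] HSob σ} (hQ : ‖Q‖ ≤ 1) {q : ℤ × ℤ → ℂ}
    (hq : ∀ v k, (Q v).coeff k = q k * v.coeff k) {β : ℝ → ℝ} (hβ : Continuous β)
    (hβ0 : ∀ s, 0 ≤ β s) (hβ1 : ∀ s, β s ≤ 1) {R : ℝ} (hR : 0 < R) {x : ℝ → HSob σ}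
    (hx : Continuous x) {t : ℝ} (ht : t ∈ Set.Icc 0 T) (k : ℤ × ℤ) :
    (volterraInt (nsKernel Q β R) x t).coeff k = q k * duhamel (modeNorm k ^ 2)
      (fun s => β s * nonlin (retract R (x s)).coeff (retract R (x s)).coeff k) t := by
  have hi := (isVolterraKernel_nsKernel hσ hσ1 hT hQ hβ hβ0 hβ1 hR).intervalIntegrable ht hx
  rw [volterraInt, ← HSob.coeffL_apply σ hσ.le k,
    ← ContinuousLinearMap.intervalIntegral_comp_comm _ hi, duhamel,
    ← intervalIntegral.integral_const_mul]
  refine intervalIntegral.integral_congr_ae (Filter.Eventually.of_forall fun r hr => ?_)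
  rw [Set.uIoc_of_le ht.1] at hr
  rw [HSob.coeffL_apply, nsKernel, HSob.coeff_smul, hq, heatBilin_coeff hσ hσ1 hr.1,
    Complex.real_smul]
  ring

theorem continuous_nonlin_comp {σ : ℝ} (hσ : 0 < σ) (hσ1 : σ < 1) (k : ℤ × ℤ) {x : ℝ → HSob σ}
    (hx : Continuous x) : Continuous fun s => nonlin (x s).coeff (x s).coeff k := by
  have h2 : Continuous fun s => (x s, x s) := hx.prodMk hx
  have h3 := (continuous_nonlin hσ hσ1 k).comp h2
  exact h3

theorem volterraInt_mildKernel_coeff {σ : ℝ} (hσ : 0 < σ) (hσ1 : σ < 1) {T : ℝ} (hT : 0 ≤ T)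
    (x : C(Set.Icc (0 : ℝ) T, HSob σ)) {t : ℝ} (ht : t ∈ Set.Icc 0 T) (k : ℤ × ℤ) :
    (volterraInt (mildKernel σ) (Set.IccExtend hT x) t).coeff k = duhamel (modeNorm k ^ 2)
      (fun s => nonlin (Set.IccExtend hT x s).coeff (Set.IccExtend hT x s).coeff k) t := by
  have hR : 0 < ‖x‖ + 1 := by positivity
  have hxR : ∀ s, ‖x s‖ ≤ ‖x‖ + 1 := fun s => (x.norm_coe_le_norm s).trans (by linarith)
  rw [volterraInt_mildKernel_eq hT hR hxR ht,
    volterraInt_nsKernel_coeff hσ hσ1 hT ContinuousLinearMap.norm_id_le (q := fun _ => 1)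
      (by simp) continuous_const (fun _ => zero_le_one) (fun _ => le_rfl) hR
      x.continuous.Icc_extend' ht, one_mul]
  refine duhamel_congr _ ht.1 fun s hs => ?_
  rw [retract_eq_self hR]
  · simp
  · exact hxR _

/-! ### Existence for the mild equation -/

/-- Dini's theorem: the continuous truncation errors decrease to zero on a compact interval. -/
theorem exists_proj_close {T σ : ℝ} (g : C(Set.Icc (0 : ℝ) T, HSob σ)) {ε : ℝ} (hε : 0 < ε) :
    ∃ M : ℕ, ∀ N ≥ M, ∀ t, ‖g t - proj σ N (g t)‖ ≤ ε := by
  have h1 : TendstoUniformly (fun N t => ‖g t - proj σ N (g t)‖) (fun _ => 0) Filter.atTop :=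
    Antitone.tendstoUniformly_of_forall_tendsto (fun N => by fun_prop)
      (fun M N hMN t => antitone_norm_sub_proj (g t) hMN) continuous_const
      (fun t => tendsto_proj (g t))
  rw [Metric.tendstoUniformly_iff] at h1
  obtain ⟨M, hM⟩ := Filter.eventually_atTop.1 (h1 ε hε)
  refine ⟨M, fun N hN t => ?_⟩
  have := hM N hN t
  rw [dist_eq_norm, zero_sub, norm_neg, norm_norm] at this
  exact this.le

theorem proj_coeff' (r : ℝ) (N : ℕ) (v : HSob r) (k : ℤ × ℤ) :
    (proj r N v).coeff k = (if k ∈ boxModes N then 1 else 0 : ℂ) * v.coeff k := by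
  rw [proj_coeff]; split_ifs <;> simp

theorem nonlin_smul_smul {σ : ℝ} (c : ℝ) (u : HSob σ) (k : ℤ × ℤ) :
    nonlin (c • u).coeff (c • u).coeff k = ((c ^ 2 : ℝ) : ℂ) * nonlin u.coeff u.coeff k := by
  rw [nonlin_smul_left, nonlin_smul_right, Complex.real_smul, Complex.real_smul]
  push_cast; ring

theorem relNonlin_eq {σ : ℝ} (hσ : 0 ≤ σ) (w x : HSob σ) (k : ℤ × ℤ) :
    relNonlin w x k = nonlin (w + x).coeff (w + x).coeff k - nonlin x.coeff x.coeff k := by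
  rw [relNonlin, nonlin_add_left hσ, nonlin_add_right hσ, nonlin_add_right hσ]
  ring

theorem sobR_three_proj_le {σ : ℝ} (hσ : 0 ≤ σ) (M N : ℕ) (v : HSob σ) :
    sobR 3 (proj σ N (proj σ M v)) ≤
      (∑ k ∈ boxModes M, modeNorm k ^ (2 * (3 : ℝ))) * ‖v‖ ^ 2 := by
  have hs : (proj σ N (proj σ M v)).SuppIn M := fun k hk => by
    rw [proj_coeff, proj_coeff, if_neg hk, ite_self]
  rw [hs.sobR_eq, Finset.sum_mul]
  refine Finset.sum_le_sum fun k _ => ?_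
  have hw := Real.rpow_nonneg (modeNorm_nonneg k) (2 * (3 : ℝ))
  gcongr
  exact (HSob.norm_coeff_le hσ _ k).trans
    ((norm_proj_apply_le σ N _).trans (norm_proj_apply_le σ M v))

/-- A Galerkin solution is decomposed as y = u + ζ + x, with ζ from low modes of g, x driven by the
small remainder, and u controlled by energy. All thresholds are fixed from g before N and R are
chosen. -/
theorem exists_apriori {σ : ℝ} (hσ : 0 < σ) (hσ1 : σ < 1) {T : ℝ} (hT : 0 ≤ T)
    (g : C(Set.Icc (0 : ℝ) T, HSob σ)) : ∃ K : ℝ, ∀ (N : ℕ) (R : ℝ), 0 < R →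
      ∀ y : C(Set.Icc (0 : ℝ) T, HSob σ), (∀ t : Set.Icc (0 : ℝ) T, y t = proj σ N (g t) -
        volterraInt (nsKernel (proj σ N) (fun _ => 1) R) (Set.IccExtend hT y) t) →
      ∀ t, ‖y t‖ ≤ K := by
  set κ := ∫ r in (0 : ℝ)..T, heatRate σ r with hκ
  have hκ0 : 0 ≤ κ := intervalIntegral.integral_nonneg hT fun r _ => heatRate_nonneg σ r
  -- Small enough that the convolution of paths truncated at radius η has norm at most η/2; the
  -- remainder of g takes the other η/2.
  set η := 1 / (2 * (κ + 1)) with hη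
  have hη0 : 0 < η := by positivity
  have hηκ : η ^ 2 * κ ≤ η / 2 := by
    have h1 : η * κ ≤ 1 / 2 := by
      rw [hη, one_div_mul_eq_div, div_le_iff₀ (by positivity)]; linarith
    nlinarith
  obtain ⟨M, hM⟩ := exists_proj_close g (half_pos hη0)
  set B := max (η ^ 2) ((∑ k ∈ boxModes M, modeNorm k ^ (2 * (3 : ℝ))) * ‖g‖ ^ 2) with hB
  obtain ⟨K, hK⟩ := exists_galerkin_bound hσ hσ1 hT (B := B)
    ((sq_nonneg η).trans (le_max_left _ _))
  refine ⟨Real.sqrt K + ‖g‖ + η, fun N R hR y hy => ?_⟩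
  have hyc : Continuous (Set.IccExtend hT y) := y.continuous.Icc_extend'
  have hgc : Continuous (Set.IccExtend hT g) := g.continuous.Icc_extend'
  -- By bilinearity the retraction in the equation of y is this scalar factor. Putting the same
  -- factor into the equation of x makes the difference of the two equations exact, whatever R is.
  set ρ : ℝ → ℝ := fun s => retractFactor R (Set.IccExtend hT y s) ^ 2 with hρ
  have hρc : Continuous ρ := ((continuous_retractFactor hR).comp hyc).pow 2
  have hρ0 : ∀ s, 0 ≤ ρ s := fun s => sq_nonneg _
  have hρ1 : ∀ s, ρ s ≤ 1 := fun s =>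
    pow_le_one₀ (retractFactor_nonneg hR _) (retractFactor_le_one hR _)
  have hP := norm_proj_le σ N
  obtain ⟨x, hx⟩ := (isVolterraKernel_nsKernel hσ hσ1 hT hP hρc hρ0 hρ1 hη0).exists_solution hT
    (⟨fun t => proj σ N (g t - proj σ M (g t)), by fun_prop⟩ : C(Set.Icc (0 : ℝ) T, HSob σ))
  simp only [ContinuousMap.coe_mk] at hx
  have hxc : Continuous (Set.IccExtend hT x) := x.continuous.Icc_extend'
  have hxη : ∀ t, ‖x t‖ ≤ η := by
    intro t
    rw [hx t]
    refine (norm_sub_le _ _).trans ?_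
    have h1 := (norm_proj_apply_le σ N (g t - proj σ M (g t))).trans (hM M le_rfl t)
    have h2 := norm_volterraInt_nsKernel_le hσ hσ1 hP hρ0 hρ1 hη0 (x := Set.IccExtend hT x) t.2
    linarith
  have hcoeff_y : ∀ (t : Set.Icc (0 : ℝ) T) (k : ℤ × ℤ), (y t).coeff k =
      (proj σ N (g t)).coeff k - (if k ∈ boxModes N then 1 else 0 : ℂ) *
        duhamel (modeNorm k ^ 2) (fun s => ρ s * nonlin (Set.IccExtend hT y s).coeff
          (Set.IccExtend hT y s).coeff k) t := by
    intro t k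
    rw [hy t, HSob.coeff_sub, volterraInt_nsKernel_coeff hσ hσ1 hT hP (proj_coeff' σ N)
      continuous_const (fun _ => zero_le_one) (fun _ => le_rfl) hR hyc t.2]
    congr 3
    funext s
    rw [Complex.ofReal_one, one_mul]
    exact nonlin_smul_smul _ _ k
  have hcoeff_x : ∀ (t : Set.Icc (0 : ℝ) T) (k : ℤ × ℤ), (x t).coeff k =
      (proj σ N (g t - proj σ M (g t))).coeff k - (if k ∈ boxModes N then 1 else 0 : ℂ) *
        duhamel (modeNorm k ^ 2) (fun s => ρ s * nonlin (Set.IccExtend hT x s).coeff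
          (Set.IccExtend hT x s).coeff k) t := by
    intro t k
    rw [hx t, HSob.coeff_sub, volterraInt_nsKernel_coeff hσ hσ1 hT hP (proj_coeff' σ N)
      hρc hρ0 hρ1 hη0 hxc t.2]
    congr 3
    funext s
    rw [retract_eq_self hη0]
    exact hxη _
  set ζ : ℝ → HSob σ := fun t => proj σ N (proj σ M (Set.IccExtend hT g t)) with hζ
  have hζc : Continuous ζ := by fun_prop
  -- The linear data cancel, since the projections of g and of its remainder differ by ζ. Hence u(0)
  -- = 0 and its coefficients are differentiable.
  set u : ℝ → HSob σ := fun t => Set.IccExtend hT y t - Set.IccExtend hT x t - ζ t with hu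
  have hys : ∀ t, (Set.IccExtend hT y t).SuppIn N := fun t k hk => by
    have := hcoeff_y (Set.projIcc 0 T hT t) k
    rw [proj_coeff, if_neg hk, if_neg hk, zero_mul, sub_zero] at this
    exact this
  have hxs : ∀ t, (Set.IccExtend hT x t).SuppIn N := fun t k hk => by
    have := hcoeff_x (Set.projIcc 0 T hT t) k
    rw [proj_coeff, if_neg hk, if_neg hk, zero_mul, sub_zero] at this
    exact this
  have hζs : ∀ t, (ζ t).SuppIn N := fun t => HSob.suppIn_proj N _
  have hus : ∀ t, (u t).SuppIn N := fun t k hk => by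
    rw [hu]
    simp only [HSob.coeff_sub]
    rw [hys t k hk, hxs t k hk, hζs t k hk, sub_zero, sub_zero]
  have hyu : ∀ t, Set.IccExtend hT y t = u t + ζ t + Set.IccExtend hT x t := fun t => by
    simp only [hu]; abel
  have hu_coeff : ∀ t ∈ Set.Icc 0 T, ∀ k ∈ boxModes N, (u t).coeff k =
      -duhamel (modeNorm k ^ 2) (fun s => ρ s *
        relNonlin (u s + ζ s) (Set.IccExtend hT x s) k) t := by
    intro t ht k hk
    have e1 := hcoeff_y ⟨t, ht⟩ k
    have e2 := hcoeff_x ⟨t, ht⟩ k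
    simp only [hu, HSob.coeff_sub, hζ, Set.IccExtend_of_mem hT _ ht]
    rw [e1, e2, if_pos hk, one_mul, one_mul, map_sub, HSob.coeff_sub]
    have e3 : duhamel (modeNorm k ^ 2) (fun s => ρ s *
        relNonlin (u s + ζ s) (Set.IccExtend hT x s) k) t =
        duhamel (modeNorm k ^ 2) (fun s => ρ s * nonlin (Set.IccExtend hT y s).coeff
          (Set.IccExtend hT y s).coeff k) t -
        duhamel (modeNorm k ^ 2) (fun s => ρ s * nonlin (Set.IccExtend hT x s).coeff
          (Set.IccExtend hT x s).coeff k) t := by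
      have c1 := continuous_nonlin_comp hσ hσ1 k hyc
      have c2 := continuous_nonlin_comp hσ hσ1 k hxc
      rw [duhamel, duhamel, duhamel, ← intervalIntegral.integral_sub]
      · refine intervalIntegral.integral_congr fun r _ => ?_
        rw [relNonlin_eq hσ.le, ← hyu]
        ring
      · exact (continuous_duhamel_integrand _ ((Complex.continuous_ofReal.comp hρc).mul c1)
          _).intervalIntegrable _ _
      · exact (continuous_duhamel_integrand _ ((Complex.continuous_ofReal.comp hρc).mul c2)
          _).intervalIntegrable _ _
    simp only [hu, hζ] at e3
    rw [e3]
    ring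
  have huc : Continuous u := (hyc.sub hxc).sub hζc
  have hu0 : u 0 = 0 := by
    have h0 : (0 : ℝ) ∈ Set.Icc 0 T := ⟨le_rfl, hT⟩
    refine HSob.ext fun k => ?_
    by_cases hk : k ∈ boxModes N
    · rw [hu_coeff 0 h0 k hk, duhamel_zero, neg_zero, HSob.coeff_zero]
    · rw [hus 0 k hk, HSob.coeff_zero]
  have hbound := hK N u ζ (Set.IccExtend hT x) ρ hus hζs hxs huc.continuousOn hu0
    (fun t _ => ⟨by
      rw [sobR_self]
      refine le_trans ?_ (le_max_left _ _)
      have := hxη (Set.projIcc 0 T hT t)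
      exact pow_le_pow_left₀ (norm_nonneg _) this 2, by
      refine (sobR_three_proj_le hσ.le M N _).trans (le_trans ?_ (le_max_right _ _))
      have hs : 0 ≤ ∑ k ∈ boxModes M, modeNorm k ^ (2 * (3 : ℝ)) :=
        Finset.sum_nonneg fun k _ => Real.rpow_nonneg (modeNorm_nonneg k) _
      have := g.norm_coe_le_norm (Set.projIcc 0 T hT t)
      gcongr
      exact this, hρ0 t, hρ1 t⟩)
    (fun t ht k hk => by
      have hc : Continuous fun s => (ρ s : ℂ) *
          relNonlin (u s + ζ s) (Set.IccExtend hT x s) k := by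
        have c1 := continuous_nonlin_comp hσ hσ1 k hyc
        have c2 := continuous_nonlin_comp hσ hσ1 k hxc
        simp only [relNonlin_eq hσ.le, ← hyu]
        exact (Complex.continuous_ofReal.comp hρc).mul (c1.sub c2)
      have hd := (hasDerivAt_duhamel (modeNorm k ^ 2) hc t).neg
      have he : (fun s => (u s).coeff k) =ᶠ[𝓝 t] fun s => -duhamel (modeNorm k ^ 2)
          (fun s => ρ s * relNonlin (u s + ζ s) (Set.IccExtend hT x s) k) s := by
        filter_upwards [Icc_mem_nhds ht.1 ht.2] with s hs
        exact hu_coeff s hs k hk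
      refine (hd.congr_of_eventuallyEq he).congr_deriv ?_
      rw [hu_coeff t (Set.Ioo_subset_Icc_self ht) k hk]
      ring)
  intro t
  have h1 := hbound t t.2
  rw [sobR_self] at h1
  have h2 : ‖u t‖ ≤ Real.sqrt K := Real.le_sqrt_of_sq_le h1
  have h3 := hyu t
  rw [Set.IccExtend_of_mem hT _ t.2, Set.IccExtend_of_mem hT _ t.2] at h3
  have h4 : ‖ζ t‖ ≤ ‖g‖ := (norm_proj_apply_le σ N _).trans
    ((norm_proj_apply_le σ M _).trans (g.norm_coe_le_norm _))
  have h5 : ‖y t‖ ≤ ‖u t‖ + ‖ζ t‖ + ‖x t‖ := by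
    have h6 : y t = u t + ζ t + x t := h3
    rw [h6]
    exact (norm_add_le _ _).trans (by gcongr; exact norm_add_le _ _)
  linarith [hxη t]

/-! ### Solving the mild equation -/

theorem exists_mild {σ : ℝ} (hσ : 0 < σ) (hσ1 : σ < 1) {T : ℝ} (hT : 0 ≤ T)
    (g : C(Set.Icc (0 : ℝ) T, HSob σ)) : ∃ v, IsMild hT g v := by
  obtain ⟨K, hK⟩ := exists_apriori hσ hσ1 hT g
  -- Any radius at or above the a priori bound would do: the truncation turns out never to act.
  set R := |K| + 1 with hR_def
  have hR : 0 < R := by positivity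
  have kid := isVolterraKernel_nsKernel hσ hσ1 hT (Q := ContinuousLinearMap.id ℝ (HSob σ))
    ContinuousLinearMap.norm_id_le (β := fun _ => 1) continuous_const (fun _ => zero_le_one)
    (fun _ => le_rfl) hR
  have kP := fun N => isVolterraKernel_nsKernel hσ hσ1 hT (norm_proj_le σ N) (β := fun _ => 1)
    continuous_const (fun _ => zero_le_one) (fun _ => le_rfl) hR
  obtain ⟨v, hv⟩ := kid.exists_solution hT g
  obtain ⟨C, hC, H⟩ := exists_dist_le_of_isVolterraKernel hT kid.integrable kid.nonneg
    (E := HSob σ)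
  have hvc : Continuous (Set.IccExtend hT v) := v.continuous.Icc_extend'
  have hvK : ∀ t, ‖v t‖ ≤ K := by
    intro t
    refine le_of_forall_pos_le_add fun ε hε => ?_
    -- Galerkin solutions y obey the a priori bound, and v solves the projected equation up to v -
    -- P_N v. Gronwall, with a constant independent of N, transfers the bound to v.
    obtain ⟨N, hN⟩ := exists_proj_close v (ε := ε / (C + 1)) (by positivity)
    obtain ⟨y, hy⟩ := (kP N).exists_solution hT
      (⟨fun t => proj σ N (g t), by fun_prop⟩ : C(Set.Icc (0 : ℝ) T, HSob σ))
    have hyK := hK N R hR y hy t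
    have hP : ∀ s : Set.Icc (0 : ℝ) T, proj σ N (v s) = proj σ N (g s) -
        volterraInt (nsKernel (proj σ N) (fun _ => 1) R) (Set.IccExtend hT v) s := by
      intro s
      rw [hv s, map_sub, volterraInt, volterraInt,
        ← ContinuousLinearMap.intervalIntegral_comp_comm _ (kid.intervalIntegrable s.2 hvc)]
      simp [nsKernel]
    have h1 := H _ (kP N) v y (ε / (C + 1)) (by positivity) (fun s => by
      have e : v s - y s = (v s - proj σ N (v s)) -
          (volterraInt (nsKernel (proj σ N) (fun _ => 1) R) (Set.IccExtend hT v) s -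
          volterraInt (nsKernel (proj σ N) (fun _ => 1) R) (Set.IccExtend hT y) s) := by
        rw [hP s, hy s]
        simp only [ContinuousMap.coe_mk]
        abel
      rw [e]
      exact (norm_sub_le _ _).trans (add_le_add_left (hN N le_rfl s) _)) t
    have h2 : C * (ε / (C + 1)) ≤ ε := by
      rw [mul_div_assoc', div_le_iff₀ (by positivity)]
      nlinarith
    calc ‖v t‖ = ‖y t + (v t - y t)‖ := by rw [add_sub_cancel]
      _ ≤ ‖y t‖ + ‖v t - y t‖ := norm_add_le _ _
      _ ≤ K + ε := by linarith
  refine ⟨v, fun t => ?_⟩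
  rw [hv t, volterraInt_mildKernel_eq hT hR _ t.2]
  exact fun s => (hvK s).trans ((le_abs_self K).trans (by linarith))

/-- A random continuous path is strongly measurable as soon as its values are. -/
theorem stronglyMeasurable_path {α E : Type*} [MeasurableSpace α] [NormedAddCommGroup E]
    [NormedSpace ℝ E] {T : ℝ} (hT : 0 < T) {g : α → C(Set.Icc (0 : ℝ) T, E)}
    (hg : ∀ t, StronglyMeasurable fun a => g a t) : StronglyMeasurable g := by
  -- On the unit interval, Bernstein approximations express a path as a limit of continuous
  -- functions of finitely many of its values.
  set e := iccHomeoI 0 T hT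
  set φ : C(unitInterval, Set.Icc (0 : ℝ) T) := ⟨e.symm, e.symm.continuous⟩
  set ψ : C(Set.Icc (0 : ℝ) T, unitInterval) := ⟨e, e.continuous⟩
  have hφψ : ∀ f : C(Set.Icc (0 : ℝ) T, E), (f.comp φ).comp ψ = f := fun f => by
    ext t
    exact congrArg f (e.symm_apply_apply t)
  have h1 : StronglyMeasurable fun a => (g a).comp φ := by
    refine stronglyMeasurable_of_tendsto Filter.atTop
      (f := fun n a => bernsteinApproximation n ((g a).comp φ)) (fun n => ?_)
      (tendsto_pi_nhds.2 fun a => bernsteinApproximation_uniform _)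
    simp only [bernsteinApproximation]
    refine Finset.stronglyMeasurable_fun_sum _ fun k _ => ?_
    have hc : Continuous fun x : E =>
        (bernstein n k • ContinuousMap.const unitInterval x : C(unitInterval, E)) := by
      refine ContinuousMap.continuous_of_continuous_uncurry _ ?_
      exact ((bernstein n k).continuous.comp continuous_snd).smul continuous_fst
    exact hc.comp_stronglyMeasurable (hg _)
  have h2 : StronglyMeasurable fun a => ((g a).comp φ).comp ψ :=
    (ContinuousMap.continuous_precomp ψ).comp_stronglyMeasurable h1
  simpa only [hφψ] using h2

/-- A solution map of the mild equation, obtained as a limit of continuous maps. -/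
theorem exists_mild_solution_map {σ : ℝ} (hσ : 0 < σ) (hσ1 : σ < 1) {T : ℝ} (hT : 0 ≤ T) :
    ∃ (S : C(Set.Icc (0 : ℝ) T, HSob σ) → C(Set.Icc (0 : ℝ) T, HSob σ))
      (Γ : ℕ → C(Set.Icc (0 : ℝ) T, HSob σ) → C(Set.Icc (0 : ℝ) T, HSob σ)),
      (∀ g, IsMild hT g (S g)) ∧ (∀ n, Continuous (Γ n)) ∧
      ∀ g, Filter.Tendsto (fun n => Γ n g) Filter.atTop (𝓝 (S g)) := by
  have ker := fun n : ℕ => isVolterraKernel_nsKernel hσ hσ1 hT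
    (Q := ContinuousLinearMap.id ℝ (HSob σ)) ContinuousLinearMap.norm_id_le (β := fun _ => 1)
    continuous_const (fun _ => zero_le_one) (fun _ => le_rfl) (R := (n : ℝ) + 1) (by positivity)
  choose Γ hΓ using fun n g => (ker n).exists_solution hT g
  choose S hS using exists_mild hσ hσ1 hT
  have hlip : ∀ n : ℕ, ∃ C : ℝ, 0 ≤ C ∧ ∀ x g y g' : C(Set.Icc (0 : ℝ) T, HSob σ),
      (∀ t : Set.Icc (0 : ℝ) T, x t = g t - volterraInt (nsKernel (ContinuousLinearMap.id ℝ _)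
        (fun _ => 1) ((n : ℝ) + 1)) (Set.IccExtend hT x) t) →
      (∀ t : Set.Icc (0 : ℝ) T, y t = g' t - volterraInt (nsKernel (ContinuousLinearMap.id ℝ _)
        (fun _ => 1) ((n : ℝ) + 1)) (Set.IccExtend hT y) t) → dist x y ≤ C * dist g g' := by
    intro n
    obtain ⟨C, hC, H⟩ := (ker n).exists_dist_le hT
    refine ⟨C, hC, fun x g y g' hx hy => ?_⟩
    rw [dist_eq_norm, dist_eq_norm, ContinuousMap.norm_le _ (by positivity)]
    refine H _ _ ‖g - g'‖ (norm_nonneg _) (fun t => ?_)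
    rw [hx t, hy t, sub_sub_sub_comm]
    exact (norm_sub_le _ _).trans (add_le_add_left ((g - g').norm_coe_le_norm t) _)
  refine ⟨S, Γ, hS, fun n => ?_, fun g => ?_⟩
  · obtain ⟨C, hC, H⟩ := hlip n
    exact LipschitzWith.continuous (K := ⟨C, hC⟩)
      (LipschitzWith.of_dist_le_mul fun g g' => H _ _ _ _ (hΓ n g) (hΓ n g'))
  -- Once the radius exceeds ‖S g‖, the path S g solves the truncated equation too, so the sequence
  -- is eventually constant.
  · obtain ⟨m, hm⟩ := exists_nat_ge ‖S g‖
    refine tendsto_const_nhds.congr' (Filter.eventually_atTop.2 ⟨m, fun n hn => ?_⟩)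
    obtain ⟨C, hC, H⟩ := hlip n
    have h1 := H (S g) g (Γ n g) g (fun t => by
      rw [hS g t, volterraInt_mildKernel_eq hT (R := (n : ℝ) + 1) (by positivity) _ t.2]
      intro s
      have : (m : ℝ) ≤ n := by exact_mod_cast hn
      linarith [(S g).norm_coe_le_norm s]) (hΓ n g)
    rw [dist_self, mul_zero] at h1
    exact dist_le_zero.1 h1

/-! ### Dyadic interpolation and Hölder continuity -/

/-- The largest dyadic number of level `n` below `t`. -/
def dyadicFloor (n : ℕ) (t : ℝ) : ℝ := (⌊2 ^ n * t⌋₊ : ℝ) / 2 ^ n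

theorem dyadicFloor_le (n : ℕ) {t : ℝ} (ht : 0 ≤ t) : dyadicFloor n t ≤ t := by
  rw [dyadicFloor, div_le_iff₀ (by positivity), mul_comm t]
  exact Nat.floor_le (by positivity)

theorem le_dyadicFloor_add (n : ℕ) (t : ℝ) : t ≤ dyadicFloor n t + (1 / 2) ^ n := by
  rw [dyadicFloor, one_div, inv_pow, ← one_div, ← add_div, le_div_iff₀ (by positivity), mul_comm t]
  exact (Nat.lt_floor_add_one _).le

@[simp] theorem dyadicFloor_zero (n : ℕ) : dyadicFloor n 0 = 0 := by simp [dyadicFloor]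

theorem tendsto_dyadicFloor {t : ℝ} (ht : 0 ≤ t) :
    Filter.Tendsto (fun n => dyadicFloor n t) Filter.atTop (𝓝 t) := by
  have h1 : Filter.Tendsto (fun n : ℕ => t - (1 / 2 : ℝ) ^ n) Filter.atTop (𝓝 (t - 0)) :=
    tendsto_const_nhds.sub (tendsto_pow_atTop_nhds_zero_of_lt_one (by norm_num) (by norm_num))
  rw [sub_zero] at h1
  exact tendsto_of_tendsto_of_tendsto_of_le_of_le h1 tendsto_const_nhds
    (fun n => by have := le_dyadicFloor_add n t; simp only; linarith)
    (fun n => dyadicFloor_le n ht)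

theorem floor_two_mul_cases {x : ℝ} (hx : 0 ≤ x) :
    ⌊2 * x⌋₊ = 2 * ⌊x⌋₊ ∨ ⌊2 * x⌋₊ = 2 * ⌊x⌋₊ + 1 := by
  have h1 := Nat.floor_le hx
  have h2 := Nat.lt_floor_add_one x
  have h3 : 2 * ⌊x⌋₊ ≤ ⌊2 * x⌋₊ := Nat.le_floor (by push_cast; linarith)
  have h4 : ⌊2 * x⌋₊ < 2 * ⌊x⌋₊ + 2 := by
    rw [Nat.floor_lt (by positivity)]; push_cast; linarith
  omega

/-- The increments of `X` over neighbouring dyadic points of `[0,1]` of level `n` are at most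
`m q^n`. -/
def DyadicBound {E : Type*} [NormedAddCommGroup E] (q m : ℝ) (X : ℝ → E) : Prop :=
  ∀ n j : ℕ, j < 2 ^ n → ‖X ((j + 1 : ℕ) / 2 ^ n) - X ((j : ℕ) / 2 ^ n)‖ ≤ m * q ^ n

section Dyadic

variable {E : Type*} [NormedAddCommGroup E] {q m : ℝ} {X : ℝ → E}

theorem DyadicBound.norm_succ_sub_le (h : DyadicBound q m X) (hm : 0 ≤ m) (hq : 0 ≤ q) {t : ℝ}
    (ht : t ∈ Set.Icc (0 : ℝ) 1) (n : ℕ) :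
    ‖X (dyadicFloor (n + 1) t) - X (dyadicFloor n t)‖ ≤ m * q ^ (n + 1) := by
  have h1 : (2 : ℝ) ^ (n + 1) * t = 2 * (2 ^ n * t) := by ring
  have h2 : dyadicFloor n t = (2 * ⌊(2 : ℝ) ^ n * t⌋₊ : ℕ) / 2 ^ (n + 1) := by
    rw [dyadicFloor, pow_succ]; push_cast; field_simp
  have hle : ⌊(2 : ℝ) ^ (n + 1) * t⌋₊ ≤ 2 ^ (n + 1) := by
    rw [← Nat.floor_natCast (R := ℝ) (2 ^ (n + 1))]
    refine Nat.floor_le_floor ?_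
    push_cast
    exact mul_le_of_le_one_right (by positivity) ht.2
  rw [h2, dyadicFloor]
  rw [h1] at hle ⊢
  rcases floor_two_mul_cases (x := 2 ^ n * t) (mul_nonneg (by positivity) ht.1) with h3 | h3
  · rw [h3, sub_self, norm_zero]; positivity
  · rw [h3] at hle ⊢
    exact h (n + 1) _ hle

theorem DyadicBound.norm_sub_le (h : DyadicBound q m X) (hm : 0 ≤ m) (hq : 0 ≤ q) {s t : ℝ}
    (hs : 0 ≤ s) (hst : s ≤ t) (ht : t ≤ 1) {n : ℕ} (hn : t - s ≤ (1 / 2) ^ n) :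
    ‖X (dyadicFloor n t) - X (dyadicFloor n s)‖ ≤ m * q ^ n := by
  have h1 : ⌊(2 : ℝ) ^ n * s⌋₊ ≤ ⌊(2 : ℝ) ^ n * t⌋₊ := Nat.floor_le_floor (by gcongr)
  have h2 : ⌊(2 : ℝ) ^ n * t⌋₊ ≤ ⌊(2 : ℝ) ^ n * s⌋₊ + 1 := by
    rw [← Nat.floor_add_one (mul_nonneg (by positivity) hs)]
    refine Nat.floor_le_floor ?_
    have h3 : (2 : ℝ) ^ n * (t - s) ≤ 2 ^ n * (1 / 2) ^ n := by gcongr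
    rw [← mul_pow] at h3
    norm_num at h3
    linarith
  have hle : ⌊(2 : ℝ) ^ n * t⌋₊ ≤ 2 ^ n := by
    rw [← Nat.floor_natCast (R := ℝ) (2 ^ n)]
    refine Nat.floor_le_floor ?_
    push_cast
    exact mul_le_of_le_one_right (by positivity) ht
  rw [dyadicFloor, dyadicFloor]
  rcases (by omega : ⌊(2 : ℝ) ^ n * t⌋₊ = ⌊(2 : ℝ) ^ n * s⌋₊ ∨
    ⌊(2 : ℝ) ^ n * t⌋₊ = ⌊(2 : ℝ) ^ n * s⌋₊ + 1) with h3 | h3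
  · rw [h3, sub_self, norm_zero]; positivity
  · rw [h3] at hle ⊢
    exact h n _ hle

/-- The continuous process read off from the values at the dyadic points of `[0,1]`. -/
def dyadicLim (X : ℝ → E) (t : ℝ) : E :=
  Filter.limUnder Filter.atTop fun n => X (dyadicFloor n t)

variable [CompleteSpace E]

theorem DyadicBound.tendsto (h : DyadicBound q m X) (hm : 0 ≤ m) (hq : 0 ≤ q) (hq1 : q < 1) {t : ℝ}
    (ht : t ∈ Set.Icc (0 : ℝ) 1) :
    Filter.Tendsto (fun n => X (dyadicFloor n t)) Filter.atTop (𝓝 (dyadicLim X t)) := by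
  refine (cauchySeq_of_le_geometric q (m * q) hq1 fun n => ?_).tendsto_limUnder
  rw [dist_comm, dist_eq_norm]
  refine (h.norm_succ_sub_le hm hq ht n).trans (le_of_eq (by ring))

theorem DyadicBound.norm_sub_dyadicLim_le (h : DyadicBound q m X) (hm : 0 ≤ m) (hq : 0 ≤ q)
    (hq1 : q < 1) {t : ℝ} (ht : t ∈ Set.Icc (0 : ℝ) 1) (n : ℕ) :
    ‖X (dyadicFloor n t) - dyadicLim X t‖ ≤ m * q * q ^ n / (1 - q) := by
  rw [← dist_eq_norm]
  refine dist_le_of_le_geometric_of_tendsto q (m * q) hq1 (fun n => ?_) (h.tendsto hm hq hq1 ht) n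
  rw [dist_comm, dist_eq_norm]
  refine (h.norm_succ_sub_le hm hq ht n).trans (le_of_eq (by ring))

/-- Take n with 2^{-(n+1)} < t - s ≤ 2^{-n}. At level n the dyadic floors are equal or adjacent, and
the passage to the limit adds two geometric tails; dividing by q turns q^{n+1} back into q^n. -/
theorem exists_holder_of_dyadicBound {α : ℝ} (hα : 0 < α) : ∃ C : ℝ, 0 ≤ C ∧
    ∀ (X : ℝ → E) (m : ℝ), 0 ≤ m → DyadicBound (2 ^ (-α)) m X → ∀ s ∈ Set.Icc (0 : ℝ) 1,
      ∀ t ∈ Set.Icc (0 : ℝ) 1, ‖dyadicLim X t - dyadicLim X s‖ ≤ C * m * |t - s| ^ α := by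
  set q : ℝ := 2 ^ (-α) with hq
  have hq0 : 0 < q := by positivity
  have hq1 : q < 1 := Real.rpow_lt_one_of_one_lt_of_neg (by norm_num) (by linarith)
  have h1q : 0 < 1 - q := by linarith
  have hC : 0 ≤ (1 + 2 * (q / (1 - q))) / q := by positivity
  refine ⟨(1 + 2 * (q / (1 - q))) / q, hC, fun X m hm h => ?_⟩
  have main : ∀ s t : ℝ, 0 ≤ s → s < t → t ≤ 1 →
      ‖dyadicLim X t - dyadicLim X s‖ ≤ (1 + 2 * (q / (1 - q))) / q * m * |t - s| ^ α := by
    intro s t hs hst ht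
    obtain ⟨n, hn1, hn2⟩ := exists_nat_pow_near_of_lt_one (x := t - s) (y := (1 / 2 : ℝ))
      (by linarith) (by linarith) (by norm_num) (by norm_num)
    have a1 := h.norm_sub_le hm hq0.le hs hst.le ht hn2
    have a2 := h.norm_sub_dyadicLim_le hm hq0.le hq1 (t := s) ⟨hs, hst.le.trans ht⟩ n
    have a3 := h.norm_sub_dyadicLim_le hm hq0.le hq1 (t := t) ⟨hs.trans hst.le, ht⟩ n
    have e : dyadicLim X t - dyadicLim X s = (X (dyadicFloor n t) - X (dyadicFloor n s)) -
      (X (dyadicFloor n t) - dyadicLim X t) + (X (dyadicFloor n s) - dyadicLim X s) := by abel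
    have a4 : ‖dyadicLim X t - dyadicLim X s‖ ≤ m * q ^ n * (1 + 2 * (q / (1 - q))) := by
      rw [e]
      refine (norm_add_le _ _).trans ((add_le_add_left (norm_sub_le _ _) _).trans ?_)
      calc _ ≤ m * q ^ n + m * q * q ^ n / (1 - q) + m * q * q ^ n / (1 - q) := by linarith
        _ = _ := by ring
    have a5 : q ^ (n + 1) ≤ |t - s| ^ α := by
      have e1 : q ^ (n + 1) = ((1 / 2 : ℝ) ^ (n + 1)) ^ α := by
        rw [hq, ← Real.rpow_natCast, ← Real.rpow_mul (by norm_num), ← Real.rpow_natCast (1 / 2),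
          ← Real.rpow_mul (by norm_num), one_div, Real.inv_rpow (by norm_num),
          ← Real.rpow_neg (by norm_num)]
        congr 1; ring
      rw [e1, abs_of_pos (by linarith)]
      exact Real.rpow_le_rpow (by positivity) hn1.le hα.le
    calc _ ≤ m * q ^ n * (1 + 2 * (q / (1 - q))) := a4
      _ = (1 + 2 * (q / (1 - q))) / q * m * q ^ (n + 1) := by rw [pow_succ]; field_simp
      _ ≤ _ := by gcongr
  intro s hs t ht
  rcases lt_trichotomy s t with hst | hst | hst
  · exact main s t hs.1 hst ht.2
  · rw [hst, sub_self, norm_zero]; positivity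
  · rw [norm_sub_rev, abs_sub_comm]
    exact main t s ht.1 hst hs.2

end Dyadic

/-! ### Moments of fractional Brownian motion -/

/-- An increment is centered Gaussian with variance |t-s|^{2H}, so its moments are scaled standard
Gaussian moments and the constant is shared by all modes. -/
theorem exists_lintegral_fbm_le {Ω : Type*} [MeasurableSpace Ω] {μ : Measure Ω}
    [IsProbabilityMeasure μ] {H : ℝ} (hH : 0 < H) (p : ℕ) : ∃ C : ℝ≥0∞, C < ∞ ∧
      ∀ X : ℝ → Ω → ℝ, IsFractionalBrownian H X μ → ∀ s t,
        ∫⁻ ω, ‖X t ω - X s ω‖ₑ ^ p ∂μ ≤ C * ENNReal.ofReal (|t - s| ^ (p * H)) := by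
  refine ⟨∫⁻ x, ‖x‖ₑ ^ p ∂(gaussianReal 0 1), ?_, fun X hX s t => le_of_eq ?_⟩
  · have h1 := (memLp_id_gaussianReal (μ := 0) (v := 1) p).eLpNorm_lt_top
    rcases Nat.eq_zero_or_pos p with rfl | hp
    · simp
    · rw [eLpNorm_lt_top_iff_lintegral_rpow_enorm_lt_top (by simpa using hp.ne') (by simp)] at h1
      simpa using h1
  have hlaw := hX.gaussian.hasGaussianLaw_sub (s := t) (t := s)
  have hmeas : Measurable (X t - X s) := (hX.measurable t).sub (hX.measurable s)
  have hm := fun r => (hX.gaussian.hasGaussianLaw_eval r).memLp_two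
  have hmean : ∫ ω, (X t - X s) ω ∂μ = 0 := by
    simp only [Pi.sub_apply]
    rw [integral_sub ((hm t).integrable (by norm_num)) ((hm s).integrable (by norm_num)),
      hX.centered, hX.centered, sub_zero]
  have hvar : Var[X t - X s; μ] = |t - s| ^ (2 * H) := by
    rw [variance_sub (hm t) (hm s), ← covariance_self (hX.measurable t).aemeasurable,
      ← covariance_self (hX.measurable s).aemeasurable, hX.covariance, hX.covariance, hX.covariance,
      sub_self, sub_self, abs_zero, Real.zero_rpow (by positivity)]
    ring
  have hmap := hlaw.map_eq_gaussianReal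
  rw [hmean, hvar] at hmap
  have hscale : gaussianReal 0 (|t - s| ^ (2 * H)).toNNReal =
      (gaussianReal 0 1).map (|t - s| ^ H * ·) := by
    rw [gaussianReal_map_const_mul, mul_zero, mul_one]
    congr 1
    ext
    rw [Real.coe_toNNReal _ (by positivity), NNReal.coe_mk, ← Real.rpow_natCast, ← Real.rpow_mul (abs_nonneg _)]
    congr 1; push_cast; ring
  calc ∫⁻ ω, ‖X t ω - X s ω‖ₑ ^ p ∂μ = ∫⁻ x, ‖x‖ₑ ^ p ∂(μ.map (X t - X s)) := by
        rw [lintegral_map (by fun_prop) hmeas]; rfl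
    _ = ∫⁻ x, ‖|t - s| ^ H * x‖ₑ ^ p ∂(gaussianReal 0 1) := by
        rw [hmap, hscale, lintegral_map (by fun_prop) (by fun_prop)]
    _ = _ := by
        simp_rw [enorm_mul, mul_pow]
        rw [lintegral_const_mul _ (by fun_prop), mul_comm]
        congr 1
        rw [Real.enorm_of_nonneg (by positivity), ← ENNReal.ofReal_pow (by positivity),
          ← Real.rpow_natCast, ← Real.rpow_mul (abs_nonneg _), mul_comm H]

/-! ### A Hölder continuous version of the noise -/

/-- The random constant in Kolmogorov's continuity criterion. -/
def dyadicSum (α : ℝ) (p : ℕ) (X : ℝ → ℂ) : ℝ≥0∞ :=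
  ∑' n : ℕ, ENNReal.ofReal (2 ^ (α * p)) ^ n *
    ∑ j ∈ Finset.range (2 ^ n), ‖X ((j + 1 : ℕ) / 2 ^ n) - X ((j : ℕ) / 2 ^ n)‖ₑ ^ p

theorem two_rpow_neg_pow (α : ℝ) (n : ℕ) : ((2 : ℝ) ^ (-α)) ^ n = ((2 : ℝ) ^ (α * n))⁻¹ := by
  rw [← Real.rpow_natCast, ← Real.rpow_mul (by norm_num), neg_mul, Real.rpow_neg (by norm_num)]

theorem dyadicBound_of_dyadicSum {α : ℝ} {p : ℕ} (hp : p ≠ 0) {X : ℝ → ℂ}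
    (h : dyadicSum α p X ≠ ∞) :
    DyadicBound (2 ^ (-α)) ((dyadicSum α p X).toReal ^ (p⁻¹ : ℝ)) X := by
  intro n j hj
  set x := X ((j + 1 : ℕ) / 2 ^ n) - X ((j : ℕ) / 2 ^ n) with hx
  have h1 : ENNReal.ofReal (2 ^ (α * p)) ^ n * ‖x‖ₑ ^ p ≤ dyadicSum α p X := by
    refine le_trans ?_ (ENNReal.le_tsum n)
    gcongr
    exact Finset.single_le_sum (f := fun j : ℕ =>
      ‖X ((j + 1 : ℕ) / 2 ^ n) - X ((j : ℕ) / 2 ^ n)‖ₑ ^ p) (fun _ _ => zero_le)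
      (Finset.mem_range.2 hj)
  have h2 : ((2 : ℝ) ^ (α * p)) ^ n * ‖x‖ ^ p ≤ (dyadicSum α p X).toReal := by
    have := ENNReal.toReal_mono h h1
    rwa [ENNReal.toReal_mul, ENNReal.toReal_pow, ENNReal.toReal_pow,
      ENNReal.toReal_ofReal (by positivity), toReal_enorm] at this
  have h3 : ((2 : ℝ) ^ (α * p)) ^ n * ‖x‖ ^ p = (((2 : ℝ) ^ (α * n)) * ‖x‖) ^ p := by
    rw [mul_pow, ← Real.rpow_natCast, ← Real.rpow_natCast (2 ^ (α * n)),
      ← Real.rpow_mul (by norm_num), ← Real.rpow_mul (by norm_num)]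
    congr 2; ring
  rw [h3] at h2
  have h4 : (2 : ℝ) ^ (α * n) * ‖x‖ ≤ (dyadicSum α p X).toReal ^ (p⁻¹ : ℝ) := by
    have := Real.rpow_le_rpow (by positivity) h2 (by positivity : (0 : ℝ) ≤ (p : ℝ)⁻¹)
    rwa [Real.pow_rpow_inv_natCast (by positivity) hp] at this
  rw [two_rpow_neg_pow, ← div_eq_mul_inv, le_div_iff₀ (by positivity), mul_comm]
  exact h4

theorem neg_notMem_halfLattice {k : ℤ × ℤ} (hk : k ∈ halfLattice) : -k ∉ halfLattice := by
  simp only [halfLattice, Set.mem_ofPred_eq, Prod.fst_neg, Prod.snd_neg] at hk ⊢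
  omega

theorem cylNoise_neg {Ω : Type*} (b : halfLattice → ℝ → Ω → ℂ) (t : ℝ) (ω : Ω) (k : ℤ × ℤ) :
    cylNoise b t ω (-k) = -conj (cylNoise b t ω k) := by
  unfold cylNoise
  by_cases h1 : k ∈ halfLattice
  · rw [dif_neg (neg_notMem_halfLattice h1), dif_pos h1, dif_pos (by rwa [neg_neg])]
    simp only [neg_neg]
  · by_cases h2 : -k ∈ halfLattice
    · rw [dif_pos h2, dif_neg h1, dif_pos h2]
      simp
    · rw [dif_neg h2, dif_neg h1, dif_neg h2, dif_neg (by rwa [neg_neg])]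
      simp

theorem cylNoise_zero {Ω : Type*} (b : halfLattice → ℝ → Ω → ℂ) (t : ℝ) (ω : Ω) : cylNoise b t ω 0 = 0 := by
  have h : (0 : ℤ × ℤ) ∉ halfLattice := by simp [halfLattice]
  rw [cylNoise, dif_neg h, dif_neg (by rwa [neg_zero])]

section Noise

variable {Ω : Type*} [MeasurableSpace Ω] {μ : Measure Ω}

theorem measurable_dyadicSum (α : ℝ) (p : ℕ) {X : ℝ → Ω → ℂ} (hX : ∀ t, Measurable (X t)) :
    Measurable fun ω => dyadicSum α p fun t => X t ω := by
  unfold dyadicSum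
  fun_prop

/-- Level n has 2^n increments, each with moment of order 2^{-npH}, so the weighted sum is geometric
with ratio 2^{αp+1-pH} < 1. -/
theorem exists_lintegral_dyadicSum_le {α H : ℝ} {p : ℕ} (hp : 1 < p * (H - α)) :
    ∃ C : ℝ≥0∞, C < ∞ ∧ ∀ (X : ℝ → Ω → ℂ) (c : ℝ≥0∞), (∀ t, Measurable (X t)) →
      (∀ s t, ∫⁻ ω, ‖X t ω - X s ω‖ₑ ^ p ∂μ ≤ c * ENNReal.ofReal (|t - s| ^ (p * H))) →
      ∫⁻ ω, dyadicSum α p (fun t => X t ω) ∂μ ≤ c * C := by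
  set r : ℝ := 2 ^ (α * p + 1 - p * H) with hr
  have hr1 : r < 1 := Real.rpow_lt_one_of_one_lt_of_neg (by norm_num) (by linarith)
  refine ⟨∑' n : ℕ, ENNReal.ofReal r ^ n, ?_, fun X c hX hc => ?_⟩
  · rw [ENNReal.tsum_geometric, ENNReal.inv_lt_top, tsub_pos_iff_lt]
    exact ENNReal.ofReal_lt_one.2 hr1
  · unfold dyadicSum
    rw [lintegral_tsum (by fun_prop), ← ENNReal.tsum_mul_left]
    refine ENNReal.tsum_le_tsum fun n => ?_
    rw [lintegral_const_mul _ (by fun_prop), lintegral_finsetSum _ (by fun_prop)]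
    have h1 : ∀ j ∈ Finset.range (2 ^ n), ∫⁻ ω, ‖X ((j + 1 : ℕ) / 2 ^ n) ω -
        X ((j : ℕ) / 2 ^ n) ω‖ₑ ^ p ∂μ ≤ c * ENNReal.ofReal ((2 ^ (p * H))⁻¹ ^ n) := by
      intro j _
      refine (hc _ _).trans (le_of_eq ?_)
      congr 2
      push_cast
      rw [← sub_div, add_sub_cancel_left, abs_of_pos (by positivity), one_div,
        Real.inv_rpow (by positivity), inv_pow, ← Real.rpow_natCast, ← Real.rpow_natCast,
        ← Real.rpow_mul (by norm_num), ← Real.rpow_mul (by norm_num), mul_comm]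
    refine (mul_le_mul_right (Finset.sum_le_sum h1) _).trans (le_of_eq ?_)
    rw [Finset.sum_const, Finset.card_range, nsmul_eq_mul, Nat.cast_pow, mul_left_comm _ c, mul_left_comm _ c,
      ← ENNReal.ofReal_pow (by positivity), Nat.cast_ofNat,
      show (2 : ℝ≥0∞) = ENNReal.ofReal 2 by simp, ← ENNReal.ofReal_pow (by positivity),
      ← ENNReal.ofReal_pow (by positivity), ← ENNReal.ofReal_mul (by positivity),
      ← ENNReal.ofReal_mul (by positivity), ← mul_pow, ← mul_pow]
    congr 3
    rw [hr, Real.rpow_sub (by norm_num), Real.rpow_add (by norm_num), Real.rpow_one]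
    ring

theorem enorm_complex_pow_le (z : ℂ) (p : ℕ) : ‖z‖ₑ ^ p ≤ 2 ^ p * (‖z.re‖ₑ ^ p + ‖z.im‖ₑ ^ p) := by
  have h1 : ‖z‖ₑ ≤ ‖z.re‖ₑ + ‖z.im‖ₑ := by
    rw [← ofReal_norm, ← ofReal_norm, ← ofReal_norm,
      ← ENNReal.ofReal_add (norm_nonneg _) (norm_nonneg _)]
    exact ENNReal.ofReal_le_ofReal (Complex.norm_le_abs_re_add_abs_im z)
  have h2 : ‖z‖ₑ ≤ 2 * max ‖z.re‖ₑ ‖z.im‖ₑ := by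
    rw [two_mul]
    exact h1.trans (add_le_add (le_max_left _ _) (le_max_right _ _))
  refine (pow_le_pow_left' h2 p).trans ?_
  rw [mul_pow]
  gcongr
  rcases max_cases ‖z.re‖ₑ ‖z.im‖ₑ with h | h <;> rw [h.1]
  · exact le_self_add
  · exact le_add_self

theorem exists_lintegral_cylNoise_le [IsProbabilityMeasure μ] {H : ℝ} (hH : 0 < H)
    {b : halfLattice → ℝ → Ω → ℂ} (hb : IsComplexFBMFamily H b μ) {p : ℕ} (hp : p ≠ 0) :
    ∃ C : ℝ≥0∞, C < ∞ ∧ ∀ k s t, ∫⁻ ω, ‖cylNoise b t ω k - cylNoise b s ω k‖ₑ ^ p ∂μ ≤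
      C * ENNReal.ofReal (|t - s| ^ (p * H)) := by
  obtain ⟨C, hC, h⟩ := exists_lintegral_fbm_le (μ := μ) hH p
  have key : ∀ (k : halfLattice) (s t : ℝ), ∫⁻ ω, ‖b k t ω - b k s ω‖ₑ ^ p ∂μ ≤
      2 ^ p * (C + C) * ENNReal.ofReal (|t - s| ^ (p * H)) := by
    intro k s t
    calc ∫⁻ ω, ‖b k t ω - b k s ω‖ₑ ^ p ∂μ
        ≤ ∫⁻ ω, 2 ^ p * (‖(b k t ω).re - (b k s ω).re‖ₑ ^ p +
          ‖(b k t ω).im - (b k s ω).im‖ₑ ^ p) ∂μ :=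
          lintegral_mono fun ω => enorm_complex_pow_le _ p
      _ ≤ 2 ^ p * (C * ENNReal.ofReal (|t - s| ^ (p * H)) +
          C * ENNReal.ofReal (|t - s| ^ (p * H))) := by
        have m1 := fun r => (hb.fbm_re k).measurable r
        have m2 := fun r => (hb.fbm_im k).measurable r
        rw [lintegral_const_mul _ (by fun_prop), lintegral_add_left (by fun_prop)]
        gcongr
        · exact h _ (hb.fbm_re k) s t
        · exact h _ (hb.fbm_im k) s t
      _ = _ := by ring
  refine ⟨2 ^ p * (C + C), ENNReal.mul_lt_top (by simp) (ENNReal.add_lt_top.2 ⟨hC, hC⟩),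
    fun k s t => ?_⟩
  unfold cylNoise
  split_ifs with h1 h2
  · exact key _ s t
  · refine le_trans (le_of_eq (lintegral_congr fun ω => ?_)) (key ⟨-k, h2⟩ s t)
    rw [← enorm_neg, ← neg_sub', neg_neg, ← map_sub]
    congr 1
    rw [← ofReal_norm, ← ofReal_norm, Complex.norm_conj]
  · simp [hp]

theorem measurable_cylNoise {H : ℝ} {b : halfLattice → ℝ → Ω → ℂ} (hb : IsComplexFBMFamily H b μ)
    (k : ℤ × ℤ) (t : ℝ) : Measurable fun ω => cylNoise b t ω k := by
  have key : ∀ k, Measurable (b k t) := fun k =>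
    measurable_of_re_im (𝕜 := ℂ) ((hb.fbm_re k).measurable t) ((hb.fbm_im k).measurable t)
  unfold cylNoise
  split_ifs with h1 h2
  · exact key _
  · exact (Complex.continuous_conj.measurable.comp (key _)).neg
  · exact measurable_const

theorem cylNoise_time_zero [IsProbabilityMeasure μ] {H : ℝ} (hH : 0 < H)
    {b : halfLattice → ℝ → Ω → ℂ} (hb : IsComplexFBMFamily H b μ) (k : ℤ × ℤ) :
    ∀ᵐ ω ∂μ, cylNoise b 0 ω k = 0 := by
  have real : ∀ X : ℝ → Ω → ℝ, IsFractionalBrownian H X μ → ∀ᵐ ω ∂μ, X 0 ω = 0 := by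
    intro X hX
    have h1 := hX.covariance 0 0
    rw [covariance_self (hX.measurable 0).aemeasurable, sub_self, abs_zero,
      Real.zero_rpow (by positivity)] at h1
    norm_num at h1
    have hm := (hX.gaussian.hasGaussianLaw_eval 0).memLp_two
    have h2 := (evariance_eq_zero_iff (hX.measurable 0).aemeasurable).1
      (by rw [← hm.ofReal_variance_eq, h1, ENNReal.ofReal_zero])
    filter_upwards [h2] with ω hω
    rw [hω, hX.centered 0]
  have key : ∀ k, ∀ᵐ ω ∂μ, b k 0 ω = 0 := fun k => by
    filter_upwards [real _ (hb.fbm_re k), real _ (hb.fbm_im k)] with ω h1 h2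
    exact Complex.ext h1 h2
  unfold cylNoise
  split_ifs with h1 h2
  · exact key _
  · filter_upwards [key ⟨-k, h2⟩] with ω hω
    rw [hω]; simp
  · simp

end Noise

theorem continuous_of_holder {E : Type*} [NormedAddCommGroup E] {f : ℝ → E} {a α : ℝ} (hα : 0 < α)
    (h : ∀ s t, ‖f t - f s‖ ≤ a * |t - s| ^ α) : Continuous f := by
  rw [continuous_iff_continuousAt]
  intro s
  rw [ContinuousAt, tendsto_iff_norm_sub_tendsto_zero]
  have h1 : Continuous fun t : ℝ => a * |t - s| ^ α :=
    continuous_const.mul ((by fun_prop : Continuous fun t : ℝ => |t - s|).rpow_const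
      fun _ => Or.inr hα.le)
  have h2 := h1.tendsto s
  rw [sub_self, abs_zero, Real.zero_rpow hα.ne', mul_zero] at h2
  exact squeeze_zero (fun t => norm_nonneg _) (fun t => h s t) h2

/-- `B` is a version of the noise with Hölder continuous coefficients, whose Hölder constants are
square summable with a weight. -/
structure IsRegularPath (α σ : ℝ) (B : ℤ × ℤ → ℝ → ℂ) : Prop where
  neg : ∀ k t, B (-k) t = -conj (B k t)
  zero : ∀ t, B 0 t = 0
  initial : ∀ k, B k 0 = 0
  holder : ∃ a : ℤ × ℤ → ℝ, (∀ k, 0 ≤ a k) ∧ (∀ k s t, ‖B k t - B k s‖ ≤ a k * |t - s| ^ α) ∧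
    Summable fun k => modeNorm k ^ (2 * σ - 4 * α) * a k ^ 2

/-- Fatou's lemma along dyadic times: the p-th moment of the difference is at most a limit of
moments of vanishing increments. -/
theorem ae_dyadicLim_eq {Ω : Type*} [MeasurableSpace Ω] {μ : Measure Ω} {p : ℕ} (hp : p ≠ 0)
    {H : ℝ} (hH : 0 < H) {c : ℝ≥0∞} (hc : c < ∞) {Y : ℝ → Ω → ℂ} (hY : ∀ t, Measurable (Y t))
    (hm : ∀ s t, ∫⁻ ω, ‖Y t ω - Y s ω‖ₑ ^ p ∂μ ≤ c * ENNReal.ofReal (|t - s| ^ (p * H)))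
    {u : ℝ} (hu : 0 ≤ u) {Z : Ω → ℂ} (hZ : Measurable Z)
    (hlim : ∀ᵐ ω ∂μ, Filter.Tendsto (fun n => Y (dyadicFloor n u) ω) Filter.atTop (𝓝 (Z ω))) :
    ∀ᵐ ω ∂μ, Z ω = Y u ω := by
  have h0 : ∫⁻ ω, ‖Z ω - Y u ω‖ₑ ^ p ∂μ = 0 := by
    refine le_antisymm ?_ zero_le
    have h1 : ∫⁻ ω, ‖Z ω - Y u ω‖ₑ ^ p ∂μ ≤
        ∫⁻ ω, Filter.liminf (fun n => ‖Y (dyadicFloor n u) ω - Y u ω‖ₑ ^ p) Filter.atTop ∂μ := by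
      refine lintegral_mono_ae ?_
      filter_upwards [hlim] with ω hω
      have h2 : Filter.Tendsto (fun n => ‖Y (dyadicFloor n u) ω - Y u ω‖ₑ ^ p) Filter.atTop
          (𝓝 (‖Z ω - Y u ω‖ₑ ^ p)) :=
        ((ENNReal.continuous_pow p).tendsto _).comp
          ((continuous_enorm.tendsto _).comp (hω.sub_const _))
      exact h2.liminf_eq.ge
    refine h1.trans ((lintegral_liminf_le fun n => by fun_prop).trans ?_)
    have h3 : Filter.Tendsto (fun n => c * ENNReal.ofReal (|dyadicFloor n u - u| ^ (p * H)))
        Filter.atTop (𝓝 0) := by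
      have h4 : Filter.Tendsto (fun n => |dyadicFloor n u - u| ^ (p * H)) Filter.atTop (𝓝 0) := by
        have h5 := ((tendsto_dyadicFloor hu).sub_const u).abs.rpow_const (p := p * H)
          (Or.inr (by positivity))
        rwa [sub_self, abs_zero, Real.zero_rpow (by positivity)] at h5
      have h6 := ENNReal.Tendsto.const_mul (ENNReal.tendsto_ofReal h4) (Or.inr hc.ne)
      rwa [ENNReal.ofReal_zero, mul_zero] at h6
    rw [← h3.liminf_eq]
    exact Filter.liminf_le_liminf (Filter.Eventually.of_forall fun n => hm _ _)
  rw [lintegral_eq_zero_iff (by fun_prop)] at h0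
  filter_upwards [h0] with ω hω
  have h1 : ‖Z ω - Y u ω‖ₑ = 0 := (pow_eq_zero_iff hp).1 hω
  rwa [enorm_eq_zero, sub_eq_zero] at h1

/-- Kolmogorov's criterion for all modes at once: the random constants have means bounded uniformly
in k, so their sum against the summable weight has finite mean and is finite almost surely. -/
theorem exists_regular_version {Ω : Type*} [MeasurableSpace Ω] {μ : Measure Ω} {X : ℝ → Ω → ℤ × ℤ → ℂ}
    (hX : ∀ k t, Measurable fun ω => X t ω k) {H α σ : ℝ} (hα : 0 < α) (hαH : α < H)
    (hασ : 1 + σ < 2 * α)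
    (hm : ∀ p : ℕ, p ≠ 0 → ∃ C : ℝ≥0∞, C < ∞ ∧ ∀ k s t, ∫⁻ ω, ‖X t ω k - X s ω k‖ₑ ^ p ∂μ ≤
      C * ENNReal.ofReal (|t - s| ^ (p * H)))
    (hneg : ∀ t ω k, X t ω (-k) = -conj (X t ω k)) (hzero : ∀ t ω, X t ω 0 = 0)
    (hinit : ∀ k, ∀ᵐ ω ∂μ, X 0 ω k = 0) {T : ℝ} (hT : 0 < T) [IsProbabilityMeasure μ] :
    ∃ B : Ω → ℤ × ℤ → ℝ → ℂ, (∀ ω, IsRegularPath α σ (B ω)) ∧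
      (∀ k t, Measurable fun ω => B ω k t) ∧
      ∀ k, ∀ t ∈ Set.Icc 0 T, ∀ᵐ ω ∂μ, B ω k t = X t ω k := by
  -- The bound 1/(H-α) is for Kolmogorov's criterion; p > 2 lets M^{2/p} be dominated by 1 + M.
  obtain ⟨p, hp⟩ : ∃ p : ℕ, max 2 (1 / (H - α)) < p := exists_nat_gt _
  have hp2 : (2 : ℝ) < p := (le_max_left _ _).trans_lt hp
  have hp0 : p ≠ 0 := by rintro rfl; norm_num at hp2
  have hpH : 1 < p * (H - α) := by
    rw [← div_lt_iff₀ (by linarith)]; exact (le_max_right _ _).trans_lt hp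
  obtain ⟨C, hC, hmom⟩ := hm p hp0
  obtain ⟨D, hD, hsum⟩ := exists_lintegral_dyadicSum_le (μ := μ) hpH
  obtain ⟨A, hA, hhol⟩ := exists_holder_of_dyadicBound (E := ℂ) hα
  set Y : ℤ × ℤ → ℝ → Ω → ℂ := fun k u ω => X (T * u) ω k with hY
  have hYm : ∀ k u, Measurable (Y k u) := fun k u => hX k _
  set c : ℝ≥0∞ := C * ENNReal.ofReal (T ^ (p * H)) with hc_def
  have hc : c < ∞ := ENNReal.mul_lt_top hC ENNReal.ofReal_lt_top
  have hYmom : ∀ k s t, ∫⁻ ω, ‖Y k t ω - Y k s ω‖ₑ ^ p ∂μ ≤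
      c * ENNReal.ofReal (|t - s| ^ (p * H)) := by
    intro k s t
    refine (hmom k _ _).trans (le_of_eq ?_)
    rw [hc_def, mul_assoc, ← ENNReal.ofReal_mul (by positivity), ← mul_sub, abs_mul, abs_of_pos hT,
      Real.mul_rpow hT.le (abs_nonneg _)]
  set M : ℤ × ℤ → Ω → ℝ≥0∞ := fun k ω => dyadicSum α p fun t => Y k t ω with hM
  have hMm : ∀ k, Measurable (M k) := fun k => measurable_dyadicSum α p (hYm k)
  set w : ℤ × ℤ → ℝ≥0∞ := fun k => ENNReal.ofReal (modeNorm k ^ (2 * σ - 4 * α)) with hw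
  have hwsum : ∑' k, w k < ∞ := by
    have h1 := summable_modeNorm_rpow (s := 4 * α - 2 * σ) (by linarith)
    simp only [neg_sub] at h1
    exact (ENNReal.tsum_coe_ne_top_iff_summable_coe.2 (by
      simpa [Real.coe_toNNReal _ (Real.rpow_nonneg (modeNorm_nonneg _) _)] using h1)).lt_top
  -- A measurable event of full measure. Off it the version is set to 0, so that every path is
  -- regular.
  set G : Set Ω := {ω | ∑' k, w k * (1 + M k ω) < ∞} ∩ {ω | ∀ k, X 0 ω k = 0} with hG
  have hGm : MeasurableSet G := by
    refine (measurableSet_lt (by fun_prop) measurable_const).inter ?_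
    rw [Set.ofPred_forall]
    exact MeasurableSet.iInter fun k => (hX k 0) (measurableSet_singleton 0)
  have hGae : ∀ᵐ ω ∂μ, ω ∈ G := by
    have h1 : ∀ᵐ ω ∂μ, ∑' k, w k * (1 + M k ω) < ∞ := by
      refine ae_lt_top (by fun_prop) ?_
      rw [lintegral_tsum (by fun_prop)]
      refine ne_of_lt (lt_of_le_of_lt (b := (∑' k, w k) * (1 + c * D)) ?_
        (ENNReal.mul_lt_top hwsum (ENNReal.add_lt_top.2 ⟨by simp, ENNReal.mul_lt_top hc hD⟩)))
      rw [← ENNReal.tsum_mul_right]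
      refine ENNReal.tsum_le_tsum fun k => ?_
      rw [lintegral_const_mul _ (by fun_prop), lintegral_add_left (by fun_prop)]
      gcongr
      · simp
      · exact hsum (Y k) c (hYm k) (hYmom k)
    filter_upwards [h1, ae_all_iff.2 hinit] with ω h2 h3
    exact ⟨h2, h3⟩
  have hfin : ∀ ω ∈ G, ∀ k, M k ω ≠ ∞ := by
    intro ω hω k
    -- The weight vanishes at the zero mode, so finiteness of the sum says nothing there; the noise
    -- itself vanishes.
    by_cases hk : k = 0
    · subst hk
      simp [hM, hY, hzero, dyadicSum, hp0]
    · have h1 : w k * (1 + M k ω) ≠ ∞ := ((ENNReal.le_tsum k).trans_lt hω.1).ne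
      intro h2
      refine h1 ?_
      rw [h2, add_top, ENNReal.mul_top]
      rw [hw, ne_eq, ENNReal.ofReal_eq_zero, not_le]
      exact Real.rpow_pos_of_pos (modeNorm_pos hk) _
  set m : ℤ × ℤ → Ω → ℝ := fun k ω => (M k ω).toReal ^ (p⁻¹ : ℝ) with hm_def
  have hm0 : ∀ k ω, 0 ≤ m k ω := fun k ω => by positivity
  have hdy : ∀ ω ∈ G, ∀ k, DyadicBound (2 ^ (-α)) (m k ω) (fun t => Y k t ω) :=
    fun ω hω k => dyadicBound_of_dyadicSum hp0 (hfin ω hω k)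
  have hq1 : (2 : ℝ) ^ (-α) < 1 := Real.rpow_lt_one_of_one_lt_of_neg (by norm_num) (by linarith)
  have hq0 : (0 : ℝ) ≤ 2 ^ (-α) := by positivity
  -- Rescaling [0,T] to [0,1] and freezing outside gives Hölder bounds on the whole line.
  set τ : ℝ → ℝ := fun t => Set.projIcc (0 : ℝ) 1 zero_le_one (t / T) with hτ
  have hτ1 : ∀ t, τ t ∈ Set.Icc (0 : ℝ) 1 := fun t => Subtype.coe_prop _
  have hτ0 : τ 0 = 0 := by simp [hτ]
  have hτs : ∀ s t, |τ t - τ s| ≤ |t - s| / T := fun s t => by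
    refine (Set.abs_projIcc_sub_projIcc _).trans (le_of_eq ?_)
    rw [← sub_div, abs_div, abs_of_pos hT]
  classical
  set B : Ω → ℤ × ℤ → ℝ → ℂ := fun ω k t =>
    if ω ∈ G then dyadicLim (fun t => Y k t ω) (τ t) else 0 with hB
  have hlim : ∀ ω ∈ G, ∀ k t, Filter.Tendsto (fun n => Y k (dyadicFloor n (τ t)) ω) Filter.atTop
      (𝓝 (B ω k t)) := by
    intro ω hω k t
    simp only [hB, if_pos hω]
    exact (hdy ω hω k).tendsto (hm0 k ω) hq0 hq1 (hτ1 t)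
  have hBm : ∀ k t, Measurable fun ω => B ω k t := by
    intro k t
    refine measurable_of_tendsto_metrizable
      (f := fun n ω => if ω ∈ G then Y k (dyadicFloor n (τ t)) ω else 0)
      (fun n => Measurable.ite hGm (hYm _ _) measurable_const) (tendsto_pi_nhds.2 fun ω => ?_)
    by_cases hω : ω ∈ G
    · simp only [if_pos hω]; exact hlim ω hω k t
    · simp only [hB, if_neg hω]; exact tendsto_const_nhds
  refine ⟨B, fun ω => ?_, hBm, fun k t ht => ?_⟩
  · by_cases hω : ω ∈ G
    · refine ⟨fun k t => ?_, fun t => ?_, fun k => ?_, fun k => A * T ^ (-α) * m k ω, fun k => ?_,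
        fun k s t => ?_, ?_⟩
      · refine tendsto_nhds_unique (hlim ω hω (-k) t) ?_
        simp only [hY, hneg]
        exact ((Complex.continuous_conj.tendsto _).comp (hlim ω hω k t)).neg
      · refine tendsto_nhds_unique (hlim ω hω 0 t) ?_
        simp only [hY, hzero]
        exact tendsto_const_nhds
      · refine tendsto_nhds_unique (hlim ω hω k 0) ?_
        simp only [hτ0, dyadicFloor_zero, hY, mul_zero, hω.2 k]
        exact tendsto_const_nhds
      · have := hm0 k ω
        positivity
      · simp only [hB, if_pos hω]
        refine (hhol _ _ (hm0 k ω) (hdy ω hω k) _ (hτ1 s) _ (hτ1 t)).trans ?_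
        have h1 := Real.rpow_le_rpow (abs_nonneg _) (hτs s t) hα.le
        rw [Real.div_rpow (abs_nonneg _) hT.le, div_eq_mul_inv, ← Real.rpow_neg hT.le] at h1
        have h2 := hm0 k ω
        calc _ ≤ A * m k ω * (|t - s| ^ α * T ^ (-α)) := by gcongr
          _ = _ := by ring
      · have h1 : Summable fun k => modeNorm k ^ (2 * σ - 4 * α) * (1 + (M k ω).toReal) := by
          have h2 := ENNReal.summable_toReal hω.1.ne
          refine h2.congr fun k => ?_
          rw [ENNReal.toReal_mul, hw,
            ENNReal.toReal_ofReal (Real.rpow_nonneg (modeNorm_nonneg k) _),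
            ENNReal.toReal_add (by simp) (hfin ω hω k), ENNReal.toReal_one]
        refine Summable.of_nonneg_of_le (fun k => ?_) (fun k => ?_)
          (h1.mul_left ((A * T ^ (-α)) ^ 2))
        · exact mul_nonneg (Real.rpow_nonneg (modeNorm_nonneg k) _) (sq_nonneg _)
        · have h3 : m k ω ^ 2 ≤ 1 + (M k ω).toReal := by
            set x := (M k ω).toReal with hx
            have hx0 : 0 ≤ x := ENNReal.toReal_nonneg
            have e : m k ω ^ 2 = x ^ (2 / p : ℝ) := by
              rw [hm_def, ← Real.rpow_natCast, ← Real.rpow_mul hx0]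
              congr 1; push_cast; ring
            have h2p : (2 / p : ℝ) ≤ 1 := by
              rw [div_le_one (by linarith)]; exact hp2.le
            rw [e]
            rcases le_total x 1 with h | h
            · exact (Real.rpow_le_one hx0 h (by positivity)).trans (by linarith)
            · refine (Real.rpow_le_rpow_of_exponent_le h h2p).trans ?_
              rw [Real.rpow_one]; linarith
          have h4 := Real.rpow_nonneg (modeNorm_nonneg k) (2 * σ - 4 * α)
          calc modeNorm k ^ (2 * σ - 4 * α) * (A * T ^ (-α) * m k ω) ^ 2
              = (A * T ^ (-α)) ^ 2 * (modeNorm k ^ (2 * σ - 4 * α) * m k ω ^ 2) := by ring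
            _ ≤ _ := by gcongr
    · refine ⟨fun k t => ?_, fun t => ?_, fun k => ?_, fun k => 0, fun k => le_rfl,
        fun k s t => ?_, ?_⟩ <;> simp [hB, if_neg hω]
  · have h1 : τ t = t / T := by
      rw [hτ]
      exact congrArg Subtype.val (Set.projIcc_of_mem zero_le_one
        ⟨div_nonneg ht.1 hT.le, (div_le_one hT).2 ht.2⟩)
    have h2 := ae_dyadicLim_eq hp0 (hα.trans hαH) hc (hYm k) (hYmom k) (hτ1 t).1 (hBm k t) (by
      filter_upwards [hGae] with ω hω using hlim ω hω k t)
    filter_upwards [h2] with ω hω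
    rw [hω, hY, h1]
    simp only [mul_div_cancel₀ _ hT.ne']

/-! ### The stochastic convolution -/

theorem mul_integral_exp_neg {l : ℝ} (hl : 0 < l) (t : ℝ) :
    l * ∫ r in (0 : ℝ)..t, Real.exp (-(l * r)) = 1 - Real.exp (-(l * t)) := by
  have h1 : ∀ r ∈ Set.uIcc 0 t, HasDerivAt (fun r => -(l⁻¹ * Real.exp (-(l * r))))
      (Real.exp (-(l * r))) r := by
    intro r _
    have := ((((hasDerivAt_id r).const_mul l).neg.exp).const_mul l⁻¹).neg
    simp only [id_eq, mul_one] at this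
    refine this.congr_deriv ?_
    rw [mul_neg, mul_neg, neg_neg, mul_left_comm, inv_mul_cancel₀ hl.ne', mul_one]
    rfl
  rw [intervalIntegral.integral_eq_sub_of_hasDerivAt h1
    (Continuous.intervalIntegrable (by fun_prop) _ _)]
  simp only [mul_zero, neg_zero, Real.exp_zero]
  field_simp
  ring

/-- The left side is ∫ e^{-l(t-s)} df(s) after integration by parts. Rewritten through increments
f(t) - f(t-r), it gains l^{-α} because e^{-lr} r^α ≤ l^{-α}. -/
theorem norm_sub_duhamel_le {α l a : ℝ} (hα : 0 < α) (hα1 : α ≤ 1) (hl : 0 < l) (ha : 0 ≤ a)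
    {f : ℝ → ℂ} (hf0 : f 0 = 0) (hf : ∀ s t, ‖f t - f s‖ ≤ a * |t - s| ^ α) {t : ℝ} (ht : 0 ≤ t) :
    ‖f t - l * duhamel l f t‖ ≤ 5 * (l ^ (-α) * a) := by
  have hfc : Continuous f := continuous_of_holder hα hf
  have hexp : ∀ {c r : ℝ}, 0 < c → 0 ≤ r → Real.exp (-(c * r)) * r ^ α ≤ c ^ (-α) := by
    intro c r hc hr
    have h1 := rpow_mul_exp_neg_le_one (x := c * r) (by positivity) hα.le hα1
    rw [Real.mul_rpow hc.le hr] at h1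
    rw [Real.rpow_neg hc.le, ← one_div, le_div_iff₀ (by positivity)]
    linarith
  have e : f t - l * duhamel l f t = (Real.exp (-(l * t)) : ℂ) * f t +
      l * ∫ r in (0 : ℝ)..t, (Real.exp (-(l * r)) : ℂ) * (f t - f (t - r)) := by
    have h1 := congrArg (fun x : ℝ => (x : ℂ)) (mul_integral_exp_neg hl t)
    simp only [Complex.ofReal_mul, Complex.ofReal_sub, Complex.ofReal_one,
      ← intervalIntegral.integral_ofReal] at h1
    have h2 : ∫ r in (0 : ℝ)..t, (Real.exp (-(l * r)) : ℂ) * (f t - f (t - r)) =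
        (∫ r in (0 : ℝ)..t, (Real.exp (-(l * r)) : ℂ)) * f t - duhamel l f t := by
      rw [duhamel, ← intervalIntegral.integral_mul_const, ← intervalIntegral.integral_sub]
      · simp only [mul_sub]
      · exact Continuous.intervalIntegrable (by fun_prop) _ _
      · exact (continuous_duhamel_integrand l hfc t).intervalIntegrable _ _
    rw [h2]
    linear_combination (-f t) * h1
  have hft : ‖f t‖ ≤ a * t ^ α := by
    have := hf 0 t
    rwa [hf0, sub_zero, sub_zero, abs_of_nonneg ht] at this
  have b1 : ‖(Real.exp (-(l * t)) : ℂ) * f t‖ ≤ l ^ (-α) * a := by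
    rw [norm_mul, Complex.norm_real, Real.norm_of_nonneg (Real.exp_nonneg _)]
    calc _ ≤ Real.exp (-(l * t)) * (a * t ^ α) := by gcongr
      _ = (Real.exp (-(l * t)) * t ^ α) * a := by ring
      _ ≤ _ := by gcongr; exact hexp hl ht
  have b2 : ‖∫ r in (0 : ℝ)..t, (Real.exp (-(l * r)) : ℂ) * (f t - f (t - r))‖ ≤
      ∫ r in (0 : ℝ)..t, (a * (l / 2) ^ (-α)) * Real.exp (-(l / 2 * r)) := by
    refine intervalIntegral.norm_integral_le_of_norm_le ht
      (Filter.Eventually.of_forall fun r hr => ?_)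
      (Continuous.intervalIntegrable (by fun_prop) _ _)
    rw [norm_mul, Complex.norm_real, Real.norm_of_nonneg (Real.exp_nonneg _)]
    have h1 := hf (t - r) t
    rw [sub_sub_cancel, abs_of_pos hr.1] at h1
    -- One half of the exponential absorbs r^α, the other stays integrable with mass of order 1/l.
    have h2 : Real.exp (-(l * r)) = Real.exp (-(l / 2 * r)) * Real.exp (-(l / 2 * r)) := by
      rw [← Real.exp_add]; congr 1; ring
    rw [h2]
    calc _ ≤ Real.exp (-(l / 2 * r)) * Real.exp (-(l / 2 * r)) * (a * r ^ α) := by gcongr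
      _ = a * (Real.exp (-(l / 2 * r)) * r ^ α) * Real.exp (-(l / 2 * r)) := by ring
      _ ≤ _ := by gcongr; exact hexp (half_pos hl) hr.1.le
  have b3 : l * ∫ r in (0 : ℝ)..t, (a * (l / 2) ^ (-α)) * Real.exp (-(l / 2 * r)) ≤
      4 * (l ^ (-α) * a) := by
    have h1 := mul_integral_exp_neg (half_pos hl) t
    have h2 : (l / 2) ^ (-α) ≤ 2 * l ^ (-α) := by
      rw [Real.div_rpow hl.le (by norm_num), Real.rpow_neg (by norm_num : (0 : ℝ) ≤ 2), div_inv_eq_mul,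
        mul_comm]
      gcongr
      calc (2 : ℝ) ^ α ≤ 2 ^ (1 : ℝ) := Real.rpow_le_rpow_of_exponent_le (by norm_num) hα1
        _ = 2 := Real.rpow_one 2
    rw [intervalIntegral.integral_const_mul]
    have h3 : l * ∫ r in (0 : ℝ)..t, Real.exp (-(l / 2 * r)) ≤ 2 := by
      have := Real.exp_nonneg (-(l / 2 * t))
      linarith
    calc _ = a * (l / 2) ^ (-α) * (l * ∫ r in (0 : ℝ)..t, Real.exp (-(l / 2 * r))) := by ring
      _ ≤ a * (2 * l ^ (-α)) * 2 := by
        have h4 : 0 ≤ l * ∫ r in (0 : ℝ)..t, Real.exp (-(l / 2 * r)) :=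
          mul_nonneg hl.le (intervalIntegral.integral_nonneg ht fun r _ => Real.exp_nonneg _)
        gcongr
      _ = _ := by ring
  rw [e]
  refine (norm_add_le _ _).trans ?_
  rw [norm_mul (l : ℂ), Complex.norm_real, Real.norm_of_nonneg hl.le]
  have b4 := mul_le_mul_of_nonneg_left b2 hl.le
  linarith

/-- The `k`-th coefficient of the solution of the linear equation with initial value `v₀`. -/
def linearCoeff (c : ℂ) (f : ℝ → ℂ) (l t : ℝ) : ℂ :=
  (Real.exp (-(l * t)) : ℂ) * c + (f t - l * duhamel l f t)

theorem duhamel_neg_conj (l : ℝ) {f g : ℝ → ℂ} (hfg : ∀ t, g t = -conj (f t)) (t : ℝ) :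
    duhamel l g t = -conj (duhamel l f t) := by
  rw [duhamel, duhamel, intervalIntegral, intervalIntegral, map_sub, ← integral_conj,
    ← integral_conj, neg_sub, ← neg_sub_neg, ← integral_neg, ← integral_neg, sub_eq_sub_iff_add_eq_add]
  simp only [hfg, mul_neg, neg_neg, map_mul, Complex.conj_ofReal]

theorem modeNorm_sq_rpow (k : ℤ × ℤ) (α : ℝ) :
    (modeNorm k ^ 2) ^ α = modeNorm k ^ (2 * α) := by
  rw [← Real.rpow_natCast, ← Real.rpow_mul (modeNorm_nonneg k)]; norm_num

/-- The bound |k|^{-2α} a_k for the convolution is uniform in t and square summable with weight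
|k|^{2σ}, which gives membership in ℋ^σ and, by dominated convergence, continuity. -/
theorem exists_linear_path {α σ : ℝ} (hα : 0 < α) (hα1 : α ≤ 1) {T : ℝ}
    (v₀ : HSob σ) {B : ℤ × ℤ → ℝ → ℂ} (hB : IsRegularPath α σ B) :
    ∃ g : C(Set.Icc (0 : ℝ) T, HSob σ), ∀ (t : Set.Icc (0 : ℝ) T) k,
      (g t).coeff k = linearCoeff (v₀.coeff k) (B k) (modeNorm k ^ 2) t := by
  obtain ⟨a, ha, hhol, hsum⟩ := hB.holder
  set A : ℤ × ℤ → ℝ := fun k => ‖v₀.coeff k‖ + 5 * (modeNorm k ^ (2 * -α) * a k) with hA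
  have hbound : ∀ (t : Set.Icc (0 : ℝ) T) k,
      ‖linearCoeff (v₀.coeff k) (B k) (modeNorm k ^ 2) t‖ ≤ A k := by
    intro t k
    rw [linearCoeff]
    refine (norm_add_le _ _).trans (add_le_add ?_ ?_)
    · rw [norm_mul, Complex.norm_real, Real.norm_of_nonneg (Real.exp_nonneg _)]
      refine mul_le_of_le_one_left (norm_nonneg _) (Real.exp_le_one_iff.2 ?_)
      have := mul_nonneg (sq_nonneg (modeNorm k)) t.2.1
      linarith
    · by_cases hk : k = 0
      · subst hk
        have h1 : duhamel (modeNorm 0 ^ 2) (B 0) t = 0 := by simp [duhamel, hB.zero]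
        rw [h1, hB.zero, mul_zero, sub_zero, norm_zero]
        have := ha 0
        have := Real.rpow_nonneg (modeNorm_nonneg 0) (2 * -α)
        positivity
      · rw [← modeNorm_sq_rpow]
        exact norm_sub_duhamel_le hα hα1 (pow_pos (modeNorm_pos hk) 2) (ha k) (hB.initial k)
          (hhol k) t.2.1
  have hAsum : Summable fun k => modeNorm k ^ (2 * σ) * A k ^ 2 := by
    refine Summable.of_nonneg_of_le (fun k => mul_nonneg (Real.rpow_nonneg (modeNorm_nonneg k) _)
      (sq_nonneg _)) (fun k => ?_) ((v₀.isSobolev.2.2.mul_left 2).add (hsum.mul_left 50))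
    by_cases hk : k = 0
    · subst hk
      have h0 : modeNorm 0 = 0 := modeNorm_zero
      have h1 : A 0 = 0 := by
        simp only [hA, h0, v₀.coeff_zero_mode, Real.zero_rpow (by linarith : 2 * -α ≠ 0)]
        simp
      rw [h1]
      have h2 := Real.rpow_nonneg (modeNorm_nonneg 0) (2 * σ)
      have h3 := Real.rpow_nonneg (modeNorm_nonneg 0) (2 * σ - 4 * α)
      rw [sq, mul_zero, mul_zero]
      exact add_nonneg (mul_nonneg zero_le_two (mul_nonneg h2 (sq_nonneg _)))
        (mul_nonneg (by norm_num) (mul_nonneg h3 (sq_nonneg _)))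
    · have hkp := modeNorm_pos hk
      have h1 : modeNorm k ^ (2 * σ - 4 * α) = modeNorm k ^ (2 * σ) * (modeNorm k ^ (2 * -α)) ^ 2 := by
        rw [← Real.rpow_natCast (modeNorm k ^ (2 * -α)), ← Real.rpow_mul hkp.le,
          ← Real.rpow_add hkp]
        congr 1; push_cast; ring
      rw [h1]
      set x := ‖v₀.coeff k‖
      set y := modeNorm k ^ (2 * -α) * a k with hy
      have h2 : A k ^ 2 ≤ 2 * x ^ 2 + 50 * y ^ 2 := by
        simp only [hA]; nlinarith [sq_nonneg (x - 5 * y)]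
      have h3 := Real.rpow_nonneg hkp.le (2 * σ)
      calc _ ≤ modeNorm k ^ (2 * σ) * (2 * x ^ 2 + 50 * y ^ 2) := by gcongr
        _ = _ := by rw [hy]; ring
  have hmem : ∀ t : Set.Icc (0 : ℝ) T, sobSq σ (emod fun k =>
      linearCoeff (v₀.coeff k) (B k) (modeNorm k ^ 2) t) < ∞ := by
    intro t
    rw [← summable_iff_sobSq_lt_top]
    refine Summable.of_nonneg_of_le (fun k => mul_nonneg (Real.rpow_nonneg (modeNorm_nonneg k) _)
      (sq_nonneg _)) (fun k => ?_) hAsum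
    have h3 := Real.rpow_nonneg (modeNorm_nonneg k) (2 * σ)
    gcongr
    exact hbound t k
  set g : Set.Icc (0 : ℝ) T → HSob σ := fun t => HSob.mk
    (fun k => linearCoeff (v₀.coeff k) (B k) (modeNorm k ^ 2) t)
    (by simp [linearCoeff, duhamel, hB.zero, v₀.coeff_zero_mode])
    (fun k => by
      simp only [linearCoeff]
      rw [modeNorm_neg, duhamel_neg_conj _ (hB.neg k), hB.neg, v₀.coeff_neg_mode]
      simp only [map_add, map_sub, map_mul, Complex.conj_ofReal]
      ring) (hmem t)
  refine ⟨⟨g, HSob.continuous_of_dominated (fun k => ?_) hbound hAsum⟩, fun t k => rfl⟩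
  have hc := continuous_of_holder hα (hhol k)
  have hd := continuous_duhamel (modeNorm k ^ 2) hc
  simp only [g, HSob.coeff_mk, linearCoeff]
  fun_prop

theorem measurable_linearCoeff {Ω : Type*} [MeasurableSpace Ω] (c : ℂ) {f : Ω → ℝ → ℂ}
    (hf : ∀ t, Measurable fun ω => f ω t) (hfc : ∀ ω, Continuous (f ω)) (l t : ℝ) :
    Measurable fun ω => linearCoeff c (f ω) l t := by
  have h1 : Measurable fun p : Ω × ℝ => (Real.exp (-(l * p.2)) : ℂ) * f p.1 (t - p.2) := by
    have h2 : Measurable (Function.uncurry fun (s : ℝ) (ω : Ω) => f ω s) :=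
      measurable_uncurry_of_continuous_of_measurable hfc hf
    have h3 : Measurable fun p : Ω × ℝ => f p.1 (t - p.2) :=
      h2.comp (f := fun p : Ω × ℝ => (t - p.2, p.1)) (by fun_prop)
    exact (by fun_prop : Measurable fun p : Ω × ℝ => (Real.exp (-(l * p.2)) : ℂ)).mul h3
  have h4 : Measurable fun ω => duhamel l (f ω) t := by
    unfold duhamel intervalIntegral
    exact (h1.stronglyMeasurable.integral_prod_right.measurable).sub
      (h1.stronglyMeasurable.integral_prod_right.measurable)
  unfold linearCoeff
  exact measurable_const.add ((hf t).sub (measurable_const.mul h4))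

/-! ### Mild and weak solutions -/

/-- The noise f is not differentiable, but the solution minus f is, and its derivative is the drift.
-/
theorem linearCoeff_sub_duhamel {f h : ℝ → ℂ} (hf : Continuous f) (hh : Continuous h) (c : ℂ) (l t : ℝ) :
    linearCoeff c f l t - duhamel l h t - c +
      ∫ s in (0 : ℝ)..t, (l * (linearCoeff c f l s - duhamel l h s) + h s) = f t := by
  set q : ℝ → ℂ := fun t => (Real.exp (-(l * t)) : ℂ) * c - l * duhamel l f t - duhamel l h t
    with hq
  have hd : ∀ s, HasDerivAt q (-(l * (linearCoeff c f l s - duhamel l h s) + h s)) s := by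
    intro s
    have d1 : HasDerivAt (fun τ : ℝ => ((Real.exp (-(l * τ)) : ℝ) : ℂ))
        ((Real.exp (-(l * s)) * -l : ℝ) : ℂ) s := by
      have := ((hasDerivAt_id s).const_mul l).neg.exp
      simp only [id_eq, mul_one] at this
      exact this.ofReal_comp
    have d2 := ((d1.mul_const c).sub ((hasDerivAt_duhamel l hf s).const_mul (l : ℂ))).sub
      (hasDerivAt_duhamel l hh s)
    refine d2.congr_deriv ?_
    rw [linearCoeff]
    push_cast
    ring
  have hdf := continuous_duhamel l hf
  have hdh := continuous_duhamel l hh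
  have hc : Continuous fun s => -(l * (linearCoeff c f l s - duhamel l h s) + h s) := by
    unfold linearCoeff
    fun_prop
  have h1 := intervalIntegral.integral_eq_sub_of_hasDerivAt (a := 0) (b := t) (fun s _ => hd s)
    (hc.intervalIntegrable _ _)
  rw [intervalIntegral.integral_neg] at h1
  have h2 : q 0 = c := by simp [hq]
  rw [h2] at h1
  have h3 : linearCoeff c f l t - duhamel l h t = q t + f t := by rw [linearCoeff, hq]; ring
  rw [h3]
  linear_combination -h1

/-- The integral equation makes d differentiable; the integrating factor e^{lt} then gives a
function with zero derivative. -/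
theorem eq_neg_duhamel {d h : ℝ → ℂ} (hd : Continuous d) (hh : Continuous h) (l : ℝ) {T : ℝ}
    (H : ∀ t ∈ Set.Icc 0 T, d t + ∫ s in (0 : ℝ)..t, (l * d s + h s) = 0) :
    ∀ t ∈ Set.Icc 0 T, d t = -duhamel l h t := by
  set E : ℝ → ℂ := fun t => -∫ s in (0 : ℝ)..t, (l * d s + h s) with hE
  have hdE : ∀ t ∈ Set.Icc 0 T, d t = E t := fun t ht => eq_neg_of_add_eq_zero_left (H t ht)
  have hE' : ∀ t, HasDerivAt E (-(l * d t + h t)) t := fun t =>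
    ((by fun_prop : Continuous fun s => (l : ℂ) * d s + h s).integral_hasStrictDerivAt 0
      t).hasDerivAt.neg
  set φ : ℝ → ℂ := fun t => (Real.exp (l * t) : ℂ) * (E t + duhamel l h t) with hφ
  have hφ' : ∀ t ∈ Set.Icc 0 T, HasDerivAt φ 0 t := by
    intro t ht
    have d1 : HasDerivAt (fun τ : ℝ => ((Real.exp (l * τ) : ℝ) : ℂ))
        ((Real.exp (l * t) * l : ℝ) : ℂ) t := by
      have := ((hasDerivAt_id t).const_mul l).exp
      simp only [id_eq, mul_one] at this
      exact this.ofReal_comp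
    refine (d1.mul ((hE' t).add (hasDerivAt_duhamel l hh t))).congr_deriv ?_
    rw [hdE t ht]
    simp only [Pi.add_apply]
    push_cast
    ring
  have hc := constant_of_has_deriv_right_zero (f := φ) (a := 0) (b := T)
    (fun t ht => (hφ' t ht).continuousAt.continuousWithinAt)
    (fun t ht => (hφ' t (Set.Ico_subset_Icc_self ht)).hasDerivWithinAt)
  intro t ht
  have h1 := hc t ht
  have h2 : φ 0 = 0 := by simp [hφ, hE]
  rw [h2, hφ, mul_eq_zero] at h1
  have h3 : E t + duhamel l h t = 0 := h1.resolve_left (by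
    exact_mod_cast (Real.exp_pos (l * t)).ne')
  rw [hdE t ht]
  exact eq_neg_of_add_eq_zero_left h3

theorem tsum_enorm_mul_sq_le (r : ℝ) (u φ : ℤ × ℤ → ℂ) (hφ : φ 0 = 0) :
    (∑' k, ‖u k‖ₑ * ‖φ k‖ₑ) ^ 2 ≤ sobSq (-r) (emod u) * sobSq r (emod φ) := by
  refine le_trans (le_of_eq ?_) ((tsum_mul_sq_le
    (fun k => ENNReal.ofReal (modeNorm k ^ (-r)) * emod u k)
    (fun k => ENNReal.ofReal (modeNorm k ^ r) * emod φ k)).trans (le_of_eq ?_))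
  · congr 1
    refine tsum_congr fun k => ?_
    by_cases hk : k = 0
    · simp [hk, hφ, emod]
    · have h1 : ENNReal.ofReal (modeNorm k ^ (-r)) * ENNReal.ofReal (modeNorm k ^ r) = 1 := by
        rw [← ENNReal.ofReal_mul (Real.rpow_nonneg (modeNorm_nonneg k) _),
          ← Real.rpow_add (modeNorm_pos hk)]
        simp
      rw [mul_mul_mul_comm, h1, one_mul]
      rfl
  · simp only [sq_ofReal_rpow_mul, sobSq]

/-- One bound K serves a whole ball of the dual space, hence all times on a bounded path; this
justifies exchanging the sum over modes with the time integral. -/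
theorem exists_sum_norm_mul_le {C : ℝ≥0∞} (hC : C < ∞) {r : ℝ} (φ : HSob r) :
    ∃ K : ℝ, ∀ u : ℤ × ℤ → ℂ, sobSq (-r) (emod u) ≤ C →
      (Summable fun k => u k * conj (φ.coeff k)) ∧
      ∀ s : Finset (ℤ × ℤ), ∑ k ∈ s, ‖u k * conj (φ.coeff k)‖ ≤ K := by
  have hφ : sobSq r (emod φ.coeff) < ∞ := (summable_iff_sobSq_lt_top r _).1 φ.isSobolev.2.2
  have hfin : C * sobSq r (emod φ.coeff) < ∞ := ENNReal.mul_lt_top hC hφ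
  refine ⟨Real.sqrt (C * sobSq r (emod φ.coeff)).toReal, fun u hu => ?_⟩
  have h1 : (∑' k, ‖u k‖ₑ * ‖φ.coeff k‖ₑ) ^ 2 ≤ C * sobSq r (emod φ.coeff) :=
    (tsum_enorm_mul_sq_le r u φ.coeff φ.coeff_zero_mode).trans (by gcongr)
  have h2 : ∀ s : Finset (ℤ × ℤ), ∑ k ∈ s, ‖u k * conj (φ.coeff k)‖ ≤
      Real.sqrt (C * sobSq r (emod φ.coeff)).toReal := by
    intro s
    refine Real.le_sqrt_of_sq_le ?_
    rw [← ENNReal.ofReal_le_iff_le_toReal hfin.ne, ENNReal.ofReal_pow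
      (Finset.sum_nonneg fun _ _ => norm_nonneg _), ENNReal.ofReal_sum_of_nonneg
      (fun _ _ => norm_nonneg _)]
    refine le_trans ?_ h1
    gcongr
    refine le_trans (le_of_eq ?_) (ENNReal.sum_le_tsum s)
    refine Finset.sum_congr rfl fun k _ => ?_
    rw [norm_mul, Complex.norm_conj, ENNReal.ofReal_mul (norm_nonneg _), ofReal_norm, ofReal_norm]
  exact ⟨.of_norm (summable_of_sum_le (fun _ => norm_nonneg _) h2), h2⟩

theorem hasSum_intervalIntegral {ι : Type*} [Countable ι] {F : ι → ℝ → ℂ}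
    (hF : ∀ i, Continuous (F i)) {t K : ℝ} (ht : 0 ≤ t)
    (hK : ∀ s ∈ Set.Icc 0 t, ∀ J : Finset ι, ∑ i ∈ J, ‖F i s‖ ≤ K) :
    HasSum (fun i => ∫ s in (0 : ℝ)..t, F i s) (∫ s in (0 : ℝ)..t, ∑' i, F i s) := by
  simp only [intervalIntegral.integral_of_le ht]
  refine hasSum_integral_of_summable_integral_norm
    (fun i => ((hF i).intervalIntegrable 0 t).1) ?_
  refine summable_of_sum_le (c := ∫ s in (0 : ℝ)..t, K)
    (fun i => integral_nonneg fun _ => norm_nonneg _) fun J => ?_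
  rw [← integral_finsetSum _ (fun i _ => ((hF i).norm.intervalIntegrable 0 t).1),
    ← intervalIntegral.integral_of_le ht]
  exact intervalIntegral.integral_mono_on ht
    (Continuous.intervalIntegrable (by fun_prop) _ _) (by simp) (fun s hs => hK s hs J)

theorem continuous_coeff {σ : ℝ} (hσ : 0 ≤ σ) {x : ℝ → HSob σ} (hx : Continuous x) (k : ℤ × ℤ) :
    Continuous fun s => (x s).coeff k :=
  (HSob.coeffL σ hσ k).continuous.comp hx

theorem sobSq_stokes_le {σ : ℝ} (v : HSob σ) :
    sobSq (-(2 - σ)) (emod (stokes v.coeff)) ≤ ‖v‖ₑ ^ 2 := by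
  rw [HSob.enorm_sq]
  refine ENNReal.tsum_le_tsum fun k => ?_
  by_cases hk : k = 0
  · simp [hk, emod, stokes, v.coeff_zero_mode]
  · have hkp := modeNorm_pos hk
    simp only [emod, stokes]
    rw [enorm_mul, enorm_neg, mul_pow, ← mul_assoc, ← ofReal_norm (_ : ℂ), Complex.norm_real,
      Real.norm_of_nonneg (sq_nonneg _), ← ENNReal.ofReal_pow (sq_nonneg _),
      ← ENNReal.ofReal_mul (Real.rpow_nonneg hkp.le _), ← Real.rpow_natCast,
      ← Real.rpow_natCast (modeNorm k), ← Real.rpow_mul hkp.le, ← Real.rpow_add hkp]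
    refine le_of_eq ?_
    congr 3
    push_cast; ring

/-- Since 2 - σ exceeds 1 + (1-σ)² by σ(1-σ), the test space ℋ^{2-σ} is smooth enough to pair with
B(v,v). -/
theorem exists_sobSq_nonlin_self_le {σ : ℝ} (hσ : 0 < σ) (hσ1 : σ < 1) : ∃ C : ℝ≥0∞, C < ∞ ∧
    ∀ v : HSob σ, sobSq (-(2 - σ)) (emod (nonlin v.coeff v.coeff)) ≤
      C * (‖v‖ₑ ^ 2 * ‖v‖ₑ ^ 2) := by
  obtain ⟨C, hC, H⟩ := exists_sobSq_nonlin_le (admissible_self hσ)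
  refine ⟨C, hC, fun v => ?_⟩
  rw [HSob.enorm_sq]
  refine le_trans (sobSq_mono_exponent (by nlinarith) ?_)
    (H _ _ v.coeff_zero_mode v.coeff_zero_mode)
  simp [emod, nonlin_zero]

/-- The coefficientwise equation, with `w` in place of the noise, implies
the weak equation. -/
theorem weak_of_coeff {σ : ℝ} (hσ : 0 < σ) (hσ1 : σ < 1) {x : ℝ → HSob σ} (hx : Continuous x)
    (v₀ : HSob σ) {t : ℝ} (ht : 0 ≤ t) {w : ℤ × ℤ → ℂ}
    (h : ∀ k, (x t).coeff k - v₀.coeff k + ∫ s in (0 : ℝ)..t, (((modeNorm k ^ 2 : ℝ) : ℂ) *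
      (x s).coeff k + nonlin (x s).coeff (x s).coeff k) = w k) (φ : HSob (2 - σ)) :
    bracket (x t - v₀).coeff φ.coeff
      - (∫ s in (0 : ℝ)..t, bracket (stokes (x s).coeff) φ.coeff)
      + (∫ s in (0 : ℝ)..t, bracket (nonlin (x s).coeff (x s).coeff) φ.coeff)
      = bracket w φ.coeff := by
  obtain ⟨R, hR⟩ := (isCompact_Icc (a := (0 : ℝ)) (b := t)).exists_bound_of_continuousOn
    hx.continuousOn
  have hRe : ∀ s ∈ Set.Icc 0 t, ‖x s‖ₑ ≤ ENNReal.ofReal R := fun s hs => by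
    rw [← ofReal_norm]; exact ENNReal.ofReal_le_ofReal (hR s hs)
  have hcx := fun k => continuous_coeff hσ.le hx k
  have hcn := fun k => continuous_nonlin_comp hσ hσ1 k hx
  obtain ⟨C, hC, hN⟩ := exists_sobSq_nonlin_self_le hσ hσ1
  have s1 : HasSum (fun k => (x t - v₀).coeff k * conj (φ.coeff k))
      (bracket (x t - v₀).coeff φ.coeff) := by
    have hlt : sobSq (-(2 - σ)) (emod (x t - v₀).coeff) < ∞ :=
      (sobSq_mono_exponent (by linarith) (by simp [emod, HSob.coeff_zero_mode])).trans_lt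
        ((summable_iff_sobSq_lt_top σ _).1 (x t - v₀).isSobolev.2.2)
    obtain ⟨K, hK⟩ := exists_sum_norm_mul_le hlt φ
    exact (hK _ le_rfl).1.hasSum
  have s2 : HasSum (fun k => ∫ s in (0 : ℝ)..t, stokes (x s).coeff k * conj (φ.coeff k))
      (∫ s in (0 : ℝ)..t, bracket (stokes (x s).coeff) φ.coeff) := by
    obtain ⟨K, hK⟩ := exists_sum_norm_mul_le
      (C := ENNReal.ofReal R ^ 2) (ENNReal.pow_lt_top ENNReal.ofReal_lt_top) φ
    refine hasSum_intervalIntegral (fun k => ?_) ht fun s hs => (hK _ ?_).2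
    · unfold stokes
      have := hcx k
      fun_prop
    · refine (sobSq_stokes_le (x s)).trans ?_
      gcongr
      exact hRe s hs
  have s3 : HasSum (fun k => ∫ s in (0 : ℝ)..t, nonlin (x s).coeff (x s).coeff k *
      conj (φ.coeff k)) (∫ s in (0 : ℝ)..t, bracket (nonlin (x s).coeff (x s).coeff) φ.coeff) := by
    obtain ⟨K, hK⟩ := exists_sum_norm_mul_le
      (C := C * (ENNReal.ofReal R ^ 2 * ENNReal.ofReal R ^ 2)) (ENNReal.mul_lt_top hC
        (ENNReal.mul_lt_top (ENNReal.pow_lt_top ENNReal.ofReal_lt_top)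
          (ENNReal.pow_lt_top ENNReal.ofReal_lt_top))) φ
    refine hasSum_intervalIntegral (fun k => (hcn k).mul continuous_const) ht
      fun s hs => (hK _ ?_).2
    refine (hN (x s)).trans ?_
    gcongr <;> exact hRe s hs
  have s4 := (s1.sub s2).add s3
  rw [← s4.tsum_eq, bracket]
  refine tsum_congr fun k => ?_
  have i1 : IntervalIntegrable (fun s => ((modeNorm k ^ 2 : ℝ) : ℂ) * (x s).coeff k) volume 0 t :=
    (continuous_const.mul (hcx k)).intervalIntegrable _ _
  rw [← h k, intervalIntegral.integral_mul_const, intervalIntegral.integral_mul_const,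
    intervalIntegral.integral_add i1 ((hcn k).intervalIntegrable _ _)]
  have e : ∫ s in (0 : ℝ)..t, stokes (x s).coeff k =
      -∫ s in (0 : ℝ)..t, ((modeNorm k ^ 2 : ℝ) : ℂ) * (x s).coeff k := by
    rw [← intervalIntegral.integral_neg]
    simp only [stokes, neg_mul]
  rw [e, HSob.coeff_sub]
  ring

/-! ### Existence and uniqueness of solutions -/

open Classical in
/-- The field with coefficients `a` at `k` and `-conj a` at `-k`. -/
def singleMode (r : ℝ) {k : ℤ × ℤ} (hk : k ≠ 0) (a : ℂ) : HSob r :=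
  HSob.mk (fun j => if j = k then a else if j = -k then -conj a else 0)
    (by rw [if_neg hk.symm, if_neg (by simpa [eq_comm] using hk)])
    (fun j => by
      have h2 : k ≠ -k := fun h => hk (self_eq_neg.1 h)
      by_cases h3 : j = k
      · rw [h3, if_neg h2.symm, if_pos rfl, if_pos rfl]
      · by_cases h4 : j = -k
        · rw [h4, neg_neg, if_pos rfl, if_neg h2.symm, if_pos rfl]; simp
        · rw [if_neg (fun h => h4 (by rw [← h, neg_neg])), if_neg (fun h => h3 (neg_injective h)),
            if_neg h3, if_neg h4]; simp)
    ((summable_iff_sobSq_lt_top r _).1 (summable_of_ne_finset_zero (s := {k, -k}) fun j hj => by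
      simp only [Finset.mem_insert, Finset.mem_singleton, not_or] at hj
      rw [if_neg hj.1, if_neg hj.2]; simp))

theorem bracket_singleMode (u : ℤ × ℤ → ℂ) (r : ℝ) {k : ℤ × ℤ} (hk : k ≠ 0) (a : ℂ) :
    bracket u (singleMode r hk a).coeff = u k * conj a - u (-k) * a := by
  classical
  have h2 : k ≠ -k := fun h => hk (self_eq_neg.1 h)
  rw [bracket, tsum_eq_sum (s := {k, -k}), Finset.sum_pair h2]
  · simp only [singleMode, HSob.coeff_mk, if_true, if_neg h2.symm, map_neg, Complex.conj_conj]
    ring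
  · intro j hj
    simp only [Finset.mem_insert, Finset.mem_singleton, not_or] at hj
    simp only [singleMode, HSob.coeff_mk, if_neg hj.1, if_neg hj.2, map_zero, mul_zero]

/-- The bracket with a single mode is u_k conj a - u_{-k} a; half the equation for a = 1 plus i/2
times that for a = i isolates u_k. -/
theorem coeff_of_weak {σ : ℝ} (hσ : 0 < σ) (hσ1 : σ < 1) {x : ℝ → HSob σ} (hx : Continuous x)
    (v₀ : HSob σ) {t : ℝ} {w : ℤ × ℤ → ℂ} {r : ℝ} {k : ℤ × ℤ} (hk : k ≠ 0)
    (h : ∀ a ∈ ({1, Complex.I} : Set ℂ),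
      bracket (x t - v₀).coeff (singleMode r hk a).coeff
      - (∫ s in (0 : ℝ)..t, bracket (stokes (x s).coeff) (singleMode r hk a).coeff)
      + (∫ s in (0 : ℝ)..t, bracket (nonlin (x s).coeff (x s).coeff) (singleMode r hk a).coeff)
      = bracket w (singleMode r hk a).coeff) :
    (x t).coeff k - v₀.coeff k + ∫ s in (0 : ℝ)..t, (((modeNorm k ^ 2 : ℝ) : ℂ) *
      (x s).coeff k + nonlin (x s).coeff (x s).coeff k) = w k := by
  have hcx := fun k => continuous_coeff hσ.le hx k
  have i1 : ∀ (c : ℂ) k, IntervalIntegrable (fun s => stokes (x s).coeff k * c) volume 0 t :=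
    fun c k => by
      have := hcx k
      unfold stokes
      exact Continuous.intervalIntegrable (by fun_prop) _ _
  have i2 : ∀ (c : ℂ) k, IntervalIntegrable (fun s => nonlin (x s).coeff (x s).coeff k * c)
      volume 0 t := fun c k =>
    ((continuous_nonlin_comp hσ hσ1 k hx).mul continuous_const).intervalIntegrable _ _
  have i3 := fun k => (continuous_nonlin_comp hσ hσ1 k hx).intervalIntegrable (μ := volume) 0 t
  simp only [bracket_singleMode, intervalIntegral.integral_sub (i1 _ _) (i1 _ _),
    intervalIntegral.integral_sub (i2 _ _) (i2 _ _), intervalIntegral.integral_mul_const] at h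
  have h1 := h 1 (by simp)
  have hI := h Complex.I (by simp)
  have e : ∫ s in (0 : ℝ)..t, stokes (x s).coeff k =
      -∫ s in (0 : ℝ)..t, ((modeNorm k ^ 2 : ℝ) : ℂ) * (x s).coeff k := by
    rw [← intervalIntegral.integral_neg]
    simp only [stokes, neg_mul]
  have i4 : IntervalIntegrable (fun s => ((modeNorm k ^ 2 : ℝ) : ℂ) * (x s).coeff k) volume 0 t :=
    (continuous_const.mul (hcx k)).intervalIntegrable _ _
  rw [intervalIntegral.integral_add i4 (i3 k)]
  simp only [map_one, Complex.conj_I, HSob.coeff_sub, e] at h1 hI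
  generalize (∫ s in (0 : ℝ)..t, ((modeNorm k ^ 2 : ℝ) : ℂ) * (x s).coeff k) = a₁ at h1 hI ⊢
  generalize (∫ s in (0 : ℝ)..t, stokes (x s).coeff (-k)) = a₂ at h1 hI
  generalize (∫ s in (0 : ℝ)..t, nonlin (x s).coeff (x s).coeff k) = a₃ at h1 hI ⊢
  generalize (∫ s in (0 : ℝ)..t, nonlin (x s).coeff (x s).coeff (-k)) = a₄ at h1 hI
  linear_combination (1 / 2) * h1 + (Complex.I / 2) * hI + (1 / 2) * ((x t).coeff k - v₀.coeff k +
    a₁ + a₃ - w k + (x t).coeff (-k) - v₀.coeff (-k) - a₂ + a₄ - w (-k)) * Complex.I_sq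

theorem duhamel_sub (l : ℝ) {h h' : ℝ → ℂ} (hh : Continuous h) (hh' : Continuous h') (t : ℝ) :
    duhamel l (fun s => h s - h' s) t = duhamel l h t - duhamel l h' t := by
  rw [duhamel, duhamel, duhamel, ← intervalIntegral.integral_sub
    ((continuous_duhamel_integrand l hh t).intervalIntegrable _ _)
    ((continuous_duhamel_integrand l hh' t).intervalIntegrable _ _)]
  simp only [mul_sub]

/-- Subtraction removes w. The remaining identity is continuous in time, so it extends from a dense
set of times, and Duhamel's formula returns it to mild form. -/
theorem eq_of_coeff_eq {σ : ℝ} (hσ : 0 < σ) (hσ1 : σ < 1) {T : ℝ} (hT : 0 ≤ T)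
    {x y : C(Set.Icc (0 : ℝ) T, HSob σ)} {v₀ : HSob σ} {ι : Type*} {τ : ι → Set.Icc (0 : ℝ) T}
    (hτ : DenseRange τ) {w : ι → ℤ × ℤ → ℂ}
    (hx : ∀ n k, k ≠ 0 → (x (τ n)).coeff k - v₀.coeff k + ∫ s in (0 : ℝ)..(τ n : ℝ),
      (((modeNorm k ^ 2 : ℝ) : ℂ) * (Set.IccExtend hT x s).coeff k +
        nonlin (Set.IccExtend hT x s).coeff (Set.IccExtend hT x s).coeff k) = w n k)
    (hy : ∀ n k, k ≠ 0 → (y (τ n)).coeff k - v₀.coeff k + ∫ s in (0 : ℝ)..(τ n : ℝ),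
      (((modeNorm k ^ 2 : ℝ) : ℂ) * (Set.IccExtend hT y s).coeff k +
        nonlin (Set.IccExtend hT y s).coeff (Set.IccExtend hT y s).coeff k) = w n k) : x = y := by
  have hxc : Continuous (Set.IccExtend hT x) := x.continuous.Icc_extend'
  have hyc : Continuous (Set.IccExtend hT y) := y.continuous.Icc_extend'
  refine eq_of_sub_eq_volterraInt hT hσ hσ1 fun t => HSob.ext fun k => ?_
  by_cases hk : k = 0
  · rw [hk, HSob.coeff_zero_mode, HSob.coeff_zero_mode]
  have cx := continuous_coeff hσ.le hxc k
  have cy := continuous_coeff hσ.le hyc k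
  have nx := continuous_nonlin_comp hσ hσ1 k hxc
  have ny := continuous_nonlin_comp hσ hσ1 k hyc
  have cd : Continuous fun s => (Set.IccExtend hT x s).coeff k - (Set.IccExtend hT y s).coeff k :=
    cx.sub cy
  have nd : Continuous fun s => nonlin (Set.IccExtend hT x s).coeff (Set.IccExtend hT x s).coeff k -
      nonlin (Set.IccExtend hT y s).coeff (Set.IccExtend hT y s).coeff k := nx.sub ny
  set D : ℝ → ℂ := fun s => ((Set.IccExtend hT x s).coeff k - (Set.IccExtend hT y s).coeff k) +
    ∫ s in (0 : ℝ)..s, (((modeNorm k ^ 2 : ℝ) : ℂ) *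
      ((Set.IccExtend hT x s).coeff k - (Set.IccExtend hT y s).coeff k) +
      (nonlin (Set.IccExtend hT x s).coeff (Set.IccExtend hT x s).coeff k -
        nonlin (Set.IccExtend hT y s).coeff (Set.IccExtend hT y s).coeff k)) with hDdef
  have hDc : Continuous D := cd.add (intervalIntegral.continuous_primitive (μ := volume)
    (fun a b => ((continuous_const.mul cd).add nd).intervalIntegrable a b) 0)
  have hD : ∀ s : Set.Icc (0 : ℝ) T, D s = 0 := by
    refine congrFun (hτ.equalizer (hDc.comp continuous_subtype_val)
      (continuous_const (y := (0 : ℂ))) (funext fun n => ?_))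
    have e1 := hx n k hk
    have e2 := hy n k hk
    have i1 : IntervalIntegrable (fun s => ((modeNorm k ^ 2 : ℝ) : ℂ) *
        (Set.IccExtend hT x s).coeff k + nonlin (Set.IccExtend hT x s).coeff
          (Set.IccExtend hT x s).coeff k) volume 0 (τ n : ℝ) :=
      ((continuous_const.mul cx).add nx).intervalIntegrable _ _
    have i2 : IntervalIntegrable (fun s => ((modeNorm k ^ 2 : ℝ) : ℂ) *
        (Set.IccExtend hT y s).coeff k + nonlin (Set.IccExtend hT y s).coeff
          (Set.IccExtend hT y s).coeff k) volume 0 (τ n : ℝ) :=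
      ((continuous_const.mul cy).add ny).intervalIntegrable _ _
    have e3 := intervalIntegral.integral_sub i1 i2
    simp only [add_sub_add_comm, ← mul_sub] at e3
    simp only [Function.comp_apply, hDdef, e3, Set.IccExtend_val]
    linear_combination e1 - e2
  have h1 := eq_neg_duhamel cd nd (modeNorm k ^ 2) (T := T) (fun s hs => hD ⟨s, hs⟩) t t.2
  rw [duhamel_sub _ nx ny, Set.IccExtend_val, Set.IccExtend_val] at h1
  rw [HSob.coeff_sub, HSob.coeff_sub, volterraInt_mildKernel_coeff hσ hσ1 hT x t.2,
    volterraInt_mildKernel_coeff hσ hσ1 hT y t.2, h1]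
  ring

section Noise

variable {Ω : Type*} [MeasurableSpace Ω] {μ : Measure Ω}

/-- The exceptional set in the weak equation depends on time and test function; dense times, modes
and two amplitudes form a countable family, so one null set suffices. -/
theorem IsSolution.ae_eq {T : ℝ} (hT : 0 ≤ T) {σ : ℝ} (hσ : 0 < σ) (hσ1 : σ < 1)
    {b : halfLattice → ℝ → Ω → ℂ} {v₀ : HSob σ} {v₁ v₂ : Ω → C(Set.Icc (0 : ℝ) T, HSob σ)}
    (h₁ : IsSolution hT b μ v₀ v₁) (h₂ : IsSolution hT b μ v₀ v₂) :
    ∀ᵐ ω ∂μ, ∀ t, v₁ ω t = v₂ ω t := by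
  have : Nonempty (Set.Icc (0 : ℝ) T) := ⟨⟨0, le_rfl, hT⟩⟩
  have key : ∀ v : Ω → C(Set.Icc (0 : ℝ) T, HSob σ), IsSolution hT b μ v₀ v → ∀ᵐ ω ∂μ,
      ∀ (n : ℕ) (k : {k : ℤ × ℤ // k ≠ 0}),
      (v ω (TopologicalSpace.denseSeq _ n)).coeff k - v₀.coeff k +
        ∫ s in (0 : ℝ)..(TopologicalSpace.denseSeq (Set.Icc (0 : ℝ) T) n : ℝ),
        (((modeNorm k ^ 2 : ℝ) : ℂ) * (Set.IccExtend hT (v ω) s).coeff k +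
          nonlin (Set.IccExtend hT (v ω) s).coeff (Set.IccExtend hT (v ω) s).coeff k) =
        cylNoise b (TopologicalSpace.denseSeq (Set.Icc (0 : ℝ) T) n) ω k := by
    intro v hv
    rw [ae_all_iff]
    intro n
    rw [ae_all_iff]
    intro k
    set t := TopologicalSpace.denseSeq (Set.Icc (0 : ℝ) T) n
    filter_upwards [hv.weak t (singleMode _ k.2 1), hv.weak t (singleMode _ k.2 Complex.I)]
      with ω e1 eI
    have h3 := coeff_of_weak hσ hσ1 ((v ω).continuous.Icc_extend' (h := hT)) v₀ (t := t)
      (w := cylNoise b t ω) (r := 2 - σ) k.2 (by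
        rintro a (rfl | rfl)
        · rw [Set.IccExtend_val]; exact e1
        · rw [Set.IccExtend_val]; exact eI)
    rw [Set.IccExtend_val] at h3
    exact h3
  filter_upwards [key v₁ h₁, key v₂ h₂] with ω e1 e2
  have := eq_of_coeff_eq hσ hσ1 hT (TopologicalSpace.denseRange_denseSeq _)
    (fun n k hk => e1 n ⟨k, hk⟩) (fun n k hk => e2 n ⟨k, hk⟩)
  intro t
  rw [this]

theorem exists_isSolution [IsProbabilityMeasure μ] {H : ℝ} (hH' : H < 1)
    {b : halfLattice → ℝ → Ω → ℂ} (hb : IsComplexFBMFamily H b μ) {σ : ℝ} (hσ : 0 < σ)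
    (hσ' : σ < 2 * (H - 1 / 2)) {T : ℝ} (hT : 0 < T) (v₀ : HSob σ) :
    ∃ v : Ω → C(Set.Icc (0 : ℝ) T, HSob σ), IsSolution hT.le b μ v₀ v := by
  have hσ1 : σ < 1 := by linarith
  -- Below H for Hölder continuity, above (1+σ)/2 for summability over the two dimensional lattice.
  obtain ⟨α, hα1, hα2⟩ := exists_between (show (1 + σ) / 2 < H by linarith)
  have hα : 0 < α := by linarith
  obtain ⟨B, hB, hBm, hBX⟩ := exists_regular_version (X := cylNoise b) (measurable_cylNoise hb)
    hα hα2 (σ := σ) (by linarith)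
    (fun p hp => exists_lintegral_cylNoise_le (hα.trans hα2) hb hp) (cylNoise_neg b)
    (cylNoise_zero b) (cylNoise_time_zero (hα.trans hα2) hb) hT
  have hBc : ∀ ω k, Continuous (B ω k) := fun ω k => by
    obtain ⟨a, -, h, -⟩ := (hB ω).holder
    exact continuous_of_holder hα (h k)
  choose g hg using fun ω => exists_linear_path hα (hα2.le.trans hH'.le) (T := T) v₀ (hB ω)
  obtain ⟨S, Γ, hS, hΓ, hlim⟩ := exists_mild_solution_map hσ hσ1 hT.le
  have hgm : StronglyMeasurable g := stronglyMeasurable_path hT fun t =>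
    HSob.stronglyMeasurable_of_coeff fun k => by
      simp only [hg]
      exact measurable_linearCoeff _ (hBm k) (fun ω => hBc ω k) _ _
  have hSm : StronglyMeasurable fun ω => S (g ω) :=
    stronglyMeasurable_of_tendsto Filter.atTop
      (fun n => (hΓ n).comp_stronglyMeasurable hgm) (tendsto_pi_nhds.2 fun ω => hlim (g ω))
  have hcoeff : ∀ ω (t : Set.Icc (0 : ℝ) T) k, (S (g ω) t).coeff k =
      linearCoeff (v₀.coeff k) (B ω k) (modeNorm k ^ 2) t - duhamel (modeNorm k ^ 2)
        (fun s => nonlin (Set.IccExtend hT.le (S (g ω)) s).coeff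
          (Set.IccExtend hT.le (S (g ω)) s).coeff k) t := by
    intro ω t k
    rw [hS (g ω) t, HSob.coeff_sub, hg, volterraInt_mildKernel_coeff hσ hσ1 hT.le _ t.2]
  refine ⟨fun ω => S (g ω), fun t => ?_, Filter.Eventually.of_forall fun ω => ?_, fun t φ => ?_⟩
  · exact ((continuous_eval_const t).comp_stronglyMeasurable hSm).measurable
  · refine HSob.ext fun k => ?_
    rw [hcoeff]
    simp [linearCoeff, (hB ω).initial k]
  · filter_upwards [ae_all_iff.2 fun k => hBX k t t.2] with ω hω
    have hc : Continuous (Set.IccExtend hT.le (S (g ω))) := (S (g ω)).continuous.Icc_extend'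
    have h1 := weak_of_coeff hσ hσ1 hc v₀ t.2.1 (w := cylNoise b t ω) (fun k => by
      have h2 := linearCoeff_sub_duhamel (hBc ω k) (continuous_nonlin_comp hσ hσ1 k hc)
        (v₀.coeff k) (modeNorm k ^ 2) t
      rw [← hω k, ← h2, Set.IccExtend_val, hcoeff]
      congr 1
      refine intervalIntegral.integral_congr fun s hs => ?_
      rw [Set.uIcc_of_le t.2.1] at hs
      have h3 := hcoeff ω ⟨s, hs.1, hs.2.trans t.2.2⟩ k
      rw [← Set.IccExtend_of_mem hT.le (S (g ω)) ⟨hs.1, hs.2.trans t.2.2⟩] at h3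
      rw [h3]) φ
    rw [Set.IccExtend_val] at h1
    exact h1

end Noise

end FractionalNS

end

theorem mainTheorem3 {Ω : Type*} [MeasurableSpace Ω] (μ : Measure Ω) [IsProbabilityMeasure μ]
    (H : ℝ) (hH : 1 / 2 < H) (hH' : H < 1)
    (b : FractionalNS.halfLattice → ℝ → Ω → ℂ) (hb : FractionalNS.IsComplexFBMFamily H b μ)
    (σ : ℝ) (hσ : 0 < σ) (hσ' : σ < 2 * (H - 1 / 2))
    (T : ℝ) (hT : 0 < T) (v₀ : FractionalNS.HSob σ) :
    (∃ v : Ω → C(Set.Icc (0 : ℝ) T, FractionalNS.HSob σ),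
      FractionalNS.IsSolution hT.le b μ v₀ v) ∧
    (∀ v₁ v₂ : Ω → C(Set.Icc (0 : ℝ) T, FractionalNS.HSob σ),
      FractionalNS.IsSolution hT.le b μ v₀ v₁ → FractionalNS.IsSolution hT.le b μ v₀ v₂ →
      ∀ᵐ ω ∂μ, ∀ t, v₁ ω t = v₂ ω t) :=
  ⟨FractionalNS.exists_isSolution hH' hb hσ hσ' hT v₀, fun _ _ h₁ h₂ =>
    FractionalNS.IsSolution.ae_eq hT.le hσ (by linarith) h₁ h₂⟩
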